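/- Let $n\ge 2$ and $k\ge 1$ be integers, let $H$ be the hyperplane line bundle over $\mathbb{CP}^{n-1}$, and let $M_{n,k}=\mathbb{P}(H^k\oplus 1_{\mathbb{CP}^{n-1}})$ be the Hirzebruch manifold, i.e. the quotient of $(\mathbb{C}^n\setminus\{0\})\times(\mathbb{C}^2\setminus\{0\})$ by $(z,w_1,w_2)\sim(sz,\,t s^k w_1,\,t w_2)$, $s,t\in\mathbb{C}^*$, with the action of $U(n)$ given by $A\cdot[z;w_1,w_2]=[Az;w_1,w_2]$. For a Kähler metric $g$ with curvature tensor $R$, the holomorphic sectional curvature of a $J$-invariant real $2$-plane $\pi=\operatorname{span}\{X,JX\}$ is $H(\pi)=R(X,JX,JX,X)/\|X\|^4$, and $g$ has $H>0$ if $H(\pi)>0$ for every such plane at every point. Then the space of all $U(n)$-invariant (smooth) Kähler metrics with $H>0$ on $M_{n,k}$, with the $C^\infty$ topology, is non-empty and path-connected. -/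

import Mathlib

open scoped ContDiff Manifold Topology ComplexConjugate

noncomputable section

namespace Hirzebruch

/-! ### The Hirzebruch manifold `P(H^k ⊕ 1)` over `ℂP^{n-1}` -/

/-- Homogeneous coordinates `(z, w)`, `z ∈ ℂⁿ \ {0}`, `w ∈ ℂ² \ {0}`. The vector `z` represents
the base point `[z] ∈ ℂP^{n-1}`; `w = (w₁, w₂)` represents the line in `H^k_{[z]} ⊕ ℂ` spanned
by `(w₁, w₂)`, where `w₁` is read in the trivialisation of `H^k_{[z]}` given by `z`. -/
abbrev HomCoord (n : ℕ) : Type :=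
  {p : (Fin n → ℂ) × (ℂ × ℂ) // p.1 ≠ 0 ∧ p.2 ≠ 0}

/-- `(z, w₁, w₂) ∼ (s z, t s^k w₁, t w₂)` for `s, t ∈ ℂ*`. -/
def homSetoid (n k : ℕ) : Setoid (HomCoord n) where
  r p q := ∃ s t : ℂ, s ≠ 0 ∧ t ≠ 0 ∧ q.1.1 = s • p.1.1 ∧
    q.1.2.1 = t * s ^ k * p.1.2.1 ∧ q.1.2.2 = t * p.1.2.2
  iseqv :=
    { refl := fun p => ⟨1, 1, one_ne_zero, one_ne_zero, by simp, by simp, by simp⟩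
      symm := by
        rintro p q ⟨s, t, hs, ht, h1, h2, h3⟩
        refine ⟨s⁻¹, t⁻¹, inv_ne_zero hs, inv_ne_zero ht, ?_, ?_, ?_⟩
        · rw [h1, smul_smul, inv_mul_cancel₀ hs, one_smul]
        · rw [h2, inv_pow]; field_simp
        · rw [h3]; field_simp
      trans := by
        rintro p q r ⟨s, t, hs, ht, h1, h2, h3⟩ ⟨s', t', hs', ht', h1', h2', h3'⟩
        refine ⟨s' * s, t' * t, mul_ne_zero hs' hs, mul_ne_zero ht' ht, ?_, ?_, ?_⟩
        · rw [h1', h1, smul_smul]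
        · rw [h2', h2]; ring
        · rw [h3', h3]; ring }

/-- The Hirzebruch manifold `M_{n,k} = P(H^k ⊕ 1)`, of complex dimension `n`. -/
def HirzebruchManifold (n k : ℕ) : Type := Quotient (homSetoid n k)

instance (n k : ℕ) : TopologicalSpace (HirzebruchManifold n k) :=
  inferInstanceAs (TopologicalSpace (Quotient (homSetoid n k)))

/-- The class `[z; w₁, w₂]`. -/
def mk (n k : ℕ) (p : HomCoord n) : HirzebruchManifold n k := Quotient.mk (homSetoid n k) p

theorem isQuotientMap_mk (n k : ℕ) : Topology.IsQuotientMap (mk n k) := isQuotientMap_quotient_mk'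

theorem mk_eq {n k : ℕ} {p q : HomCoord n} {s t : ℂ} (hs : s ≠ 0) (ht : t ≠ 0)
    (h1 : q.1.1 = s • p.1.1) (h2 : q.1.2.1 = t * s ^ k * p.1.2.1)
    (h3 : q.1.2.2 = t * p.1.2.2) : mk n k p = mk n k q :=
  Quotient.sound (s := homSetoid n k) ⟨s, t, hs, ht, h1, h2, h3⟩

/-! ### The holomorphic atlas

The chart with index `(j, b)` lives over `{z_j ≠ 0}` and on `{w₂ ≠ 0}` (`b = true`) or
`{w₁ ≠ 0}` (`b = false`). Its `i`-th coordinate for `i ≠ j` is `z_i / z_j`; the `j`-th slot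
holds the fibre coordinate, `w₁ / (w₂ z_j^k)` or `z_j^k w₂ / w₁`. Every chart is onto `ℂⁿ`. -/

/-- Indices of the charts. -/
abbrev ChartIdx (n : ℕ) : Type := Fin n × Bool

/-- The homogeneous coordinate of the fibre that is non-zero on a chart. -/
def pivot {n : ℕ} (c : ChartIdx n) (p : HomCoord n) : ℂ := cond c.2 p.1.2.2 p.1.2.1

/-- The fibre coordinate of a chart. -/
def fibreCoord {n : ℕ} (k : ℕ) (c : ChartIdx n) (p : HomCoord n) : ℂ :=
  cond c.2 (p.1.2.1 / (p.1.2.2 * p.1.1 c.1 ^ k)) (p.1.1 c.1 ^ k * p.1.2.2 / p.1.2.1)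

/-- A chart in homogeneous coordinates. -/
def preChart {n : ℕ} (k : ℕ) (c : ChartIdx n) (p : HomCoord n) : Fin n → ℂ :=
  Function.update (fun i => p.1.1 i / p.1.1 c.1) c.1 (fibreCoord k c p)

/-- The inverse of a chart in homogeneous coordinates. -/
def preParam {n : ℕ} (c : ChartIdx n) (x : Fin n → ℂ) : HomCoord n :=
  ⟨(Function.update x c.1 1, cond c.2 (x c.1, 1) (1, x c.1)), by
    constructor
    · intro h
      have := congrFun h c.1
      simp at this
    · rcases c with ⟨j, _ | _⟩ <;> simp [Prod.ext_iff]⟩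

theorem preChart_congr {n k : ℕ} (c : ChartIdx n) (p q : HomCoord n)
    (h : (homSetoid n k).r p q) : preChart k c p = preChart k c q := by
  obtain ⟨s, t, hs, ht, h1, h2, h3⟩ := h
  have hfib : fibreCoord k c p = fibreCoord k c q := by
    rcases c with ⟨j, _ | _⟩ <;> simp only [fibreCoord, cond_true, cond_false] <;>
      rw [h1, h2, h3] <;> simp only [Pi.smul_apply, smul_eq_mul, mul_pow]
    · rw [show s ^ k * p.1.1 j ^ k * (t * p.1.2.2) = (t * s ^ k) * (p.1.1 j ^ k * p.1.2.2) by ring,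
        mul_div_mul_left _ _ (mul_ne_zero ht (pow_ne_zero k hs))]
    · rw [show t * p.1.2.2 * (s ^ k * p.1.1 j ^ k) = (t * s ^ k) * (p.1.2.2 * p.1.1 j ^ k) by ring,
        mul_div_mul_left _ _ (mul_ne_zero ht (pow_ne_zero k hs))]
  unfold preChart
  rw [hfib, h1]
  congr 1
  funext i
  simp only [Pi.smul_apply, smul_eq_mul]
  rw [mul_div_mul_left _ _ hs]

theorem source_congr {n k : ℕ} (c : ChartIdx n) (p q : HomCoord n)
    (h : (homSetoid n k).r p q) :
    (p.1.1 c.1 ≠ 0 ∧ pivot c p ≠ 0) = (q.1.1 c.1 ≠ 0 ∧ pivot c q ≠ 0) := by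
  obtain ⟨s, t, hs, ht, h1, h2, h3⟩ := h
  rcases c with ⟨j, _ | _⟩ <;> simp [pivot, h1, h2, h3, hs, ht]

/-- The chart map, a total function that is meaningful on `chartSource`. -/
def chartFun {n k : ℕ} (c : ChartIdx n) : HirzebruchManifold n k → (Fin n → ℂ) :=
  Quotient.lift (preChart k c) (preChart_congr c)

/-- The domain of a chart. -/
def chartSource {n k : ℕ} (c : ChartIdx n) : Set (HirzebruchManifold n k) :=
  {x | Quotient.lift (fun p : HomCoord n => p.1.1 c.1 ≠ 0 ∧ pivot c p ≠ 0) (source_congr c) x}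

@[simp] theorem chartFun_mk {n k : ℕ} (c : ChartIdx n) (p : HomCoord n) :
    chartFun c (mk n k p) = preChart k c p := rfl

theorem mk_mem_chartSource {n k : ℕ} (c : ChartIdx n) (p : HomCoord n) :
    mk n k p ∈ chartSource c ↔ (p.1.1 c.1 ≠ 0 ∧ pivot c p ≠ 0) := Iff.rfl

theorem continuous_pivot {n : ℕ} (c : ChartIdx n) : Continuous (pivot c) := by
  rcases c with ⟨j, _ | _⟩ <;> unfold pivot <;> dsimp only [cond_true, cond_false] <;> fun_prop

theorem isOpen_preSource {n : ℕ} (c : ChartIdx n) :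
    IsOpen {p : HomCoord n | p.1.1 c.1 ≠ 0 ∧ pivot c p ≠ 0} := by
  have h1 : Continuous fun p : HomCoord n => p.1.1 c.1 := by fun_prop
  exact (isOpen_ne.preimage h1).inter (isOpen_ne.preimage (continuous_pivot c))

theorem isOpen_chartSource {n k : ℕ} (c : ChartIdx n) :
    IsOpen (chartSource (k := k) c) :=
  (isQuotientMap_mk n k).isOpen_preimage.1 (isOpen_preSource c)

theorem continuous_preParam {n : ℕ} (c : ChartIdx n) : Continuous (preParam c) := by
  refine Continuous.subtype_mk ?_ _
  rcases c with ⟨j, _ | _⟩ <;> simp only [cond_true, cond_false] <;> fun_prop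

theorem continuousOn_preChart {n k : ℕ} (c : ChartIdx n) :
    ContinuousOn (preChart k c) {p | p.1.1 c.1 ≠ 0 ∧ pivot c p ≠ 0} := by
  have hz : ∀ i, Continuous fun p : HomCoord n => p.1.1 i := fun i => by fun_prop
  have hw1 : Continuous fun p : HomCoord n => p.1.2.1 := by fun_prop
  have hw2 : Continuous fun p : HomCoord n => p.1.2.2 := by fun_prop
  rw [continuousOn_pi]
  intro i
  by_cases hi : i = c.1
  · subst hi
    simp only [preChart, Function.update_self]
    rcases c with ⟨j, _ | _⟩ <;> simp only [fibreCoord, cond_true, cond_false]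
    · exact (((hz j).pow k).mul hw2).continuousOn.div hw1.continuousOn fun p hp => hp.2
    · exact hw1.continuousOn.div (hw2.mul ((hz j).pow k)).continuousOn fun p hp =>
        mul_ne_zero hp.2 (pow_ne_zero k hp.1)
  · simp only [preChart, Function.update_of_ne hi]
    exact (hz i).continuousOn.div (hz c.1).continuousOn fun p hp => hp.1

theorem preChart_preParam {n k : ℕ} (c : ChartIdx n) (x : Fin n → ℂ) :
    preChart k c (preParam c x) = x := by
  funext i
  by_cases hi : i = c.1
  · subst hi
    rcases c with ⟨j, _ | _⟩ <;> simp [preChart, preParam, fibreCoord]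
  · simp [preChart, preParam, hi]

theorem preParam_mem {n : ℕ} (c : ChartIdx n) (x : Fin n → ℂ) :
    (preParam c x).1.1 c.1 ≠ 0 ∧ pivot c (preParam c x) ≠ 0 := by
  rcases c with ⟨j, _ | _⟩ <;> simp [preParam, pivot]

theorem mk_preParam_preChart {n k : ℕ} (c : ChartIdx n) (p : HomCoord n)
    (hp : p.1.1 c.1 ≠ 0 ∧ pivot c p ≠ 0) : mk n k (preParam c (preChart k c p)) = mk n k p := by
  obtain ⟨hz, hw⟩ := hp
  have key : p.1.1 = p.1.1 c.1 • (preParam c (preChart k c p)).1.1 := by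
    funext i
    by_cases hi : i = c.1
    · subst hi; simp [preParam]
    · simp [preParam, preChart, hi]; field_simp
  rcases c with ⟨j, _ | _⟩
  · simp only [pivot, cond_false] at hz hw
    refine mk_eq (s := p.1.1 j) (t := p.1.2.1 / p.1.1 j ^ k) hz
      (div_ne_zero hw (pow_ne_zero k hz)) key ?_ ?_
    · simp [preParam]; field_simp
    · simp [preParam, preChart, fibreCoord]; field_simp
  · simp only [pivot, cond_true] at hz hw
    refine mk_eq (s := p.1.1 j) (t := p.1.2.2) hz hw key ?_ ?_
    · simp [preParam, preChart, fibreCoord]; field_simp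
    · simp [preParam]

/-- The charts of `M_{n,k}`. -/
def chart {n k : ℕ} (c : ChartIdx n) :
    OpenPartialHomeomorph (HirzebruchManifold n k) (Fin n → ℂ) where
  toFun := chartFun c
  invFun x := mk n k (preParam c x)
  source := chartSource c
  target := Set.univ
  map_source' _ _ := Set.mem_univ _
  map_target' x _ := preParam_mem c x
  left_inv' := by
    intro x hx
    obtain ⟨p, rfl⟩ := (isQuotientMap_mk n k).surjective x
    exact mk_preParam_preChart c p hx
  right_inv' x _ := preChart_preParam c x
  open_source := isOpen_chartSource c
  open_target := isOpen_univ
  continuousOn_toFun :=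
    ((isQuotientMap_mk n k).continuousOn_isOpen_iff (isOpen_chartSource c)).2
      (continuousOn_preChart c)
  continuousOn_invFun :=
    ((isQuotientMap_mk n k).continuous.comp (continuous_preParam c)).continuousOn

theorem exists_mem_chartSource {n k : ℕ} (x : HirzebruchManifold n k) :
    ∃ c : ChartIdx n, x ∈ (chart (k := k) c).source := by
  obtain ⟨p, rfl⟩ := (isQuotientMap_mk n k).surjective x
  obtain ⟨j, hj⟩ := Function.ne_iff.1 p.2.1
  by_cases hw : p.1.2.2 = 0
  · refine ⟨(j, false), hj, fun h => p.2.2 (Prod.ext ?_ hw)⟩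
    simpa [pivot] using h
  · exact ⟨(j, true), hj, by simpa [pivot] using hw⟩

instance (n k : ℕ) : ChartedSpace (Fin n → ℂ) (HirzebruchManifold n k) where
  atlas := Set.range chart
  chartAt x := chart (exists_mem_chartSource x).choose
  mem_chart_source x := (exists_mem_chartSource x).choose_spec
  chart_mem_atlas _ := ⟨_, rfl⟩

theorem contDiffOn_transition {n k : ℕ} (c d : ChartIdx n) :
    ContDiffOn ℂ ω (fun x => preChart k d (preParam c x))
      {x | (preParam c x).1.1 d.1 ≠ 0 ∧ pivot d (preParam c x) ≠ 0} := by
  have hz : ∀ i, ContDiff ℂ ω fun x : Fin n → ℂ => (preParam c x).1.1 i := by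
    intro i
    by_cases hi : i = c.1
    · subst hi
      simpa [preParam] using contDiff_const
    · simpa [preParam, hi] using contDiff_apply ℂ ℂ i
  have hw1 : ContDiff ℂ ω fun x : Fin n → ℂ => (preParam c x).1.2.1 := by
    rcases c with ⟨j, _ | _⟩
    · simpa [preParam] using contDiff_const
    · simpa [preParam] using contDiff_apply ℂ ℂ j
  have hw2 : ContDiff ℂ ω fun x : Fin n → ℂ => (preParam c x).1.2.2 := by
    rcases c with ⟨j, _ | _⟩
    · simpa [preParam] using contDiff_apply ℂ ℂ j
    · simpa [preParam] using contDiff_const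
  rw [contDiffOn_pi]
  intro i
  by_cases hi : i = d.1
  · subst hi
    simp only [preChart, Function.update_self]
    rcases d with ⟨j, _ | _⟩ <;> simp only [fibreCoord, cond_true, cond_false]
    · exact (((hz j).pow k).mul hw2).contDiffOn.div hw1.contDiffOn fun p hp => hp.2
    · exact hw1.contDiffOn.div (hw2.mul ((hz j).pow k)).contDiffOn fun p hp =>
        mul_ne_zero hp.2 (pow_ne_zero k hp.1)
  · simp only [preChart, Function.update_of_ne hi]
    exact (hz i).contDiffOn.div (hz d.1).contDiffOn fun p hp => hp.1

/-- `M_{n,k}` is a complex manifold. -/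
instance (n k : ℕ) : IsManifold 𝓘(ℂ, Fin n → ℂ) ω (HirzebruchManifold n k) := by
  refine isManifold_of_contDiffOn _ _ _ ?_
  rintro _ _ ⟨c, rfl⟩ ⟨d, rfl⟩
  refine (contDiffOn_transition (k := k) c d).mono ?_
  rintro x ⟨⟨-, hx⟩, -⟩
  exact hx

/-! ### The action of `U(n)` -/

theorem unitary_mulVec_ne_zero {n : ℕ} (A : Matrix.unitaryGroup (Fin n) ℂ) {z : Fin n → ℂ}
    (hz : z ≠ 0) : A.1.mulVec z ≠ 0 := by
  intro h
  apply hz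
  have := congrArg (fun y => (A⁻¹).1.mulVec y) h
  simpa [Matrix.mulVec_mulVec] using this

/-- `A · (z, w) = (A z, w)` in homogeneous coordinates. -/
def preAct {n : ℕ} (A : Matrix.unitaryGroup (Fin n) ℂ) (p : HomCoord n) : HomCoord n :=
  ⟨(A.1.mulVec p.1.1, p.1.2), unitary_mulVec_ne_zero A p.2.1, p.2.2⟩

/-- The action of `U(n)` on `M_{n,k}` induced by its linear action on `ℂⁿ`. -/
instance (n k : ℕ) : MulAction (Matrix.unitaryGroup (Fin n) ℂ) (HirzebruchManifold n k) where
  smul A := Quotient.map (preAct A) (by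
    rintro p q ⟨s, t, hs, ht, h1, h2, h3⟩
    exact ⟨s, t, hs, ht, by simp [preAct, h1, Matrix.mulVec_smul], h2, h3⟩)
  one_smul x := by
    obtain ⟨p, rfl⟩ := (isQuotientMap_mk n k).surjective x
    exact congrArg (mk n k) (Subtype.ext (by simp [preAct]))
  mul_smul A B x := by
    obtain ⟨p, rfl⟩ := (isQuotientMap_mk n k).surjective x
    exact congrArg (mk n k) (Subtype.ext (by simp [preAct, Matrix.mulVec_mulVec]))

/-! ### Kähler metrics -/

/-- `∂f/∂x_a` at `x`, for a real-differentiable `f : ℂⁿ → ℂ`. -/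
def dz {n : ℕ} (a : Fin n) (f : (Fin n → ℂ) → ℂ) (x : Fin n → ℂ) : ℂ :=
  (fderiv ℝ f x (Pi.single a 1) - Complex.I * fderiv ℝ f x (Pi.single a Complex.I)) / 2

/-- `∂f/∂x̄_a` at `x`, for a real-differentiable `f : ℂⁿ → ℂ`. -/
def dzbar {n : ℕ} (a : Fin n) (f : (Fin n → ℂ) → ℂ) (x : Fin n → ℂ) : ℂ :=
  (fderiv ℝ f x (Pi.single a 1) + Complex.I * fderiv ℝ f x (Pi.single a Complex.I)) / 2

/-- The sesquilinear form `∑ G_{a b̄} v_a \bar{w_b}`. -/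
def herm {n : ℕ} (G : Matrix (Fin n) (Fin n) ℂ) (v w : Fin n → ℂ) : ℂ :=
  ∑ a, ∑ b, G a b * v a * conj (w b)

/-- The map `f : M_{n,k} → M_{n,k}` read in the chart `c` at the source and `d` at the target. -/
def inCharts {n k : ℕ} (f : HirzebruchManifold n k → HirzebruchManifold n k)
    (c d : ChartIdx n) (x : Fin n → ℂ) : Fin n → ℂ :=
  chart d (f ((chart c).symm x))

/-- The holomorphic map `f` pulls back the sesquilinear tensor with components `G c` in the
chart `c` to itself: `G(df v, df w) = G(v, w)`. -/
def Preserves {n k : ℕ} (f : HirzebruchManifold n k → HirzebruchManifold n k)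
    (G : ChartIdx n → (Fin n → ℂ) → Matrix (Fin n) (Fin n) ℂ) : Prop :=
  ∀ (c d : ChartIdx n) (x : Fin n → ℂ), f ((chart c).symm x) ∈ (chart (k := k) d).source →
    ∀ v w : Fin n → ℂ,
      herm (G d (inCharts f c d x)) (fderiv ℂ (inCharts f c d) x v) (fderiv ℂ (inCharts f c d) x w)
        = herm (G c x) v w

/-- A (smooth) Kähler metric on `M_{n,k}`, given by its components `g_{a b̄}` in the charts.
All charts have target `ℂⁿ`, so the components are functions on all of `ℂⁿ`. -/
@[ext] structure KahlerMetric (n k : ℕ) where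
  /-- `coeff c x a b = g_{a b̄}(x)` in the chart `c`. -/
  coeff : ChartIdx n → (Fin n → ℂ) → Matrix (Fin n) (Fin n) ℂ
  /-- The components in different charts are related by the tensor transformation law. -/
  compatible : Preserves (k := k) id coeff
  smooth : ∀ c a b, ContDiff ℝ ∞ fun x => coeff c x a b
  hermitian : ∀ c x a b, coeff c x b a = conj (coeff c x a b)
  pos : ∀ c x v, v ≠ 0 → 0 < (herm (coeff c x) v v).re
  /-- The form `√-1 ∑ g_{a b̄} dx_a ∧ dx̄_b` is closed. -/
  closed : ∀ c x a b e, dz e (fun y => coeff c y a b) x = dz a (fun y => coeff c y e b) x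

namespace KahlerMetric

variable {n k : ℕ}

/-- `U(n)` acts by isometries. -/
def IsUnitaryInvariant (g : KahlerMetric n k) : Prop :=
  ∀ A : Matrix.unitaryGroup (Fin n) ℂ,
    Preserves (fun p : HirzebruchManifold n k => A • p) g.coeff

/-- The curvature components of the Kähler metric,
`R_{a b̄ e f̄} = - ∂_e ∂_f̄ g_{a b̄} + ∑ g^{q p̄} ∂_e g_{a p̄} ∂_f̄ g_{q b̄}`. The inverse metric
satisfies `∑_p g_{a p̄} g^{q p̄} = δ_{a q}`, so `g^{q p̄}` is the entry `(p, q)` of the inverse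
matrix of `(g_{a b̄})`. -/
def curv (g : KahlerMetric n k) (c : ChartIdx n) (x : Fin n → ℂ) (a b e f : Fin n) : ℂ :=
  - dz e (dzbar f fun y => g.coeff c y a b) x +
    ∑ p, ∑ q, (g.coeff c x)⁻¹ p q * dz e (fun y => g.coeff c y a p) x *
      dzbar f (fun y => g.coeff c y q b) x

/-- The holomorphic sectional curvature `R(v, v̄, v, v̄) / |v|⁴` of the complex line spanned by
the `(1,0)`-vector `v` at the point with coordinates `x` in the chart `c`. -/
def holSecCurv (g : KahlerMetric n k) (c : ChartIdx n) (x v : Fin n → ℂ) : ℝ :=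
  (∑ a, ∑ b, ∑ e, ∑ f, g.curv c x a b e f * v a * conj (v b) * v e * conj (v f)).re /
    (herm (g.coeff c x) v v).re ^ 2

/-- `H > 0`. -/
def HasPositiveHolSecCurv (g : KahlerMetric n k) : Prop :=
  ∀ c x v, v ≠ 0 → 0 < g.holSecCurv c x v

/-- The `m`-th derivative of a component of the metric in a chart. -/
def derivCoeff (c : ChartIdx n) (a b : Fin n) (m : ℕ) (g : KahlerMetric n k) :
    C(Fin n → ℂ, ContinuousMultilinearMap ℝ (fun _ : Fin m => Fin n → ℂ) ℂ) :=
  ⟨iteratedFDeriv ℝ m fun x => g.coeff c x a b,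
    (g.smooth c a b).continuous_iteratedFDeriv (by exact_mod_cast le_top)⟩

/-- The `C^∞` topology: uniform convergence on compact subsets of the charts of all derivatives
of all components. -/
instance : TopologicalSpace (KahlerMetric n k) :=
  ⨅ (c : ChartIdx n) (a : Fin n) (b : Fin n) (m : ℕ),
    TopologicalSpace.induced (derivCoeff c a b m) ContinuousMap.compactOpen

end KahlerMetric

end Hirzebruch

end

open scoped ContDiff Manifold Topology ComplexConjugate

noncomputable section

namespace Hirzebruch

/-! ### Smooth functions of one real variable -/

/-! The action of `U(n)` has cohomogeneity one: up to it, a point is determined by the squared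
radius `r` on the fibre, which ranges over `[0, ∞]`. An invariant Kähler metric therefore has the
form `F(r)` times the Fubini–Study form of the base plus `E(r)` times the squared vertical
component, and closedness says `F' = -κ E` with `κ = ±k`. In the charts `b = true`, `F` decreases
from some `a + l` at `r = 0` to `a` at `r = ∞`.

Take `u = (F - a) / l ∈ [0, 1]` as the coordinate, and let `φ(u) = -r du/dr` be the momentum
profile. The metric closes up smoothly at both ends exactly when `φ = u (1 - u) / (1 - u (1 - u)
e(u))` with `e` smooth and a positive denominator. Integrating gives `r = (1 - u) / u * exp (q + ∫₀ᵘ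
e)`. Hence invariant Kähler metrics are parametrised by `a, l > 0`, a real number `q` and a function
`e` (`KahlerMetric.exists_profileData`), and smooth families of such data give continuous families
of metrics (`continuous_profileData_metric`).

In these terms the curvature of a complex line is the quadratic form `momForm` in quantities `X, Y ≥
0` measuring its vertical and horizontal parts (`ProfileData.hasPositiveHolSecCurv_iff`). Its
coefficients do not involve `q` and are affine in `φ` when `a` and `l` are fixed. So for fixed `a,
l` the condition `H > 0` is convex in `φ`, and two such metrics are joined by a segment of momentum
profiles (`momForm_convexComb`).

To change `a` and `l`, one passes through the models `e = -C`, that is `φ = w / (1 + C w)` with `w =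
u (1 - u)`. They have `H > 0` whenever `2 k l ≤ C a` (`momForm_model_pos`), a condition that is
convex in `(a, l)`. Any metric is joined to the model with its own `a, l` and a large `C`, then to
the model with `a = l = 1` and the same `C`, then to one fixed model. -/

theorem hasFDerivAt_intervalIntegral_of_contDiff {E F : Type} [NormedAddCommGroup E]
    [NormedSpace ℝ E] [FiniteDimensional ℝ E] [NormedAddCommGroup F] [NormedSpace ℝ F]
    [CompleteSpace F] {K : E → ℝ → F} (hK : ContDiff ℝ 1 (Function.uncurry K)) (x : E) :
    HasFDerivAt (fun x => ∫ t in (0 : ℝ)..1, K x t)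
      (∫ t in (0 : ℝ)..1, fderiv ℝ (fun y => K y t) x) x := by
  have hd : Continuous fun p : E × ℝ => fderiv ℝ (fun y => K y p.2) p.1 := by
    have : ContDiff ℝ 0 fun p : E × ℝ => fderiv ℝ (fun y => K y p.2) p.1 := by
      refine ContDiff.fderiv (f := fun p : E × ℝ => fun y => K y p.2) (n := 0) (m := 1) ?_
        contDiff_fst (by norm_num)
      exact hK.comp (contDiff_snd.prodMk (contDiff_snd.comp contDiff_fst))
    exact this.continuous
  have := ProperSpace.of_locallyCompactSpace ℝ (E := E)
  obtain ⟨M, hM⟩ := (((isCompact_closedBall x 1).prod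
    (isCompact_Icc (a := (0 : ℝ)) (b := 1))).image hd).isBounded.exists_norm_le
  have hcont : ∀ y, Continuous (K y) := fun y =>
    hK.continuous.comp (continuous_const.prodMk continuous_id)
  refine intervalIntegral.hasFDerivAt_integral_of_dominated_of_fderiv_le
    (F' := fun y t => fderiv ℝ (fun y => K y t) y) (bound := fun _ => M)
    (Metric.closedBall_mem_nhds x one_pos) ?_ ?_ ?_ ?_ ?_ ?_
  · exact Filter.Eventually.of_forall fun y => (hcont y).aestronglyMeasurable
  · exact (hcont x).intervalIntegrable _ _
  · exact (hd.comp (continuous_const.prodMk continuous_id)).aestronglyMeasurable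
  · refine Filter.Eventually.of_forall fun t ht y hy => hM _ ⟨(y, t), ⟨hy, ?_⟩, rfl⟩
    rw [Set.uIoc_of_le zero_le_one] at ht
    exact ⟨ht.1.le, ht.2⟩
  · exact intervalIntegrable_const
  · refine Filter.Eventually.of_forall fun t _ y _ => ?_
    have : ContDiff ℝ 1 fun y => K y t := hK.comp (contDiff_id.prodMk contDiff_const)
    exact (this.differentiable (by norm_num) y).hasFDerivAt

theorem contDiff_intervalIntegral {E F : Type} [NormedAddCommGroup E] [NormedSpace ℝ E]
    [FiniteDimensional ℝ E] [NormedAddCommGroup F] [NormedSpace ℝ F] [CompleteSpace F]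
    {K : E → ℝ → F} (hK : ContDiff ℝ ∞ (Function.uncurry K)) :
    ContDiff ℝ ∞ fun x => ∫ t in (0 : ℝ)..1, K x t := by
  -- The derivative takes values in `E →L[ℝ] F`, so the induction on the order has to range over all
  -- target spaces.
  suffices H : ∀ (n : ℕ) (F : Type) [NormedAddCommGroup F] [NormedSpace ℝ F] [CompleteSpace F]
      (K : E → ℝ → F), ContDiff ℝ ∞ (Function.uncurry K) →
      ContDiff ℝ n fun x => ∫ t in (0 : ℝ)..1, K x t from
    contDiff_infty.2 fun n => H n F K hK
  intro n
  induction n with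
  | zero =>
    intro F _ _ _ K hK
    refine contDiff_zero.2 ?_
    exact intervalIntegral.continuous_parametric_intervalIntegral_of_continuous' hK.continuous _ _
  | succ n ih =>
    intro F _ _ _ K hK
    have h1 : ContDiff ℝ 1 (Function.uncurry K) := hK.of_le (by exact_mod_cast le_top)
    push_cast
    rw [contDiff_succ_iff_hasFDerivAt]
    refine ⟨fun x => ∫ t in (0 : ℝ)..1, fderiv ℝ (fun y => K y t) x, ?_,
      fun x => hasFDerivAt_intervalIntegral_of_contDiff h1 x⟩
    refine ih (E →L[ℝ] F) (fun x t => fderiv ℝ (fun y => K y t) x) ?_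
    refine ContDiff.fderiv (f := fun p : E × ℝ => fun y => K y p.2) (n := ∞) (m := ∞) ?_
      contDiff_fst (by norm_num)
    exact hK.comp (contDiff_snd.prodMk (contDiff_snd.comp contDiff_fst))

/-- A function with successive derivatives `f 0, f 1, …` is smooth. -/
theorem contDiff_of_hasDerivAt_succ {f : ℕ → ℝ → ℝ}
    (h : ∀ n x, HasDerivAt (f n) (f (n + 1) x) x) (n : ℕ) : ContDiff ℝ ∞ (f n) := by
  refine contDiff_infty.2 fun m => ?_
  induction m generalizing n with
  | zero =>
    exact contDiff_zero.2 (continuous_iff_continuousAt.2 fun x => (h n x).continuousAt)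
  | succ m ih =>
    push_cast
    rw [contDiff_succ_iff_deriv]
    refine ⟨fun x => (h n x).differentiableAt, by simp, ?_⟩
    rw [show deriv (f n) = f (n + 1) from funext fun x => (h n x).deriv]
    exact ih (n + 1)

/-- Borel: every sequence of real numbers is the sequence of derivatives at `0` of a smooth
function. -/
theorem exists_contDiff_iteratedDeriv_zero_eq (c : ℕ → ℝ) :
    ∃ f : ℝ → ℝ, ContDiff ℝ ∞ f ∧ ∀ n, iteratedDeriv n f 0 = c n := by
  let χ : ContDiffBump (0 : ℝ) := ⟨1, 2, one_pos, one_lt_two⟩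
  let b : ℕ → ℝ → ℝ := fun n x => χ x * (c n / n.factorial * x ^ n)
  have hb : ∀ n, ContDiff ℝ ∞ (b n) := fun n => by
    have : ContDiff ℝ ∞ χ := χ.contDiff
    fun_prop
  have hsupp : ∀ n, HasCompactSupport (b n) := fun n => χ.hasCompactSupport.mul_right
  have hbd : ∀ n k, ∃ M, ∀ x, ‖iteratedFDeriv ℝ k (b n) x‖ ≤ M := fun n k => by
    obtain ⟨M, hM⟩ := ((hsupp n).iteratedFDeriv (𝕜 := ℝ) k).exists_bound_of_continuous
      ((hb n).continuous_iteratedFDeriv (by exact_mod_cast le_top))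
    exact ⟨M, hM⟩
  choose M hM using hbd
  -- The `k`-th derivative of `g n` below carries the factor `lam n ^ k / lam n ^ n`. For `k < n`
  -- this is at most `1 / lam n`, so this choice bounds the derivative by `2⁻ⁿ`; only the finitely
  -- many terms with `n ≤ k` escape the bound.
  let lam : ℕ → ℝ := fun n => 1 + ∑ k ∈ Finset.range n, |M n k| * 2 ^ n
  have hlam : ∀ n, 1 ≤ lam n := fun n => by
    have : 0 ≤ ∑ k ∈ Finset.range n, |M n k| * 2 ^ n := Finset.sum_nonneg fun _ _ => by positivity
    simp only [lam]; linarith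
  have hlam' : ∀ n k, k < n → |M n k| * 2 ^ n ≤ lam n := fun n k hk => by
    have := Finset.single_le_sum (f := fun k => |M n k| * 2 ^ n)
      (fun _ _ => by positivity) (Finset.mem_range.2 hk)
    simp only [lam]; linarith
  let g : ℕ → ℝ → ℝ := fun n x => (lam n)⁻¹ ^ n * b n (lam n * x)
  have hg : ∀ n, ContDiff ℝ ∞ (g n) := fun n =>
    contDiff_const.mul ((hb n).comp (contDiff_const.mul contDiff_id))
  have hgd : ∀ n k x, iteratedDeriv k (g n) x
      = (lam n)⁻¹ ^ n * (lam n ^ k * iteratedDeriv k (b n) (lam n * x)) := fun n k x => by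
    have h1 : ContDiff ℝ k (b n) := (hb n).of_le (by exact_mod_cast le_top)
    have h2 : ContDiff ℝ k fun x => b n (lam n * x) :=
      h1.comp (contDiff_const.mul contDiff_id)
    simp only [g]
    rw [iteratedDeriv_const_mul_field]
    rw [iteratedDeriv_comp_const_mul h1]
  have hgb : ∀ k n x, ‖iteratedFDeriv ℝ k (g n) x‖ ≤
      (1 / 2) ^ n + if n ≤ k then (lam n)⁻¹ ^ n * (lam n ^ k * |M n k|) else 0 := fun k n x => by
    have hl := hlam n
    have hl0 : 0 < lam n := by linarith
    have hMb : |iteratedDeriv k (b n) (lam n * x)| ≤ |M n k| := by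
      have := hM n k (lam n * x)
      rw [norm_iteratedFDeriv_eq_norm_iteratedDeriv] at this
      exact this.trans (le_abs_self _)
    have hval : ‖iteratedFDeriv ℝ k (g n) x‖ ≤ (lam n)⁻¹ ^ n * (lam n ^ k * |M n k|) := by
      rw [norm_iteratedFDeriv_eq_norm_iteratedDeriv, hgd, Real.norm_eq_abs, abs_mul, abs_mul,
        abs_of_nonneg (by positivity : 0 ≤ (lam n)⁻¹ ^ n), abs_of_nonneg (by positivity : 0 ≤ lam n ^ k)]
      gcongr
    split_ifs with hnk
    · have : (0 : ℝ) ≤ (1 / 2) ^ n := by positivity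
      linarith
    · push Not at hnk
      rw [add_zero]
      refine hval.trans ?_
      have h1 : lam n ^ k ≤ lam n ^ (n - 1) := pow_le_pow_right₀ hl (by omega)
      have h2 := hlam' n k hnk
      have h3 : |M n k| ≤ lam n * (1 / 2) ^ n := by
        rw [one_div, inv_pow, ← div_eq_mul_inv, le_div_iff₀ (by positivity)]
        exact h2
      calc (lam n)⁻¹ ^ n * (lam n ^ k * |M n k|)
          ≤ (lam n)⁻¹ ^ n * (lam n ^ (n - 1) * (lam n * (1 / 2) ^ n)) := by gcongr
        _ = (lam n)⁻¹ ^ n * (lam n ^ (n - 1 + 1)) * (1 / 2) ^ n := by ring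
        _ = (1 / 2) ^ n := by
          rw [Nat.sub_add_cancel (by omega), ← mul_pow, inv_mul_cancel₀ hl0.ne', one_pow, one_mul]
  have hsum : ∀ k : ℕ, Summable fun n : ℕ => (1 / 2 : ℝ) ^ n +
      if n ≤ k then (lam n)⁻¹ ^ n * (lam n ^ k * |M n k|) else 0 := fun k => by
    refine (summable_geometric_of_lt_one (by norm_num) (by norm_num)).add ?_
    refine summable_of_ne_finset_zero (s := Finset.range (k + 1)) fun n hn => ?_
    rw [if_neg]
    simpa [Nat.lt_succ_iff] using hn
  refine ⟨fun x => ∑' n, g n x, contDiff_tsum (N := ⊤) hg (fun k _ => hsum k)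
    (fun k n x _ => hgb k n x), fun k => ?_⟩
  rw [iteratedDeriv_eq_iteratedFDeriv, iteratedFDeriv_tsum_apply (N := ⊤) hg
    (fun k _ => hsum k) (fun k n x _ => hgb k n x) le_top]
  have hs : Summable fun n => iteratedFDeriv ℝ k (g n) 0 :=
    .of_norm_bounded (hsum k) fun n => hgb k n 0
  rw [ContinuousMultilinearMap.tsum_eval hs]
  simp_rw [← iteratedDeriv_eq_iteratedFDeriv, hgd, mul_zero]
  -- Near `0` the bump function is `1`, so `b n` is a monomial there and only the term `n = k`
  -- contributes.
  have hbz : ∀ n, iteratedDeriv k (b n) 0 = if n = k then c k else 0 := fun n => by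
    have hev : b n =ᶠ[𝓝 0] fun x => c n / n.factorial * x ^ n := by
      filter_upwards [χ.eventuallyEq_one] with x hx
      simp only [b, hx, Pi.one_apply, one_mul]
    rw [hev.iteratedDeriv_eq, iteratedDeriv_const_mul_field, iteratedDeriv_pow]
    rcases lt_trichotomy n k with h | rfl | h
    · simp [h.ne, Nat.descFactorial_eq_zero_iff_lt.2 h]
    · simp [Nat.descFactorial_self]
      field_simp
    · simp [h.ne', Nat.sub_ne_zero_of_lt h]
  rw [tsum_eq_single k fun n hn => by rw [hbz, if_neg hn]; simp]
  rw [hbz, if_pos rfl, ← mul_assoc, ← mul_pow,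
    inv_mul_cancel₀ (by linarith [hlam k] : lam k ≠ 0), one_pow, one_mul]

/-- Hadamard: `f y - f 0 = y ∫₀¹ f'(t y) dt`. -/
theorem sub_eq_mul_intervalIntegral_deriv {f f' : ℝ → ℝ} (hf : ∀ x, HasDerivAt f (f' x) x)
    (hf' : Continuous f') (y : ℝ) : f y - f 0 = y * ∫ t in (0 : ℝ)..1, f' (t * y) := by
  have h : ∀ t ∈ Set.uIcc (0 : ℝ) 1, HasDerivAt (fun t => f (t * y)) (f' (t * y) * y) t :=
    fun t _ => by
      have := (hf (t * y)).comp t ((hasDerivAt_id t).mul_const y)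
      convert! this using 1; simp
  have := intervalIntegral.integral_eq_sub_of_hasDerivAt h
    (Continuous.intervalIntegrable (by fun_prop) _ _)
  rw [intervalIntegral.integral_mul_const] at this
  simp only [one_mul, zero_mul] at this
  rw [← this, mul_comm]

/-- `f' (t) / (2 t)`, extended smoothly over `t = 0` for an even function `f`. -/
def evenStep (f : ℝ → ℝ) (t : ℝ) : ℝ := ∫ u in (0 : ℝ)..1, deriv (deriv f) (u * t) / 2

theorem contDiff_evenStep {f : ℝ → ℝ} (hf : ContDiff ℝ ∞ f) : ContDiff ℝ ∞ (evenStep f) := by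
  have h1 : ContDiff ℝ ∞ (deriv f) := (contDiff_infty_iff_deriv.1 hf).2
  have h2 : ContDiff ℝ ∞ (deriv (deriv f)) := (contDiff_infty_iff_deriv.1 h1).2
  refine contDiff_intervalIntegral (K := fun t u => deriv (deriv f) (u * t) / 2) ?_
  exact (h2.comp (contDiff_snd.mul contDiff_fst)).div_const _

theorem even_evenStep {f : ℝ → ℝ} (he : Function.Even f) : Function.Even (evenStep f) := by
  have h1 : ∀ t, deriv f (-t) = - deriv f t := fun t => by
    have := deriv_comp_neg f t
    rw [show (fun x => f (-x)) = f from funext he] at this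
    linarith
  have h2 : ∀ t, deriv (deriv f) (-t) = deriv (deriv f) t := fun t => by
    have := deriv_comp_neg (deriv f) t
    rw [show (fun x => deriv f (-x)) = fun x => - deriv f x from funext h1, deriv.fun_neg] at this
    linarith
  intro t
  simp only [evenStep, mul_neg, h2]

/-- The derivative of an even function is odd, hence vanishes at `0`, and Hadamard's formula
extracts a factor `t` from it. -/
theorem hasDerivAt_of_even {f : ℝ → ℝ} (hf : ContDiff ℝ ∞ f) (he : Function.Even f) (t : ℝ) :
    HasDerivAt f (2 * t * evenStep f t) t := by
  have h1 : ContDiff ℝ ∞ (deriv f) := (contDiff_infty_iff_deriv.1 hf).2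
  have h2 : ContDiff ℝ ∞ (deriv (deriv f)) := (contDiff_infty_iff_deriv.1 h1).2
  have h0 : deriv f 0 = 0 := by
    have := deriv_comp_neg f 0
    rw [show (fun x => f (-x)) = f from funext he, neg_zero] at this
    linarith
  have := sub_eq_mul_intervalIntegral_deriv (f := deriv f) (f' := deriv (deriv f))
    (fun x => ((contDiff_infty_iff_deriv.1 h1).1 x).hasDerivAt) h2.continuous t
  have h : deriv f t = 2 * t * evenStep f t := by
    rw [h0, sub_zero] at this
    rw [evenStep, intervalIntegral.integral_div, this]; ring
  rw [← h]
  exact ((contDiff_infty_iff_deriv.1 hf).1 t).hasDerivAt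

/-- Whitney: a smooth even function of `t` is a smooth function of `t ^ 2`. -/
theorem exists_contDiff_comp_sq {f : ℝ → ℝ} (hf : ContDiff ℝ ∞ f) (he : Function.Even f) :
    ∃ h : ℝ → ℝ, ContDiff ℝ ∞ h ∧ ∀ t, f t = h (t ^ 2) := by
  have hs : ∀ n, ContDiff ℝ ∞ (evenStep^[n] f) ∧ Function.Even (evenStep^[n] f) := fun n => by
    induction n with
    | zero => exact ⟨hf, he⟩
    | succ n ih =>
      rw [Function.iterate_succ_apply']
      exact ⟨contDiff_evenStep ih.1, even_evenStep ih.2⟩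
  -- If `f t = h (t ^ 2)`, then `evenStep f t = h' (t ^ 2)`, so the iterates of `evenStep` are the
  -- successive derivatives of `h`. Their values at `0` are the Taylor data to be matched by the
  -- continuation `B` of `h` to negative arguments.
  obtain ⟨B, hB, hB0⟩ := exists_contDiff_iteratedDeriv_zero_eq fun n => (evenStep^[n] f) 0
  let g : ℕ → ℝ → ℝ := fun n r => if 0 ≤ r then (evenStep^[n] f) √r else iteratedDeriv n B r
  have hBd : ∀ n r, HasDerivAt (iteratedDeriv n B) (iteratedDeriv (n + 1) B r) r := fun n r => by
    rw [iteratedDeriv_succ]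
    exact (hB.differentiable_iteratedDeriv n (by exact_mod_cast ENat.natCast_lt_top n) r).hasDerivAt
  have hpos : ∀ n r, 0 < r → HasDerivAt (g n) (g (n + 1) r) r := fun n r hr => by
    have h1 := (hasDerivAt_of_even (hs n).1 (hs n).2 √r).comp r (Real.hasDerivAt_sqrt hr.ne')
    have h2 : g n =ᶠ[𝓝 r] (evenStep^[n] f) ∘ Real.sqrt := by
      filter_upwards [lt_mem_nhds hr] with y hy
      simp [g, hy.le]
    refine (h1.congr_of_eventuallyEq h2).congr_deriv ?_
    have : √r ≠ 0 := (Real.sqrt_pos.2 hr).ne'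
    simp only [g, hr.le, if_true, Function.iterate_succ_apply']
    field_simp
  have hneg : ∀ n r, r ≤ 0 → g n r = iteratedDeriv n B r := fun n r hr => by
    rcases hr.lt_or_eq with h | rfl
    · simp [g, h]
    · simp [g, hB0]
  have hderiv : ∀ n r, HasDerivAt (g n) (g (n + 1) r) r := fun n r => by
    rcases lt_trichotomy r 0 with h | rfl | h
    · rw [hneg _ _ h.le]
      refine (hBd n r).congr_of_eventuallyEq ?_
      filter_upwards [gt_mem_nhds h] with y hy using hneg n y hy.le
    -- At the junction the left derivative is that of `B`; the right derivative is the limit of the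
    -- derivatives at positive arguments.
    · have hl : HasDerivWithinAt (g n) (g (n + 1) 0) (Set.Iic 0) 0 := by
        rw [hneg _ _ le_rfl]
        exact (hBd n 0).hasDerivWithinAt.congr (fun y hy => hneg n y hy) (hneg n 0 le_rfl)
      have hcont : ∀ n, ContinuousWithinAt (g n) (Set.Ioi 0) 0 := fun n => by
        have : ContinuousWithinAt (fun r => (evenStep^[n] f) √r) (Set.Ioi 0) 0 :=
          ((hs n).1.continuous.comp Real.continuous_sqrt).continuousWithinAt
        exact this.congr (fun y hy => by simp [g, (Set.mem_Ioi.1 hy).le]) (by simp [g])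
      have hr : HasDerivWithinAt (g n) (g (n + 1) 0) (Set.Ici 0) 0 := by
        refine hasDerivWithinAt_Ici_of_tendsto_deriv (s := Set.Ioi 0)
          (fun y hy => (hpos n y hy).differentiableAt.differentiableWithinAt)
          (hcont n) self_mem_nhdsWithin ?_
        refine Filter.Tendsto.congr' ?_ (hcont (n + 1))
        filter_upwards [self_mem_nhdsWithin] with y hy using ((hpos n y hy).deriv).symm
      have := hl.union hr
      rwa [Set.Iic_union_Ici, hasDerivWithinAt_univ] at this
    · exact hpos n r h
  refine ⟨g 0, contDiff_of_hasDerivAt_succ hderiv 0, fun t => ?_⟩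
  simp only [g, sq_nonneg, if_true, Function.iterate_zero, id_eq, Real.sqrt_sq_eq_abs]
  rcases abs_choice t with h | h <;> rw [h]
  exact (he t).symm

/-! ### Profiles

A momentum profile on `[0, 1]` is encoded by a smooth function `e` with `1 - u (1 - u) e(u) > 0`
and a constant of integration `q`; the radius function `(1 - u) / u * exp (q + ∫₀ᵘ e)` is then
inverted. -/

/-- An inverse, with parameters, of a smooth function of one variable is smooth. -/
theorem contDiffAt_parametric_inverse {Ψ : ℝ × ℝ → ℝ} {Ω : Set (ℝ × ℝ)} (hΩ : IsOpen Ω)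
    {V : ℝ → ℝ → ℝ} (hV : ∀ p ∈ Ω, V p.1 (Ψ p) = p.2) {p : ℝ × ℝ} (hp : p ∈ Ω)
    (hΨ : ContDiffAt ℝ ∞ Ψ p) {d : ℝ} (hd : HasDerivAt (fun u => Ψ (p.1, u)) d p.2)
    (hd0 : d ≠ 0) : ContDiffAt ℝ ∞ (Function.uncurry V) (p.1, Ψ p) := by
  -- The implicit function theorem solves `Ψ (s, u) = r` for `u` near the given point. The solution
  -- stays in `Ω`, so the left inverse `V` must agree with it.
  let f : (ℝ × ℝ) × ℝ → ℝ := fun y => Ψ (y.1.1, y.2) - y.1.2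
  let y₀ : (ℝ × ℝ) × ℝ := ((p.1, Ψ p), p.2)
  have hf : ContDiffAt ℝ ∞ f y₀ := by
    refine ContDiffAt.sub ?_ (by fun_prop)
    exact ContDiffAt.comp (g := Ψ) (f := fun y : (ℝ × ℝ) × ℝ => (y.1.1, y.2)) y₀ hΨ (by fun_prop)
  have hinv : (fderiv ℝ f y₀ ∘L .inr ℝ (ℝ × ℝ) ℝ).IsInvertible := by
    refine ⟨ContinuousLinearEquiv.unitsEquivAut ℝ (Units.mk0 d hd0), ?_⟩
    have h1 : HasFDerivAt (fun u : ℝ => f (y₀.1, u)) (fderiv ℝ f y₀ ∘L .inr ℝ (ℝ × ℝ) ℝ) p.2 := by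
      have h2 : HasFDerivAt f (fderiv ℝ f y₀) (y₀.1, p.2) :=
        (hf.differentiableAt (by simp)).hasFDerivAt
      exact h2.comp p.2 (hasFDerivAt_prodMk_right y₀.1 p.2)
    have h3 : HasDerivAt (fun u : ℝ => f (y₀.1, u)) d p.2 := hd.sub_const _
    have := h1.hasDerivAt.unique h3
    ext
    simpa using this.symm
  let G := hf.implicitFunction (by simp) hinv
  have hG : ContDiffAt ℝ ∞ G (p.1, Ψ p) := hf.contDiffAt_implicitFunction (by simp) hinv
  have hG0 : G (p.1, Ψ p) = p.2 := hf.implicitFunction_apply_self (by simp) hinv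
  refine hG.congr_of_eventuallyEq ?_
  have h1 : ∀ᶠ y in 𝓝 (p.1, Ψ p), f (y, G y) = f y₀ :=
    hf.eventually_apply_implicitFunction (by simp) hinv
  have h2 : ∀ᶠ y in 𝓝 (p.1, Ψ p), (y.1, G y) ∈ Ω := by
    have : ContinuousAt (fun y => (y.1, G y)) (p.1, Ψ p) :=
      continuousAt_fst.prodMk hG.continuousAt
    refine this (hΩ.mem_nhds ?_)
    simpa [hG0] using hp
  filter_upwards [h1, h2] with y hy1 hy2
  have h3 : Ψ (y.1, G y) = y.2 := by
    simp only [f, y₀] at hy1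
    linarith
  have := hV _ hy2
  rw [h3] at this
  exact this

/-- `q + ∫₀ᵘ e`. -/
def primitive (q : ℝ) (e : ℝ → ℝ) (u : ℝ) : ℝ := q + ∫ t in (0 : ℝ)..u, e t

/-- `1 - u (1 - u) e(u)`. -/
def den (e : ℝ → ℝ) (u : ℝ) : ℝ := 1 - u * (1 - u) * e u

/-- The radius at which the profile takes the value `u`. -/
def radius (q : ℝ) (e : ℝ → ℝ) (u : ℝ) : ℝ := (1 - u) / u * Real.exp (primitive q e u)

open Classical in
/-- The inverse of the radius function. -/
def profile (q : ℝ) (e : ℝ → ℝ) (r : ℝ) : ℝ :=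
  if h : ∃ u, 0 < u ∧ radius q e u = r then h.choose else 0

/-- Minus the derivative of the profile. -/
def slope (q : ℝ) (e : ℝ → ℝ) (r : ℝ) : ℝ :=
  profile q e r ^ 2 / (den e (profile q e r) * Real.exp (primitive q e (profile q e r)))

theorem hasDerivAt_primitive (q : ℝ) {e : ℝ → ℝ} (he : ContDiff ℝ ∞ e) (u : ℝ) :
    HasDerivAt (primitive q e) (e u) u :=
  (intervalIntegral.integral_hasDerivAt_right (he.continuous.intervalIntegrable _ _)
    he.continuous.aestronglyMeasurable.stronglyMeasurableAtFilter
    he.continuous.continuousAt).const_add q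

theorem continuous_primitive (q : ℝ) {e : ℝ → ℝ} (he : ContDiff ℝ ∞ e) :
    Continuous (primitive q e) :=
  continuous_iff_continuousAt.2 fun u => (hasDerivAt_primitive q he u).continuousAt

theorem primitive_zero (q : ℝ) (e : ℝ → ℝ) : primitive q e 0 = q := by simp [primitive]

/-- Rescaling the variable of integration turns the moving upper limit into a parameter of an
integral over `[0, 1]`. -/
theorem contDiff_primitive {q : ℝ → ℝ} {e : ℝ → ℝ → ℝ} (hq : ContDiff ℝ ∞ q)
    (he : ContDiff ℝ ∞ (Function.uncurry e)) :
    ContDiff ℝ ∞ fun p : ℝ × ℝ => primitive (q p.1) (e p.1) p.2 := by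
  have hes : ∀ s, ContDiff ℝ ∞ (e s) := fun s => he.comp (contDiff_const.prodMk contDiff_id)
  have : (fun p : ℝ × ℝ => primitive (q p.1) (e p.1) p.2)
      = fun p => q p.1 + p.2 * ∫ t in (0 : ℝ)..1, e p.1 (t * p.2) := by
    funext p
    have := sub_eq_mul_intervalIntegral_deriv (hasDerivAt_primitive (q p.1) (hes p.1))
      (hes p.1).continuous p.2
    rw [primitive_zero] at this
    linarith
  rw [this]
  refine (hq.comp contDiff_fst).add (contDiff_snd.mul ?_)
  refine contDiff_intervalIntegral (K := fun (p : ℝ × ℝ) t => e p.1 (t * p.2)) ?_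
  exact he.comp ((contDiff_fst.comp contDiff_fst).prodMk
    (contDiff_snd.mul (contDiff_snd.comp contDiff_fst)))

section

variable {q : ℝ} {e : ℝ → ℝ}

/-- The logarithmic derivative of `(1 - u) / u` is `-1 / (u (1 - u))`; adding `e` gives `-den e u /
(u (1 - u))`. Positivity of `den` is thus what makes the radius decreasing. -/
theorem hasDerivAt_radius (he : ContDiff ℝ ∞ e) {u : ℝ} (hu : u ≠ 0) :
    HasDerivAt (radius q e) (-(den e u * Real.exp (primitive q e u) / u ^ 2)) u := by
  have h := (((hasDerivAt_id u).const_sub 1).div (hasDerivAt_id u) hu).mul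
    (hasDerivAt_primitive q he u).exp
  refine h.congr_deriv ?_
  simp only [id, den, Pi.div_apply]
  field_simp
  ring

theorem strictAntiOn_radius (he : ContDiff ℝ ∞ e) (hD : ∀ u, 0 < den e u) :
    StrictAntiOn (radius q e) (Set.Ioi 0) := by
  refine strictAntiOn_of_deriv_neg (convex_Ioi 0)
    (fun u hu => (hasDerivAt_radius he (ne_of_gt hu)).continuousAt.continuousWithinAt) ?_
  intro u hu
  rw [interior_Ioi] at hu
  rw [(hasDerivAt_radius he (ne_of_gt hu)).deriv]
  have := hD u
  have hu' : 0 < u := hu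
  exact neg_neg_of_pos (by positivity)

theorem radius_one : radius q e 1 = 0 := by simp [radius]

theorem exists_radius_eq (he : ContDiff ℝ ∞ e) {r : ℝ} (hr : 0 ≤ r) :
    ∃ u, 0 < u ∧ u ≤ 1 ∧ radius q e u = r := by
  obtain ⟨u₀, -, hm⟩ := (isCompact_Icc (a := (0 : ℝ)) (b := 1)).exists_isMinOn
    (Set.nonempty_Icc.2 zero_le_one) (continuous_primitive q he).continuousOn
  set m := primitive q e u₀
  -- Chosen so that `(1 - ε) / ε = r * exp (-m)`, where `m` is the minimum of the primitive on `[0,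
  -- 1]`; the radius at `ε` is then at least `r`.
  set ε : ℝ := 1 / (1 + r * Real.exp (-m))
  have h1 : 0 ≤ r * Real.exp (-m) := by positivity
  have hε : 0 < ε := by positivity
  have hε1 : ε ≤ 1 := by
    rw [div_le_one (by linarith)]; linarith
  have hrε : r ≤ radius q e ε := by
    have h2 : (1 - ε) / ε = r * Real.exp (-m) := by
      simp only [ε]; field_simp; ring
    have h3 : m ≤ primitive q e ε := hm ⟨hε.le, hε1⟩
    calc r = r * Real.exp (-m) * Real.exp m := by
          rw [mul_assoc, ← Real.exp_add]; simp
      _ ≤ r * Real.exp (-m) * Real.exp (primitive q e ε) := by gcongr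
      _ = radius q e ε := by rw [radius, h2]
  have hc : ContinuousOn (radius q e) (Set.Icc ε 1) := fun u hu =>
    (hasDerivAt_radius he (hε.trans_le hu.1).ne').continuousAt.continuousWithinAt
  obtain ⟨u, hu, h⟩ := intermediate_value_Icc' hε1 hc (show r ∈ Set.Icc _ _ from
    ⟨by rw [radius_one]; exact hr, hrε⟩)
  exact ⟨u, hε.trans_le hu.1, hu.2, h⟩

theorem profile_radius (he : ContDiff ℝ ∞ e) (hD : ∀ u, 0 < den e u) {u : ℝ} (hu : 0 < u) :
    profile q e (radius q e u) = u := by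
  have h : ∃ u', 0 < u' ∧ radius q e u' = radius q e u := ⟨u, hu, rfl⟩
  rw [profile, dif_pos h]
  exact (strictAntiOn_radius he hD).injOn h.choose_spec.1 hu h.choose_spec.2

theorem profile_pos (he : ContDiff ℝ ∞ e) {r : ℝ} (hr : 0 ≤ r) : 0 < profile q e r := by
  obtain ⟨u, h0, -, h⟩ := exists_radius_eq (q := q) he hr
  have h : ∃ u, 0 < u ∧ radius q e u = r := ⟨u, h0, h⟩
  rw [profile, dif_pos h]
  exact h.choose_spec.1

theorem radius_profile (he : ContDiff ℝ ∞ e) {r : ℝ} (hr : 0 ≤ r) :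
    radius q e (profile q e r) = r := by
  obtain ⟨u, h0, -, h⟩ := exists_radius_eq (q := q) he hr
  have h : ∃ u, 0 < u ∧ radius q e u = r := ⟨u, h0, h⟩
  rw [profile, dif_pos h]
  exact h.choose_spec.2

theorem profile_le_one (he : ContDiff ℝ ∞ e) (hD : ∀ u, 0 < den e u) {r : ℝ} (hr : 0 ≤ r) :
    profile q e r ≤ 1 := by
  obtain ⟨u, h0, h1, h⟩ := exists_radius_eq (q := q) he hr
  rw [← h, profile_radius he hD h0]
  exact h1

theorem profile_zero (he : ContDiff ℝ ∞ e) (hD : ∀ u, 0 < den e u) : profile q e 0 = 1 := by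
  rw [← radius_one (q := q) (e := e), profile_radius he hD one_pos]

theorem slope_pos (he : ContDiff ℝ ∞ e) (hD : ∀ u, 0 < den e u) {r : ℝ} (hr : 0 ≤ r) :
    0 < slope q e r := by
  have := profile_pos (q := q) he hr
  have := hD (profile q e r)
  unfold slope
  positivity

end

/-- The radius function is defined and decreasing for all `u > 0`, also beyond `u = 1`. Hence `r =
0` is an interior point of its range, and the inverse is smooth in two-sided neighbourhoods of it.
-/
theorem contDiffAt_profile {q : ℝ → ℝ} {e : ℝ → ℝ → ℝ} (hq : ContDiff ℝ ∞ q)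
    (he : ContDiff ℝ ∞ (Function.uncurry e)) (hD : ∀ s u, 0 < den (e s) u) (s : ℝ) {r : ℝ}
    (hr : 0 ≤ r) : ContDiffAt ℝ ∞ (fun p : ℝ × ℝ => profile (q p.1) (e p.1) p.2) (s, r) := by
  have hes : ∀ s, ContDiff ℝ ∞ (e s) := fun s => he.comp (contDiff_const.prodMk contDiff_id)
  set u := profile (q s) (e s) r with hu
  have hu0 : 0 < u := profile_pos (hes s) hr
  have hur : radius (q s) (e s) u = r := radius_profile (hes s) hr
  have hΩ : IsOpen {p : ℝ × ℝ | 0 < p.2} := isOpen_lt continuous_const continuous_snd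
  have hΨ : ContDiffAt ℝ ∞ (fun p : ℝ × ℝ => radius (q p.1) (e p.1) p.2) (s, u) := by
    refine ContDiffAt.mul ?_ (contDiff_primitive hq he).exp.contDiffAt
    exact (contDiffAt_const.sub contDiffAt_snd).div contDiffAt_snd hu0.ne'
  have := contDiffAt_parametric_inverse (V := fun s r => profile (q s) (e s) r) hΩ
    (fun p hp => profile_radius (hes p.1) (hD p.1) hp) (p := (s, u)) hu0 hΨ
    (hasDerivAt_radius (q := q s) (hes s) hu0.ne') ?_
  · simp only [hur] at this
    exact this
  · have := hD s u
    exact (neg_neg_of_pos (by positivity)).ne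

theorem contDiffAt_slope {q : ℝ → ℝ} {e : ℝ → ℝ → ℝ} (hq : ContDiff ℝ ∞ q)
    (he : ContDiff ℝ ∞ (Function.uncurry e)) (hD : ∀ s u, 0 < den (e s) u) (s : ℝ) {r : ℝ}
    (hr : 0 ≤ r) : ContDiffAt ℝ ∞ (fun p : ℝ × ℝ => slope (q p.1) (e p.1) p.2) (s, r) := by
  have hp := contDiffAt_profile hq he hD s hr
  have hpair := (contDiffAt_fst (𝕜 := ℝ) (n := ∞) (p := (s, r))).prodMk hp
  have h1 := ((contDiff_primitive hq he).contDiffAt).comp (s, r) hpair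
  have h2 := (he.contDiffAt).comp (s, r) hpair
  refine (hp.pow 2).div (ContDiffAt.mul ?_ h1.exp) ?_
  · exact contDiffAt_const.sub ((hp.mul (contDiffAt_const.sub hp)).mul h2)
  · exact (mul_pos (hD _ _) (Real.exp_pos _)).ne'

section

variable {q : ℝ} {e : ℝ → ℝ}

theorem contDiffAt_profile_right (he : ContDiff ℝ ∞ e) (hD : ∀ u, 0 < den e u) {r : ℝ}
    (hr : 0 ≤ r) : ContDiffAt ℝ ∞ (profile q e) r :=
  (contDiffAt_profile (q := fun _ => q) (e := fun _ => e) contDiff_const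
    (he.comp contDiff_snd) (fun _ => hD) 0 hr).comp r (contDiffAt_const.prodMk contDiffAt_id)

theorem contDiffAt_slope_right (he : ContDiff ℝ ∞ e) (hD : ∀ u, 0 < den e u) {r : ℝ}
    (hr : 0 ≤ r) : ContDiffAt ℝ ∞ (slope q e) r :=
  (contDiffAt_slope (q := fun _ => q) (e := fun _ => e) contDiff_const
    (he.comp contDiff_snd) (fun _ => hD) 0 hr).comp r (contDiffAt_const.prodMk contDiffAt_id)

theorem eventually_radius_profile (he : ContDiff ℝ ∞ e) (hD : ∀ u, 0 < den e u) {r : ℝ}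
    (hr : 0 ≤ r) : ∀ᶠ t in 𝓝 r, 0 < profile q e t ∧ radius q e (profile q e t) = t := by
  have h0 := profile_pos (q := q) he hr
  have hpc := (contDiffAt_profile_right (q := q) he hD hr).continuousAt
  have h1 := hpc.eventually (lt_mem_nhds h0)
  filter_upwards [h1] with t ht
  refine ⟨ht, ?_⟩
  by_cases h : ∃ u, 0 < u ∧ radius q e u = t
  · rw [profile, dif_pos h]
    exact h.choose_spec.2
  -- A radius that is not attained has the default profile value `0`, which positivity excludes.
  · rw [profile, dif_neg h] at ht
    exact absurd ht (lt_irrefl 0)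

theorem hasDerivAt_profile (he : ContDiff ℝ ∞ e) (hD : ∀ u, 0 < den e u) {r : ℝ}
    (hr : 0 ≤ r) : ∀ᶠ t in 𝓝 r, HasDerivAt (profile q e) (-slope q e t) t := by
  have h1 : ∀ᶠ t in 𝓝 r, DifferentiableAt ℝ (profile q e) t := by
    have : ContDiffAt ℝ 1 (profile q e) r :=
      (contDiffAt_profile_right (q := q) he hD hr).of_le (by exact_mod_cast le_top)
    filter_upwards [this.eventually (by simp)] with t ht using ht.differentiableAt (by simp)
  filter_upwards [h1, (eventually_radius_profile (q := q) he hD hr).eventually_nhds]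
    with t ht1 ht2
  have h0 := ht2.self_of_nhds.1
  have h3 := (hasDerivAt_radius (q := q) he h0.ne').comp t ht1.hasDerivAt
  have h4 : HasDerivAt (radius q e ∘ profile q e) 1 t :=
    (hasDerivAt_id t).congr_of_eventuallyEq (ht2.mono fun y hy => hy.2)
  have h5 := h3.unique h4
  have h6 := hD (profile q e t)
  have h7 : deriv (profile q e) t = - slope q e t := by
    rw [slope]
    have hE := Real.exp_pos (primitive q e (profile q e t))
    field_simp at h5 ⊢
    linarith
  rw [← h7]
  exact ht1.hasDerivAt

/-- The momentum profile `u (1 - u) / (1 - u (1 - u) e(u))`. -/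
def momentum (e : ℝ → ℝ) (u : ℝ) : ℝ := u * (1 - u) / den e u

/-- The product `r * (-du/dr)` is a function of `u` alone, from which `q` has disappeared. This
identity brings the momentum profile into the curvature. -/
theorem mul_slope (he : ContDiff ℝ ∞ e) (hD : ∀ u, 0 < den e u) {r : ℝ}
    (hr : 0 ≤ r) : ∀ᶠ t in 𝓝 r, t * slope q e t = momentum e (profile q e t) := by
  filter_upwards [eventually_radius_profile (q := q) he hD hr] with t ht
  obtain ⟨h0, h1⟩ := ht
  have := hD (profile q e t)
  nth_rewrite 1 [← h1]
  rw [slope, radius, momentum]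
  field_simp

end

/-- The reflected data, which describe the profile seen from the other end. -/
def reflectFun (e : ℝ → ℝ) (u : ℝ) : ℝ := e (1 - u)

/-- The constant of integration of the reflected data. -/
def reflectConst (q : ℝ) (e : ℝ → ℝ) : ℝ := -primitive q e 1

section

variable {q : ℝ} {e : ℝ → ℝ}

theorem contDiff_reflectFun (he : ContDiff ℝ ∞ e) : ContDiff ℝ ∞ (reflectFun e) :=
  he.comp (contDiff_const.sub contDiff_id)

theorem den_reflectFun (e : ℝ → ℝ) (u : ℝ) : den (reflectFun e) u = den e (1 - u) := by
  simp only [den, reflectFun]; ring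

theorem momentum_reflectFun (e : ℝ → ℝ) (u : ℝ) :
    momentum (reflectFun e) u = momentum e (1 - u) := by
  simp only [momentum, den_reflectFun]; ring

theorem primitive_reflect (he : ContDiff ℝ ∞ e) (u : ℝ) :
    primitive (reflectConst q e) (reflectFun e) u = -primitive q e (1 - u) := by
  simp only [primitive, reflectConst, reflectFun]
  rw [intervalIntegral.integral_comp_sub_left (fun x => e x) 1, sub_zero]
  have := intervalIntegral.integral_add_adjacent_intervals
    (he.continuous.intervalIntegrable (μ := MeasureTheory.volume) 0 (1 - u))
    (he.continuous.intervalIntegrable (μ := MeasureTheory.volume) (1 - u) 1)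
  linarith

/-- Replacing `r` by `1 / r` and `u` by `1 - u` preserves the shape `(1 - u) / u * exp (P u)` of the
radius, with `P u` replaced by `-P (1 - u)`. This makes the metric visible at the other end of the
fibre. -/
theorem profile_reflect (he : ContDiff ℝ ∞ e) (hD : ∀ u, 0 < den e u) {r : ℝ} (hr : 0 < r) :
    profile (reflectConst q e) (reflectFun e) r⁻¹ = 1 - profile q e r := by
  have h0 := profile_pos (q := q) he hr.le
  have h1 := radius_profile (q := q) he hr.le
  have hlt : profile q e r < 1 := by
    refine lt_of_le_of_ne (profile_le_one he hD hr.le) fun h => ?_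
    rw [h, radius_one] at h1
    exact hr.ne h1
  have key : radius (reflectConst q e) (reflectFun e) (1 - profile q e r) = r⁻¹ := by
    nth_rewrite 2 [← h1]
    simp only [radius, primitive_reflect he, sub_sub_cancel, Real.exp_neg]
    have : 1 - profile q e r ≠ 0 := by linarith
    field_simp
  rw [← key, profile_radius (contDiff_reflectFun he) (fun u => by rw [den_reflectFun]; exact hD _)
    (by linarith)]

end

/-! ### Invariant sesquilinear tensors -/

variable {n : ℕ}

/-- `∑ v_i \bar{w_i}`. -/
def inn (v w : Fin n → ℂ) : ℂ := ∑ i, v i * conj (w i)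

/-- The weight of the fibre coordinate: `k` on the charts `(j, true)`, `-k` on `(j, false)`. -/
def weight (k : ℕ) (b : Bool) : ℤ := cond b (k : ℤ) (-k)

/-- The representative of the base point with `j`-th coordinate `1`. -/
def frame (c : ChartIdx n) (x : Fin n → ℂ) : Fin n → ℂ := Function.update x c.1 1

/-- The base component of a tangent vector. -/
def hor (c : ChartIdx n) (v : Fin n → ℂ) : Fin n → ℂ := Function.update v c.1 0

/-- `|z|²` for the representative `z` of the base point. -/
def nrm (c : ChartIdx n) (x : Fin n → ℂ) : ℝ := ∑ i, Complex.normSq (frame c x i)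

/-- The invariant squared radius on the fibres. -/
def rho (k : ℕ) (c : ChartIdx n) (x : Fin n → ℂ) : ℝ :=
  Complex.normSq (x c.1) * nrm c x ^ (-weight k c.2)

/-- The vertical component of a tangent vector, for the Chern connection of the line bundle. -/
def vert (k : ℕ) (c : ChartIdx n) (x v : Fin n → ℂ) : ℂ :=
  v c.1 - weight k c.2 * x c.1 * (inn (hor c v) (frame c x) / nrm c x)

/-- The Fubini–Study form of the base. -/
def fubini (c : ChartIdx n) (x v w : Fin n → ℂ) : ℂ :=
  inn (hor c v) (hor c w) / nrm c x -
    inn (hor c v) (frame c x) * inn (frame c x) (hor c w) / nrm c x ^ 2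

/-- The sesquilinear tensor with base coefficient `F` and fibre coefficient `E`. -/
def tensor (k : ℕ) (F E : Bool → ℝ → ℝ) (c : ChartIdx n) (x v w : Fin n → ℂ) : ℂ :=
  F c.2 (rho k c x) * fubini c x v w +
    (E c.2 (rho k c x) * nrm c x ^ (-weight k c.2) : ℝ) * (vert k c x v * conj (vert k c x w))

/-- The components of `tensor`. -/
def tensorCoeff (k : ℕ) (F E : Bool → ℝ → ℝ) (c : ChartIdx n) (x : Fin n → ℂ) :
    Matrix (Fin n) (Fin n) ℂ :=
  Matrix.of fun a b => tensor k F E c x (Pi.single a 1) (Pi.single b 1)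

theorem inn_add_left (u v w : Fin n → ℂ) : inn (u + v) w = inn u w + inn v w := by
  simp [inn, add_mul, Finset.sum_add_distrib]

theorem inn_smul_left (a : ℂ) (v w : Fin n → ℂ) : inn (a • v) w = a * inn v w := by
  simp [inn, Finset.mul_sum, mul_assoc]

theorem conj_inn (v w : Fin n → ℂ) : conj (inn v w) = inn w v := by
  simp [inn, map_sum, mul_comm]

theorem inn_add_right (u v w : Fin n → ℂ) : inn u (v + w) = inn u v + inn u w := by
  rw [← conj_inn, inn_add_left, map_add, conj_inn, conj_inn]

theorem inn_smul_right (a : ℂ) (v w : Fin n → ℂ) : inn v (a • w) = conj a * inn v w := by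
  rw [← conj_inn, inn_smul_left, map_mul, conj_inn]

theorem inn_sub_left (u v w : Fin n → ℂ) : inn (u - v) w = inn u w - inn v w := by
  simp [inn, sub_mul, Finset.sum_sub_distrib]

theorem inn_sub_right (u v w : Fin n → ℂ) : inn u (v - w) = inn u v - inn u w := by
  rw [← conj_inn, inn_sub_left, map_sub, conj_inn, conj_inn]

theorem inn_self (v : Fin n → ℂ) : inn v v = ((∑ i, Complex.normSq (v i) : ℝ) : ℂ) := by
  simp [inn, Complex.mul_conj]

theorem inn_frame (c : ChartIdx n) (x : Fin n → ℂ) : inn (frame c x) (frame c x) = nrm c x :=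
  inn_self _

theorem hor_add (c : ChartIdx n) (v w : Fin n → ℂ) : hor c (v + w) = hor c v + hor c w := by
  funext i
  by_cases h : i = c.1
  · subst h; simp [hor]
  · simp [hor, h]

theorem hor_smul (c : ChartIdx n) (a : ℂ) (v : Fin n → ℂ) : hor c (a • v) = a • hor c v := by
  funext i
  by_cases h : i = c.1
  · subst h; simp [hor]
  · simp [hor, h]

theorem frame_eq (c : ChartIdx n) (x : Fin n → ℂ) : frame c x = hor c x + Pi.single c.1 1 := by
  funext i
  by_cases h : i = c.1
  · subst h; simp [hor, frame]
  · simp [hor, frame, h]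

theorem vert_add (k : ℕ) (c : ChartIdx n) (x v w : Fin n → ℂ) :
    vert k c x (v + w) = vert k c x v + vert k c x w := by
  simp only [vert, hor_add, inn_add_left, Pi.add_apply]; ring

theorem vert_smul (k : ℕ) (c : ChartIdx n) (a : ℂ) (x v : Fin n → ℂ) :
    vert k c x (a • v) = a * vert k c x v := by
  simp only [vert, hor_smul, inn_smul_left, Pi.smul_apply, smul_eq_mul]; ring

theorem tensor_add_left (k : ℕ) (F E : Bool → ℝ → ℝ) (c : ChartIdx n) (x u v w : Fin n → ℂ) :
    tensor k F E c x (u + v) w = tensor k F E c x u w + tensor k F E c x v w := by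
  simp only [tensor, fubini, hor_add, vert_add, inn_add_left]; ring

theorem tensor_smul_left (k : ℕ) (F E : Bool → ℝ → ℝ) (c : ChartIdx n) (a : ℂ)
    (x v w : Fin n → ℂ) : tensor k F E c x (a • v) w = a * tensor k F E c x v w := by
  simp only [tensor, fubini, hor_smul, vert_smul, inn_smul_left]; ring

theorem conj_tensor (k : ℕ) (F E : Bool → ℝ → ℝ) (c : ChartIdx n) (x v w : Fin n → ℂ) :
    conj (tensor k F E c x v w) = tensor k F E c x w v := by
  simp only [tensor, fubini, map_add, map_mul, map_sub, map_div₀, map_pow, conj_inn,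
    Complex.conj_ofReal, Complex.conj_conj]
  ring

theorem tensor_add_right (k : ℕ) (F E : Bool → ℝ → ℝ) (c : ChartIdx n) (x u v w : Fin n → ℂ) :
    tensor k F E c x u (v + w) = tensor k F E c x u v + tensor k F E c x u w := by
  rw [← conj_tensor, tensor_add_left, map_add, conj_tensor, conj_tensor]

theorem tensor_smul_right (k : ℕ) (F E : Bool → ℝ → ℝ) (c : ChartIdx n) (a : ℂ)
    (x v w : Fin n → ℂ) : tensor k F E c x v (a • w) = conj a * tensor k F E c x v w := by
  rw [← conj_tensor, tensor_smul_left, map_mul, conj_tensor]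

/-- A sesquilinear form is given by the matrix of its values on the standard basis. -/
theorem herm_eq_of_sesquilinear {B : (Fin n → ℂ) → (Fin n → ℂ) → ℂ}
    (h1 : ∀ u v w, B (u + v) w = B u w + B v w) (h2 : ∀ (a : ℂ) v w, B (a • v) w = a * B v w)
    (h3 : ∀ u v w, B u (v + w) = B u v + B u w) (h4 : ∀ (a : ℂ) v w, B v (a • w) = conj a * B v w)
    (v w : Fin n → ℂ) :
    herm (Matrix.of fun a b => B (Pi.single a 1) (Pi.single b 1)) v w = B v w := by
  have hsg : ∀ a : Fin n, (Pi.single a 1 : Fin n → ℂ) = fun j => if a = j then 1 else 0 :=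
    fun a => funext fun j => by simp [Pi.single_apply, eq_comm]
  have hl : ∀ v w, B v w = ∑ a, v a * B (Pi.single a 1) w := fun v w => by
    let L : (Fin n → ℂ) →ₗ[ℂ] ℂ := ⟨⟨fun v => B v w, fun u v => h1 u v w⟩, fun a v => h2 a v w⟩
    have := L.pi_apply_eq_sum_univ v
    simpa [L, hsg] using this
  have hr : ∀ v w, B v w = ∑ b, conj (w b) * B v (Pi.single b 1) := fun v w => by
    let L : (Fin n → ℂ) →ₗ[ℂ] ℂ := ⟨⟨fun w => conj (B v w), fun u w => by simp [h3]⟩,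
      fun a w => by simp [h4]⟩
    have := congrArg conj (L.pi_apply_eq_sum_univ w)
    simpa [L, hsg] using this
  rw [hl, herm]
  refine Finset.sum_congr rfl fun a _ => ?_
  rw [hr, Finset.mul_sum]
  refine Finset.sum_congr rfl fun b _ => ?_
  simp only [Matrix.of_apply]
  ring

theorem herm_tensorCoeff (k : ℕ) (F E : Bool → ℝ → ℝ) (c : ChartIdx n) (x v w : Fin n → ℂ) :
    herm (tensorCoeff k F E c x) v w = tensor k F E c x v w :=
  herm_eq_of_sesquilinear (tensor_add_left k F E c x) (fun a => tensor_smul_left k F E c a x)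
    (tensor_add_right k F E c x) (fun a => tensor_smul_right k F E c a x) v w

theorem herm_single (G : Matrix (Fin n) (Fin n) ℂ) (a b : Fin n) :
    herm G (Pi.single a 1) (Pi.single b 1) = G a b := by
  rw [herm, Finset.sum_eq_single a, Finset.sum_eq_single b]
  · simp
  · intro i _ hi; simp [Pi.single_eq_of_ne hi]
  · simp
  · intro i _ hi; simp [Pi.single_eq_of_ne hi]
  · simp

theorem nrm_eq (c : ChartIdx n) (x : Fin n → ℂ) :
    nrm c x = 1 + ∑ i, Complex.normSq (hor c x i) := by
  unfold nrm
  rw [← Finset.add_sum_erase _ _ (Finset.mem_univ c.1),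
    ← Finset.add_sum_erase (a := c.1) _ (fun i => Complex.normSq (hor c x i)) (Finset.mem_univ _)]
  simp only [frame, hor, Function.update_self, map_one, map_zero, zero_add]
  congr 1
  refine Finset.sum_congr rfl fun i hi => ?_
  rw [Function.update_of_ne (Finset.ne_of_mem_erase hi),
    Function.update_of_ne (Finset.ne_of_mem_erase hi)]

theorem one_le_nrm (c : ChartIdx n) (x : Fin n → ℂ) : 1 ≤ nrm c x := by
  rw [nrm_eq]
  have : 0 ≤ ∑ i, Complex.normSq (hor c x i) := Finset.sum_nonneg fun i _ => Complex.normSq_nonneg _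
  linarith

theorem nrm_pos (c : ChartIdx n) (x : Fin n → ℂ) : 0 < nrm c x :=
  one_pos.trans_le (one_le_nrm c x)

theorem rho_nonneg (k : ℕ) (c : ChartIdx n) (x : Fin n → ℂ) : 0 ≤ rho k c x :=
  mul_nonneg (Complex.normSq_nonneg _) (zpow_nonneg (nrm_pos c x).le _)

theorem inn_unitary (A : Matrix.unitaryGroup (Fin n) ℂ) (v w : Fin n → ℂ) :
    inn (A.1.mulVec v) (A.1.mulVec w) = inn v w := by
  have h : ∀ v w : Fin n → ℂ, inn v w = v ⬝ᵥ star w := fun v w => rfl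
  have hA : star A.1 * A.1 = 1 := Matrix.mem_unitaryGroup_iff'.1 A.2
  rw [h, h, Matrix.star_mulVec, dotProduct_comm, ← Matrix.dotProduct_mulVec,
    Matrix.mulVec_mulVec, ← Matrix.star_eq_conjTranspose, hA, Matrix.one_mulVec, dotProduct_comm]

/-! #### Transition maps composed with unitary maps -/

section Transition

variable {k : ℕ} (A : Matrix.unitaryGroup (Fin n) ℂ) (c d : ChartIdx n)

/-- The homogeneous coordinate that is normalised by the chart `d` after applying `A`. -/
def scale (x : Fin n → ℂ) : ℂ := A.1.mulVec (frame c x) d.1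

/-- `A` in the charts `c` and `d`. -/
abbrev actMap (k : ℕ) (x : Fin n → ℂ) : Fin n → ℂ :=
  inCharts (fun p : HirzebruchManifold n k => A • p) c d x

variable {A c d} {x : Fin n → ℂ}

/-- The action does not touch `w`, so a non-zero fibre coordinate is needed only when passing
between the two kinds of charts. -/
theorem mem_source_iff :
    A • ((chart (k := k) c).symm x) ∈ (chart (k := k) d).source ↔
      scale A c d x ≠ 0 ∧ (c.2 ≠ d.2 → x c.1 ≠ 0) := by
  change (scale A c d x ≠ 0 ∧ pivot d (preAct A (preParam c x)) ≠ 0) ↔ _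
  rcases c with ⟨j, _ | _⟩ <;> rcases d with ⟨i, _ | _⟩ <;> simp [pivot, preAct, preParam]

theorem actMap_of_ne {i : Fin n} (hi : i ≠ d.1) :
    actMap A c d k x i = A.1.mulVec (frame c x) i / scale A c d x := by
  change preChart k d (preAct A (preParam c x)) i = _
  simp only [preChart, Function.update_of_ne hi]
  rfl

theorem actMap_fibre_eq (h : c.2 = d.2) :
    actMap A c d k x d.1 = x c.1 * scale A c d x ^ (-weight k c.2) := by
  change preChart k d (preAct A (preParam c x)) d.1 = _
  simp only [preChart, Function.update_self]
  rcases c with ⟨j, _ | _⟩ <;> rcases d with ⟨i, _ | _⟩ <;>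
    simp_all [fibreCoord, preAct, preParam, weight, scale, frame, div_eq_mul_inv, mul_comm]

theorem actMap_fibre_ne (h : c.2 ≠ d.2) :
    actMap A c d k x d.1 = (x c.1 * scale A c d x ^ (-weight k c.2))⁻¹ := by
  change preChart k d (preAct A (preParam c x)) d.1 = _
  simp only [preChart, Function.update_self]
  rcases c with ⟨j, _ | _⟩ <;> rcases d with ⟨i, _ | _⟩ <;>
    simp_all [fibreCoord, preAct, preParam, weight, scale, frame, div_eq_mul_inv, mul_comm]

theorem frame_actMap (hs : scale A c d x ≠ 0) :
    frame d (actMap A c d k x) = (scale A c d x)⁻¹ • A.1.mulVec (frame c x) := by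
  funext i
  by_cases hi : i = d.1
  · subst hi
    simp only [frame, Function.update_self, Pi.smul_apply, smul_eq_mul]
    exact (inv_mul_cancel₀ hs).symm
  · rw [frame, Function.update_of_ne hi, actMap_of_ne hi, Pi.smul_apply, smul_eq_mul,
      div_eq_inv_mul]

/-- The linear part of `frame`. -/
def horL (c : ChartIdx n) : (Fin n → ℂ) →L[ℂ] (Fin n → ℂ) :=
  LinearMap.toContinuousLinearMap ⟨⟨hor c, hor_add c⟩, fun a v => hor_smul c a v⟩

theorem hasFDerivAt_mulVec_frame (i : Fin n) :
    HasFDerivAt (fun x => A.1.mulVec (frame c x) i)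
      (((ContinuousLinearMap.proj i : (Fin n → ℂ) →L[ℂ] ℂ).comp
        (LinearMap.toContinuousLinearMap A.1.mulVecLin)).comp (horL c)) x := by
  have h : (fun x => A.1.mulVec (frame c x) i) = fun x =>
      (((ContinuousLinearMap.proj i : (Fin n → ℂ) →L[ℂ] ℂ).comp
        (LinearMap.toContinuousLinearMap A.1.mulVecLin)).comp (horL c)) x +
        A.1.mulVec (Pi.single c.1 1) i := by
    funext y
    rw [frame_eq, Matrix.mulVec_add]
    rfl
  rw [h]
  exact (ContinuousLinearMap.hasFDerivAt _).add_const _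

/-- The logarithmic derivative of `scale`. -/
def logScale (A : Matrix.unitaryGroup (Fin n) ℂ) (c d : ChartIdx n) (x v : Fin n → ℂ) : ℂ :=
  A.1.mulVec (hor c v) d.1 / scale A c d x

theorem exists_hasFDerivAt_fibre (hs : scale A c d x ≠ 0) :
    ∃ L : (Fin n → ℂ) →L[ℂ] ℂ,
      HasFDerivAt (fun x => x c.1 * scale A c d x ^ (-weight k c.2)) L x ∧
      ∀ v, L v = scale A c d x ^ (-weight k c.2) *
        (v c.1 - weight k c.2 * x c.1 * logScale A c d x v) := by
  have h1 := hasFDerivAt_mulVec_frame (A := A) (c := c) (x := x) d.1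
  have h2 := (hasDerivAt_zpow (-weight k c.2) (scale A c d x) (Or.inl hs)).comp_hasFDerivAt x h1
  have h3 := ((ContinuousLinearMap.proj c.1 : (Fin n → ℂ) →L[ℂ] ℂ).hasFDerivAt (x := x)).mul h2
  refine ⟨_, h3, fun v => ?_⟩
  simp only [add_apply, smul_apply,
    ContinuousLinearMap.proj_apply, smul_eq_mul, Function.comp_apply, logScale]
  change x c.1 * (_ * A.1.mulVec (hor c v) d.1) + _ * v c.1 = _
  rw [zpow_sub_one₀ hs]
  push_cast
  change x c.1 * (-(weight k c.2 : ℂ) * (scale A c d x ^ (-weight k c.2) * (scale A c d x)⁻¹) * _) +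
    scale A c d x ^ (-weight k c.2) * v c.1 = _
  ring

/-- After `A` is applied, the base vector is divided by `scale`, which brings in the logarithmic
derivative of `scale`. Between the two kinds of charts the fibre coordinate is also inverted, which
gives the factor `-y ^ 2`. -/
theorem exists_hasFDerivAt_actMap
    (h : A • ((chart (k := k) c).symm x) ∈ (chart (k := k) d).source) :
    ∃ L : (Fin n → ℂ) →L[ℂ] (Fin n → ℂ), HasFDerivAt (actMap A c d k) L x ∧ ∀ v,
      hor d (L v) = (scale A c d x)⁻¹ • (A.1.mulVec (hor c v) -
        logScale A c d x v • A.1.mulVec (frame c x)) ∧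
      (c.2 = d.2 → L v d.1 = scale A c d x ^ (-weight k c.2) *
        (v c.1 - weight k c.2 * x c.1 * logScale A c d x v)) ∧
      (c.2 ≠ d.2 → L v d.1 = - actMap A c d k x d.1 ^ 2 * (scale A c d x ^ (-weight k c.2) *
        (v c.1 - weight k c.2 * x c.1 * logScale A c d x v))) := by
  obtain ⟨hs, hx⟩ := mem_source_iff.1 h
  obtain ⟨L₀, hL₀, hL₀v⟩ := exists_hasFDerivAt_fibre (k := k) hs
  have hcomp : ∀ i, ∃ L : (Fin n → ℂ) →L[ℂ] ℂ, HasFDerivAt (fun y => actMap A c d k y i) L x ∧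
      (i ≠ d.1 → ∀ v, L v = (scale A c d x)⁻¹ * (A.1.mulVec (hor c v) i -
        logScale A c d x v * A.1.mulVec (frame c x) i)) ∧
      (i = d.1 → c.2 = d.2 → ∀ v, L v = L₀ v) ∧
      (i = d.1 → c.2 ≠ d.2 → ∀ v, L v = - actMap A c d k x d.1 ^ 2 * L₀ v) := by
    intro i
    by_cases hi : i = d.1
    · by_cases hcd : c.2 = d.2
      · refine ⟨L₀, ?_, fun h => absurd hi h, fun _ _ _ => rfl, fun _ h => absurd hcd h⟩
        rw [hi, show (fun y => actMap A c d k y d.1) = _ from funext fun y => actMap_fibre_eq hcd]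
        exact hL₀
      · have hne : x c.1 * scale A c d x ^ (-weight k c.2) ≠ 0 :=
          mul_ne_zero (hx hcd) (zpow_ne_zero _ hs)
        have := (hasDerivAt_inv hne).comp_hasFDerivAt x hL₀
        refine ⟨-((x c.1 * scale A c d x ^ (-weight k c.2)) ^ 2)⁻¹ • L₀, ?_, fun h => absurd hi h,
          fun _ h => absurd h hcd, fun _ _ v => ?_⟩
        · rw [hi, show (fun y => actMap A c d k y d.1) = _ from
            funext fun y => actMap_fibre_ne hcd]
          exact this
        · rw [actMap_fibre_ne hcd, smul_apply, smul_eq_mul, inv_pow]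
    · have h1 := hasFDerivAt_mulVec_frame (A := A) (c := c) (x := x) i
      have h2 := hasFDerivAt_mulVec_frame (A := A) (c := c) (x := x) d.1
      have h3 := h1.mul ((hasDerivAt_inv hs).comp_hasFDerivAt x h2)
      have h4 := h3.congr_of_eventuallyEq (f₁ := fun y => actMap A c d k y i)
        (Filter.Eventually.of_forall fun y => by
          simp only [actMap_of_ne hi, div_eq_mul_inv]
          rfl)
      refine ⟨_, h4, fun _ v => ?_, fun h _ _ => absurd h hi, fun h _ _ => absurd h hi⟩
      · change A.1.mulVec (frame c x) i * (-(scale A c d x ^ 2)⁻¹ * A.1.mulVec (hor c v) d.1) +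
          (scale A c d x)⁻¹ * A.1.mulVec (hor c v) i = _
        rw [logScale]
        field_simp
        ring
  choose L hL h1 h2 h3 using hcomp
  refine ⟨ContinuousLinearMap.pi L, hasFDerivAt_pi.2 hL, fun v => ⟨?_, fun hcd => ?_, fun hcd => ?_⟩⟩
  · funext i
    by_cases hi : i = d.1
    · subst hi
      simp only [hor, Function.update_self, Pi.smul_apply, Pi.sub_apply, smul_eq_mul]
      change 0 = _ * (A.1.mulVec (hor c v) d.1 - logScale A c d x v * scale A c d x)
      rw [logScale, div_mul_cancel₀ _ hs, sub_self, mul_zero]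
    · simp only [hor, Function.update_of_ne hi, ContinuousLinearMap.coe_pi', h1 i hi v]
      rfl
  · exact (h2 _ rfl hcd v).trans (hL₀v v)
  · exact (h3 _ rfl hcd v).trans (by rw [hL₀v])

end Transition

section Invariance

variable {k : ℕ} {A : Matrix.unitaryGroup (Fin n) ℂ} {c d : ChartIdx n} {x : Fin n → ℂ}

theorem weight_not (k : ℕ) (b : Bool) : weight k (!b) = -weight k b := by
  cases b <;> simp [weight]

theorem nrm_actMap (hs : scale A c d x ≠ 0) :
    nrm d (actMap A c d k x) = nrm c x / Complex.normSq (scale A c d x) := by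
  have h : ((nrm d (actMap A c d k x) : ℝ) : ℂ) =
      ((nrm c x / Complex.normSq (scale A c d x) : ℝ) : ℂ) := by
    rw [← inn_frame, frame_actMap hs, inn_smul_left, inn_smul_right, inn_unitary, inn_frame]
    push_cast
    rw [← Complex.mul_conj, map_inv₀, div_eq_mul_inv, mul_inv]
    ring
  exact_mod_cast h

theorem rho_actMap_eq (h : c.2 = d.2) (hs : scale A c d x ≠ 0) :
    rho k d (actMap A c d k x) = rho k c x := by
  have hs' : Complex.normSq (scale A c d x) ≠ 0 := by simpa using hs
  rw [rho, rho, nrm_actMap hs, actMap_fibre_eq h, ← h, map_mul, map_zpow₀, div_zpow]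
  have := zpow_ne_zero (-weight k c.2) hs'
  field_simp

theorem rho_actMap_ne (h : c.2 ≠ d.2) (hs : scale A c d x ≠ 0) :
    rho k d (actMap A c d k x) = (rho k c x)⁻¹ := by
  have hs' : Complex.normSq (scale A c d x) ≠ 0 := by simpa using hs
  have hd : d.2 = !c.2 := by revert h; cases c.2 <;> cases d.2 <;> simp
  rw [rho, rho, nrm_actMap hs, actMap_fibre_ne h, hd, weight_not, map_inv₀, map_mul, map_zpow₀,
    neg_neg, div_zpow, zpow_neg, zpow_neg]
  have := zpow_ne_zero (weight k c.2) hs'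
  have := zpow_ne_zero (weight k c.2) (nrm_pos c x).ne'
  field_simp

variable {L : (Fin n → ℂ) →L[ℂ] (Fin n → ℂ)}

/-- This is the change of the Chern connection form `∂ log |z|²` when `z` is divided by `scale`. The
same logarithmic derivative occurs in the derivative of the fibre coordinate, and the two cancel in
`vert`. -/
theorem inn_frame_div_actMap (hs : scale A c d x ≠ 0) {v v' : Fin n → ℂ}
    (hL : hor d v' = (scale A c d x)⁻¹ • (A.1.mulVec (hor c v) -
        logScale A c d x v • A.1.mulVec (frame c x))) :
    inn (hor d v') (frame d (actMap A c d k x)) / nrm d (actMap A c d k x) =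
      inn (hor c v) (frame c x) / nrm c x - logScale A c d x v := by
  have hN : (nrm c x : ℂ) ≠ 0 := by exact_mod_cast (nrm_pos c x).ne'
  have hs' : conj (scale A c d x) ≠ 0 := by simpa using hs
  rw [hL, frame_actMap hs, inn_smul_left, inn_smul_right, inn_sub_left, inn_smul_left,
    inn_unitary, inn_unitary, inn_frame, nrm_actMap hs]
  push_cast
  rw [← Complex.mul_conj, map_inv₀]
  field_simp

/-- The form pairs the components of the base vectors orthogonal to `z`, divided by `|z|²`. It
ignores multiples of `z` added to a tangent vector and a common rescaling. -/
theorem fubini_actMap (hs : scale A c d x ≠ 0) {v v' w w' : Fin n → ℂ}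
    (hv : hor d v' = (scale A c d x)⁻¹ • (A.1.mulVec (hor c v) -
        logScale A c d x v • A.1.mulVec (frame c x)))
    (hw : hor d w' = (scale A c d x)⁻¹ • (A.1.mulVec (hor c w) -
        logScale A c d x w • A.1.mulVec (frame c x))) :
    fubini d (actMap A c d k x) v' w' = fubini c x v w := by
  have hN : (nrm c x : ℂ) ≠ 0 := by exact_mod_cast (nrm_pos c x).ne'
  have hs' : conj (scale A c d x) ≠ 0 := by simpa using hs
  have h1 := inn_frame_div_actMap (k := k) hs hv
  have h2 := congrArg conj (inn_frame_div_actMap (k := k) hs hw)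
  simp only [map_sub, map_div₀, conj_inn, Complex.conj_ofReal] at h2
  have h3 : inn (hor d v') (hor d w') / nrm d (actMap A c d k x) =
      inn (hor c v) (hor c w) / nrm c x
        - conj (logScale A c d x w) * (inn (hor c v) (frame c x) / nrm c x)
        - logScale A c d x v * (inn (frame c x) (hor c w) / nrm c x)
        + logScale A c d x v * conj (logScale A c d x w) := by
    rw [hv, hw, inn_smul_left, inn_smul_right, inn_sub_left, inn_sub_right, inn_sub_right,
      inn_smul_left, inn_smul_left, inn_smul_right, inn_smul_right, inn_unitary, inn_unitary,
      inn_unitary, inn_unitary, inn_frame, nrm_actMap hs]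
    push_cast
    rw [← Complex.mul_conj, map_inv₀]
    field_simp
    ring
  have h4 : ∀ (c : ChartIdx n) (x v w : Fin n → ℂ), fubini c x v w =
      inn (hor c v) (hor c w) / nrm c x - (inn (hor c v) (frame c x) / nrm c x) *
        (inn (frame c x) (hor c w) / nrm c x) := fun c x v w => by
    rw [fubini, sq, mul_div_mul_comm]
  rw [h4, h4, h1, h2, h3]
  ring

/-- Tensors built from functions of the radius that match at the two ends are invariant. -/
theorem tensor_actMap {F E : Bool → ℝ → ℝ} (hF : ∀ b r, 0 < r → F (!b) r⁻¹ = F b r)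
    (hE : ∀ b r, 0 < r → E (!b) r⁻¹ = E b r * r ^ 2)
    (h : A • ((chart (k := k) c).symm x) ∈ (chart (k := k) d).source) (v w : Fin n → ℂ) :
    tensor k F E d (actMap A c d k x) (fderiv ℂ (actMap A c d k) x v)
      (fderiv ℂ (actMap A c d k) x w) = tensor k F E c x v w := by
  obtain ⟨hs, hx⟩ := mem_source_iff.1 h
  obtain ⟨L, hL, hLv⟩ := exists_hasFDerivAt_actMap h
  have hs' : Complex.normSq (scale A c d x) ≠ 0 := by simpa using hs
  have hN := (nrm_pos c x).ne'
  rw [hL.fderiv]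
  have hfub := fubini_actMap (k := k) hs (hLv v).1 (hLv w).1
  by_cases hcd : c.2 = d.2
  · have hvert : ∀ v, vert k d (actMap A c d k x) (L v) =
        scale A c d x ^ (-weight k c.2) * vert k c x v := fun v => by
      rw [vert, vert, inn_frame_div_actMap hs (hLv v).1, (hLv v).2.1 hcd, actMap_fibre_eq hcd, ← hcd]
      ring
    rw [tensor, tensor, hfub, rho_actMap_eq hcd hs, hvert, hvert, nrm_actMap hs, ← hcd, map_mul]
    congr 1
    have : scale A c d x ^ (-weight k c.2) * vert k c x v *
        (conj (scale A c d x ^ (-weight k c.2)) * conj (vert k c x w)) =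
        ((Complex.normSq (scale A c d x) ^ (-weight k c.2) : ℝ) : ℂ) *
          (vert k c x v * conj (vert k c x w)) := by
      rw [← map_zpow₀, ← Complex.mul_conj]; ring
    rw [this, ← mul_assoc, ← Complex.ofReal_mul, div_zpow]
    congr 2
    have := zpow_ne_zero (-weight k c.2) hs'
    field_simp
  · have hd : d.2 = !c.2 := by revert hcd; cases c.2 <;> cases d.2 <;> simp
    have hx0 : Complex.normSq (x c.1) ≠ 0 := by simpa using hx hcd
    have hr : 0 < rho k c x := mul_pos (lt_of_le_of_ne (Complex.normSq_nonneg _) hx0.symm)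
      (zpow_pos (nrm_pos c x) _)
    have hvert : ∀ v, vert k d (actMap A c d k x) (L v) =
        - actMap A c d k x d.1 ^ 2 * (scale A c d x ^ (-weight k c.2) * vert k c x v) := fun v => by
      rw [vert, vert, inn_frame_div_actMap hs (hLv v).1, (hLv v).2.2 hcd, hd, weight_not]
      have : actMap A c d k x d.1 = actMap A c d k x d.1 ^ 2 *
          (x c.1 * scale A c d x ^ (-weight k c.2)) := by
        have h1 := hx hcd
        have h2 := zpow_ne_zero (-weight k c.2) hs
        rw [actMap_fibre_ne hcd]
        field_simp
      push_cast
      nth_rewrite 2 [this]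
      ring
    rw [tensor, tensor, hfub, rho_actMap_ne hcd hs, hvert, hvert, nrm_actMap hs, hd, hF _ _ hr,
      hE _ _ hr]
    congr 1
    have : -actMap A c d k x d.1 ^ 2 * (scale A c d x ^ (-weight k c.2) * vert k c x v) *
        conj (-actMap A c d k x d.1 ^ 2 * (scale A c d x ^ (-weight k c.2) * vert k c x w)) =
        ((Complex.normSq (actMap A c d k x d.1) ^ 2 *
          Complex.normSq (scale A c d x) ^ (-weight k c.2) : ℝ) : ℂ) *
          (vert k c x v * conj (vert k c x w)) := by
      push_cast
      rw [← Complex.mul_conj, ← Complex.mul_conj, mul_zpow, ← map_zpow₀]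
      simp only [map_mul, map_neg, map_pow]
      ring
    rw [this, ← mul_assoc, ← Complex.ofReal_mul]
    congr 2
    rw [actMap_fibre_ne hcd, map_inv₀, map_mul, map_zpow₀, weight_not, neg_neg, rho, div_zpow,
      zpow_neg, zpow_neg]
    have := zpow_ne_zero (weight k c.2) hs'
    have := zpow_ne_zero (weight k c.2) hN
    field_simp

theorem preserves_tensorCoeff {F E : Bool → ℝ → ℝ} (hF : ∀ b r, 0 < r → F (!b) r⁻¹ = F b r)
    (hE : ∀ b r, 0 < r → E (!b) r⁻¹ = E b r * r ^ 2) (A : Matrix.unitaryGroup (Fin n) ℂ) :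
    Preserves (fun p : HirzebruchManifold n k => A • p) (tensorCoeff k F E) := by
  intro c d x h v w
  rw [herm_tensorCoeff, herm_tensorCoeff]
  exact tensor_actMap hF hE h v w

/-- Compatibility between the charts thereby becomes the case `A = 1` of invariance. -/
theorem preserves_id_iff (G : ChartIdx n → (Fin n → ℂ) → Matrix (Fin n) (Fin n) ℂ) :
    Preserves (k := k) id G ↔
      Preserves (fun p : HirzebruchManifold n k => (1 : Matrix.unitaryGroup (Fin n) ℂ) • p) G := by
  rw [show (fun p : HirzebruchManifold n k => (1 : Matrix.unitaryGroup (Fin n) ℂ) • p) = id from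
    funext fun p => one_smul _ p]

end Invariance

/-! ### Wirtinger calculus -/

/-- `f` is real differentiable at `x` with `∂_u f = p` and `∂̄_u f = q`. -/
def HasWirt {V : Type*} [NormedAddCommGroup V] [NormedSpace ℝ V] [NormedSpace ℂ V]
    (f : V → ℂ) (p q : ℂ) (x u : V) : Prop :=
  ∃ f' : V →L[ℝ] ℂ, HasFDerivAt f f' x ∧ f' u = p + q ∧ f' (Complex.I • u) = Complex.I * (p - q)

namespace HasWirt

variable {V : Type*} [NormedAddCommGroup V] [NormedSpace ℝ V] [NormedSpace ℂ V]
  {f g : V → ℂ} {p q p' q' : ℂ} {x u : V}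

theorem congr_val (h : HasWirt f p q x u) (hp : p = p') (hq : q = q') : HasWirt f p' q' x u := by
  subst hp hq; exact h

theorem congr_of_eventuallyEq (h : HasWirt f p q x u) (hg : g =ᶠ[𝓝 x] f) : HasWirt g p q x u := by
  obtain ⟨f', h1, h2⟩ := h
  exact ⟨f', h1.congr_of_eventuallyEq hg, h2⟩

theorem unique (h : HasWirt f p q x u) (h' : HasWirt f p' q' x u) : p = p' ∧ q = q' := by
  obtain ⟨f', h1, h2, h3⟩ := h
  obtain ⟨g', h1', h2', h3'⟩ := h'
  obtain rfl := h1.unique h1'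
  have h4 := h2.symm.trans h2'
  have h5 := mul_left_cancel₀ Complex.I_ne_zero (h3.symm.trans h3')
  constructor
  · linear_combination (h4 + h5) / 2
  · linear_combination (h4 - h5) / 2

theorem const (a : ℂ) (x u : V) : HasWirt (fun _ => a) 0 0 x u :=
  ⟨0, hasFDerivAt_const a x, by simp, by simp⟩

theorem add (h : HasWirt f p q x u) (h' : HasWirt g p' q' x u) :
    HasWirt (fun y => f y + g y) (p + p') (q + q') x u := by
  obtain ⟨f', h1, h2, h3⟩ := h
  obtain ⟨g', h1', h2', h3'⟩ := h'
  refine ⟨f' + g', h1.add h1', ?_, ?_⟩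
  · rw [add_apply, h2, h2']; ring
  · rw [add_apply, h3, h3']; ring

theorem mul (h : HasWirt f p q x u) (h' : HasWirt g p' q' x u) :
    HasWirt (fun y => f y * g y) (f x * p' + p * g x) (f x * q' + q * g x) x u := by
  obtain ⟨f', h1, h2, h3⟩ := h
  obtain ⟨g', h1', h2', h3'⟩ := h'
  refine ⟨f x • g' + g x • f', h1.mul h1', ?_, ?_⟩
  · simp only [add_apply, smul_apply, smul_eq_mul, h2, h2']; ring
  · simp only [add_apply, smul_apply, smul_eq_mul, h3, h3']; ring

theorem const_mul (a : ℂ) (h : HasWirt f p q x u) :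
    HasWirt (fun y => a * f y) (a * p) (a * q) x u :=
  ((const a x u).mul h).congr_val (by ring) (by ring)

theorem neg (h : HasWirt f p q x u) : HasWirt (fun y => -f y) (-p) (-q) x u := by
  simpa using h.const_mul (-1)

theorem sub (h : HasWirt f p q x u) (h' : HasWirt g p' q' x u) :
    HasWirt (fun y => f y - g y) (p - p') (q - q') x u := by
  simpa [sub_eq_add_neg] using h.add h'.neg

theorem star (h : HasWirt f p q x u) :
    HasWirt (fun y => conj (f y)) (conj q) (conj p) x u := by
  obtain ⟨f', h1, h2, h3⟩ := h
  refine ⟨(Complex.conjCLE : ℂ →L[ℝ] ℂ).comp f',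
    (Complex.conjCLE : ℂ →L[ℝ] ℂ).hasFDerivAt.comp x h1, ?_, ?_⟩
  · simp [h2, add_comm]
  · simp [h3]; ring

theorem sum {ι : Type*} (s : Finset ι) {f : ι → V → ℂ} {p q : ι → ℂ}
    (h : ∀ i ∈ s, HasWirt (f i) (p i) (q i) x u) :
    HasWirt (fun y => ∑ i ∈ s, f i y) (∑ i ∈ s, p i) (∑ i ∈ s, q i) x u := by
  classical
  induction s using Finset.induction_on with
  | empty => simpa using const (0 : ℂ) x u
  | insert i s hi ih =>
    simp only [Finset.sum_insert hi]
    exact (h i (Finset.mem_insert_self i s)).add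
      (ih fun j hj => h j (Finset.mem_insert_of_mem hj))

/-- A function of a real valued function. -/
theorem realComp {g : V → ℝ} {φ : ℝ → ℝ} {φ' : ℝ} (h : HasWirt (fun y => (g y : ℂ)) p q x u)
    (hφ : HasDerivAt φ φ' (g x)) :
    HasWirt (fun y => (φ (g y) : ℂ)) (φ' * p) (φ' * q) x u := by
  obtain ⟨f', h1, h2, h3⟩ := h
  have hg : HasFDerivAt g (Complex.reCLM.comp f') x := by
    have := Complex.reCLM.hasFDerivAt.comp x h1
    simpa [Function.comp_def] using this
  -- The function is real valued, so its derivative is too.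
  have hf' : f' = Complex.ofRealCLM.comp (Complex.reCLM.comp f') :=
    h1.unique (Complex.ofRealCLM.hasFDerivAt.comp x hg)
  have h4 := Complex.ofRealCLM.hasFDerivAt.comp x (hφ.comp_hasFDerivAt x hg)
  have hre : ∀ v, (((f' v).re : ℝ) : ℂ) = f' v := fun v => by
    conv_rhs => rw [hf']
    rfl
  refine ⟨_, h4, ?_, ?_⟩
  · simp only [ContinuousLinearMap.comp_apply, smul_apply, smul_eq_mul, Complex.reCLM_apply,
      Complex.ofRealCLM_apply, Complex.ofReal_mul]
    rw [hre, h2]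
    ring
  · simp only [ContinuousLinearMap.comp_apply, smul_apply, smul_eq_mul, Complex.reCLM_apply,
      Complex.ofRealCLM_apply, Complex.ofReal_mul]
    rw [hre, h3]
    ring

end HasWirt

theorem HasWirt.proj (i : Fin n) (x u : Fin n → ℂ) : HasWirt (fun y => y i) (u i) 0 x u :=
  ⟨(ContinuousLinearMap.proj i : (Fin n → ℂ) →L[ℝ] ℂ),
    (ContinuousLinearMap.proj i : (Fin n → ℂ) →L[ℝ] ℂ).hasFDerivAt, by simp, by simp⟩

theorem HasWirt.dz_eq {f : (Fin n → ℂ) → ℂ} {p q : ℂ} {x : Fin n → ℂ} {a : Fin n}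
    (h : HasWirt f p q x (Pi.single a 1)) : dz a f x = p := by
  obtain ⟨f', h1, h2, h3⟩ := h
  rw [dz, h1.fderiv, h2]
  have : (Pi.single a Complex.I : Fin n → ℂ) = Complex.I • Pi.single a 1 := by
    rw [← Pi.single_smul, smul_eq_mul, mul_one]
  rw [this, h3]
  linear_combination (-(p - q) / 2) * Complex.I_sq

/-! ### Derivatives of the invariant tensors -/

section Derivative

variable {k : ℕ} (c : ChartIdx n) (x u v w : Fin n → ℂ)

theorem hasWirt_frame (i : Fin n) : HasWirt (fun y => frame c y i) (hor c u i) 0 x u := by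
  by_cases hi : i = c.1
  · subst hi
    simpa [frame, hor] using HasWirt.const (1 : ℂ) x u
  · simpa [frame, hor, hi] using HasWirt.proj i x u

theorem hasWirt_inn_frame_left :
    HasWirt (fun y => inn (frame c y) w) (inn (hor c u) w) 0 x u := by
  refine (HasWirt.sum Finset.univ fun i _ =>
    (hasWirt_frame c x u i).mul (HasWirt.const (conj (w i)) x u)).congr_val ?_ ?_
  · simp [inn]
  · simp

theorem hasWirt_inn_frame_right :
    HasWirt (fun y => inn v (frame c y)) 0 (inn v (hor c u)) x u := by
  have := (hasWirt_inn_frame_left c x u v).star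
  simpa [conj_inn] using this

theorem hasWirt_nrm : HasWirt (fun y => (nrm c y : ℂ)) (inn (hor c u) (frame c x))
    (inn (frame c x) (hor c u)) x u := by
  have h : (fun y => (nrm c y : ℂ)) = fun y => ∑ i, frame c y i * conj (frame c y i) := by
    funext y; rw [← inn_frame]; rfl
  rw [h]
  refine (HasWirt.sum Finset.univ fun i _ =>
    (hasWirt_frame c x u i).mul (hasWirt_frame c x u i).star).congr_val ?_ ?_
  · simp [inn]
  · simp [inn]

theorem hasWirt_inv_nrm : HasWirt (fun y => ((nrm c y)⁻¹ : ℂ))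
    (-(nrm c x : ℂ)⁻¹ ^ 2 * inn (hor c u) (frame c x))
    (-(nrm c x : ℂ)⁻¹ ^ 2 * inn (frame c x) (hor c u)) x u := by
  have := (hasWirt_nrm c x u).realComp (hasDerivAt_inv (nrm_pos c x).ne')
  simp only [Complex.ofReal_inv] at this
  refine this.congr_val ?_ ?_ <;> push_cast <;> ring

theorem hasWirt_zpow_nrm (m : ℤ) : HasWirt (fun y => ((nrm c y ^ m : ℝ) : ℂ))
    (m * (nrm c x ^ m : ℝ) * (nrm c x : ℂ)⁻¹ * inn (hor c u) (frame c x))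
    (m * (nrm c x ^ m : ℝ) * (nrm c x : ℂ)⁻¹ * inn (frame c x) (hor c u)) x u := by
  have := (hasWirt_nrm c x u).realComp (hasDerivAt_zpow m _ (Or.inl (nrm_pos c x).ne'))
  rw [zpow_sub_one₀ (nrm_pos c x).ne'] at this
  refine this.congr_val ?_ ?_ <;> push_cast <;> ring

theorem conj_vert (k : ℕ) : conj (vert k c x v) =
    conj (v c.1) - weight k c.2 * conj (x c.1) * (inn (frame c x) (hor c v) / nrm c x) := by
  simp [vert, conj_inn]

theorem hasWirt_rho : HasWirt (fun y => (rho k c y : ℂ))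
    ((nrm c x ^ (-weight k c.2) : ℝ) * conj (x c.1) * vert k c x u)
    ((nrm c x ^ (-weight k c.2) : ℝ) * x c.1 * conj (vert k c x u)) x u := by
  have h : (fun y => (rho k c y : ℂ)) = fun y =>
      (y c.1 * conj (y c.1)) * ((nrm c y ^ (-weight k c.2) : ℝ) : ℂ) := by
    funext y; rw [rho, Complex.mul_conj]; push_cast; rfl
  rw [h]
  refine (((HasWirt.proj c.1 x u).mul (HasWirt.proj c.1 x u).star).mul
    (hasWirt_zpow_nrm c x u (-weight k c.2))).congr_val ?_ ?_
  · simp only [vert, map_zero]; push_cast; ring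
  · rw [conj_vert]; push_cast; ring

theorem hasWirt_fubini : HasWirt (fun y => fubini c y v w)
    (-(inn (hor c v) (hor c w) * inn (hor c u) (frame c x) +
      inn (hor c v) (frame c x) * inn (hor c u) (hor c w)) * (nrm c x : ℂ)⁻¹ ^ 2 +
      2 * inn (hor c v) (frame c x) * inn (frame c x) (hor c w) * inn (hor c u) (frame c x) *
        (nrm c x : ℂ)⁻¹ ^ 3)
    (-(inn (hor c v) (hor c w) * inn (frame c x) (hor c u) +
      inn (hor c v) (hor c u) * inn (frame c x) (hor c w)) * (nrm c x : ℂ)⁻¹ ^ 2 +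
      2 * inn (hor c v) (frame c x) * inn (frame c x) (hor c w) * inn (frame c x) (hor c u) *
        (nrm c x : ℂ)⁻¹ ^ 3) x u := by
  have h : (fun y => fubini c y v w) = fun y => inn (hor c v) (hor c w) * ((nrm c y)⁻¹ : ℂ) -
      inn (hor c v) (frame c y) * inn (frame c y) (hor c w) *
        (((nrm c y)⁻¹ : ℂ) * ((nrm c y)⁻¹ : ℂ)) := by
    funext y; rw [fubini]; field_simp
  rw [h]
  refine (((hasWirt_inv_nrm c x u).const_mul _).sub
    (((hasWirt_inn_frame_right c x u (hor c v)).mul (hasWirt_inn_frame_left c x u (hor c w))).mul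
      ((hasWirt_inv_nrm c x u).mul (hasWirt_inv_nrm c x u)))).congr_val ?_ ?_ <;> ring

theorem hasWirt_vert : HasWirt (fun y => vert k c y v)
    (-weight k c.2 * (u c.1 * inn (hor c v) (frame c x) * (nrm c x : ℂ)⁻¹ -
      x c.1 * inn (hor c v) (frame c x) * inn (hor c u) (frame c x) * (nrm c x : ℂ)⁻¹ ^ 2))
    (-weight k c.2 * x c.1 * fubini c x v u) x u := by
  have h : (fun y => vert k c y v) = fun y => v c.1 -
      weight k c.2 * (y c.1 * (inn (hor c v) (frame c y) * ((nrm c y)⁻¹ : ℂ))) := by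
    funext y; rw [vert]; ring
  rw [h]
  refine ((HasWirt.const _ x u).sub (((HasWirt.proj c.1 x u).mul
    ((hasWirt_inn_frame_right c x u (hor c v)).mul (hasWirt_inv_nrm c x u))).const_mul _)).congr_val
      ?_ ?_
  · ring
  · rw [fubini]; ring

theorem conj_fubini : conj (fubini c x v w) = fubini c x w v := by
  simp only [fubini, map_sub, map_div₀, map_mul, map_pow, conj_inn, Complex.conj_ofReal]
  ring

/-- The `∂`-derivative of an invariant tensor, with `F'`, `E'` the derivatives of `F`, `E`. -/
def tensorDeriv (k : ℕ) (F E F' E' : ℝ) (c : ChartIdx n) (x u v w : Fin n → ℂ) : ℂ :=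
  F' * ((nrm c x ^ (-weight k c.2) : ℝ) * conj (x c.1) * vert k c x u) * fubini c x v w +
  F * (-(inn (hor c v) (hor c w) * inn (hor c u) (frame c x) +
      inn (hor c v) (frame c x) * inn (hor c u) (hor c w)) * (nrm c x : ℂ)⁻¹ ^ 2 +
      2 * inn (hor c v) (frame c x) * inn (frame c x) (hor c w) * inn (hor c u) (frame c x) *
        (nrm c x : ℂ)⁻¹ ^ 3) +
  (E' * (nrm c x ^ (-weight k c.2) : ℝ) ^ 2 * conj (x c.1) * vert k c x u -
    E * weight k c.2 * (nrm c x ^ (-weight k c.2) : ℝ) * (nrm c x : ℂ)⁻¹ *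
      inn (hor c u) (frame c x)) * (vert k c x v * conj (vert k c x w)) -
  E * (nrm c x ^ (-weight k c.2) : ℝ) * weight k c.2 *
    ((u c.1 * inn (hor c v) (frame c x) * (nrm c x : ℂ)⁻¹ -
      x c.1 * inn (hor c v) (frame c x) * inn (hor c u) (frame c x) * (nrm c x : ℂ)⁻¹ ^ 2) *
        conj (vert k c x w) + vert k c x v * (conj (x c.1) * fubini c x u w))

/-- Only the `∂`-part is computed. The `∂̄`-part follows from it by Hermitian symmetry and
uniqueness of Wirtinger derivatives. -/
theorem hasWirt_tensor {F E : Bool → ℝ → ℝ} {F' E' : ℝ}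
    (hF : HasDerivAt (F c.2) F' (rho k c x)) (hE : HasDerivAt (E c.2) E' (rho k c x)) :
    HasWirt (fun y => tensor k F E c y v w)
      (tensorDeriv k (F c.2 (rho k c x)) (E c.2 (rho k c x)) F' E' c x u v w)
      (conj (tensorDeriv k (F c.2 (rho k c x)) (E c.2 (rho k c x)) F' E' c x u w v)) x u := by
  have hp : ∀ v w, ∃ q, HasWirt (fun y => tensor k F E c y v w)
      (tensorDeriv k (F c.2 (rho k c x)) (E c.2 (rho k c x)) F' E' c x u v w) q x u := by
    intro v w
    have h : (fun y => tensor k F E c y v w) = fun y =>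
        (F c.2 (rho k c y) : ℂ) * fubini c y v w +
        (E c.2 (rho k c y) : ℂ) * ((nrm c y ^ (-weight k c.2) : ℝ) : ℂ) *
          (vert k c y v * conj (vert k c y w)) := by
      funext y; rw [tensor]; push_cast; rfl
    rw [h]
    refine ⟨_, ((((hasWirt_rho c x u).realComp hF).mul (hasWirt_fubini c x u v w)).add
      ((((hasWirt_rho c x u).realComp hE).mul (hasWirt_zpow_nrm c x u _)).mul
        ((hasWirt_vert c x u v).mul (hasWirt_vert c x u w).star))).congr_val ?_ rfl⟩
    simp only [tensorDeriv, map_mul, map_neg, conj_fubini, map_intCast]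
    push_cast
    ring
  obtain ⟨q, hq⟩ := hp v w
  obtain ⟨q', hq'⟩ := hp w v
  have := hq'.star
  simp only [conj_tensor] at this
  exact hq.congr_val rfl (hq.unique this).2

/-- The Kähler condition. -/
theorem tensorDeriv_comm (F E F' E' : ℝ) (hF' : F' = -weight k c.2 * E) :
    tensorDeriv k F E F' E' c x u v w = tensorDeriv k F E F' E' c x v u w := by
  subst hF'
  -- With `F' = -κ E` the term in `F'` and the term in which `E` multiplies `fubini c x u w` are
  -- exchanged by swapping `u` and `v`. The remaining terms are symmetric together once `vert` is
  -- expanded.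
  simp only [tensorDeriv, vert]
  push_cast
  ring

end Derivative

/-! ### Invariant Kähler metrics from functions of the radius -/

theorem inn_hor_frame (c : ChartIdx n) (x v : Fin n → ℂ) :
    inn (hor c v) (frame c x) = inn (hor c v) (hor c x) := by
  rw [frame_eq, inn_add_right]
  have : inn (hor c v) (Pi.single c.1 1) = 0 := by
    rw [inn, Finset.sum_eq_single c.1]
    · simp [hor]
    · intro i _ hi; simp [Pi.single_eq_of_ne hi]
    · simp
  rw [this, add_zero]

theorem normSq_inn_le (v w : Fin n → ℂ) :
    Complex.normSq (inn v w) ≤ (∑ i, Complex.normSq (v i)) * ∑ i, Complex.normSq (w i) := by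
  have h1 : ‖inn v w‖ ≤ ∑ i, ‖v i‖ * ‖w i‖ := by
    refine (norm_sum_le _ _).trans (le_of_eq ?_)
    simp
  have h2 := Finset.sum_mul_sq_le_sq_mul_sq Finset.univ (fun i => ‖v i‖) (fun i => ‖w i‖)
  simp only [Complex.normSq_eq_norm_sq]
  exact (pow_le_pow_left₀ (norm_nonneg _) h1 2).trans h2

/-- By Cauchy–Schwarz `|⟨v, z⟩|² ≤ |v|² (|z|² - 1)` for the base component of `v`: its `j`-th entry
is `0`, so only the part of `z` other than the entry `1` enters. The strict gap gives definiteness.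
-/
theorem fubini_self (c : ChartIdx n) (x v : Fin n → ℂ) :
    ∃ t : ℝ, fubini c x v v = t ∧ 0 ≤ t ∧ (hor c v ≠ 0 → 0 < t) := by
  set S := ∑ i, Complex.normSq (hor c v i) with hS
  set R := Complex.normSq (inn (hor c v) (frame c x)) with hR
  have hN := nrm_pos c x
  refine ⟨S / nrm c x - R / nrm c x ^ 2, ?_, ?_⟩
  · rw [fubini, inn_self, ← hS, ← conj_inn (hor c v) (frame c x), Complex.mul_conj, ← hR]
    push_cast
    rfl
  have hle : R ≤ S * (nrm c x - 1) := by
    rw [hR, inn_hor_frame, nrm_eq, add_sub_cancel_left]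
    exact normSq_inn_le _ _
  have heq : S / nrm c x - R / nrm c x ^ 2 = (S * nrm c x - R) / nrm c x ^ 2 := by
    field_simp
  have hS0 : 0 ≤ S := Finset.sum_nonneg fun i _ => Complex.normSq_nonneg _
  rw [heq]
  refine ⟨div_nonneg (by nlinarith) (by positivity), fun hv => div_pos ?_ (by positivity)⟩
  obtain ⟨i, hi⟩ := Function.ne_iff.1 hv
  have : 0 < S := Finset.sum_pos' (fun i _ => Complex.normSq_nonneg _)
    ⟨i, Finset.mem_univ i, Complex.normSq_pos.2 hi⟩
  nlinarith

theorem tensor_self_re_pos {k : ℕ} {F E : Bool → ℝ → ℝ} (hF : ∀ b r, 0 ≤ r → 0 < F b r)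
    (hE : ∀ b r, 0 ≤ r → 0 < E b r) (c : ChartIdx n) (x : Fin n → ℂ) {v : Fin n → ℂ}
    (hv : v ≠ 0) : 0 < (tensor k F E c x v v).re := by
  obtain ⟨t, ht, ht0, ht1⟩ := fubini_self c x v
  have hF' := hF c.2 _ (rho_nonneg k c x)
  have hE' := hE c.2 _ (rho_nonneg k c x)
  have hW : 0 < nrm c x ^ (-weight k c.2) := zpow_pos (nrm_pos c x) _
  rw [tensor, ht, Complex.mul_conj, ← Complex.ofReal_mul, ← Complex.ofReal_mul,
    ← Complex.ofReal_add, Complex.ofReal_re]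
  have h1 := Complex.normSq_nonneg (vert k c x v)
  by_cases hh : hor c v = 0
  · have hvj : v c.1 ≠ 0 := fun h => hv <| by
      funext i
      by_cases hi : i = c.1
      · rw [hi, h]; rfl
      · have := congrFun hh i
        simpa [hor, hi] using this
    have : vert k c x v ≠ 0 := by simpa [vert, hh, inn] using hvj
    have := Complex.normSq_pos.2 this
    positivity
  · have := ht1 hh
    positivity

theorem contDiff_zpow_nrm (c : ChartIdx n) (k : ℕ) (b : Bool) :
    ContDiff ℝ ∞ fun x => nrm c x ^ (-weight k b) := by
  have hf : ∀ i, ContDiff ℝ ∞ fun x => frame c x i := fun i => by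
    by_cases hi : i = c.1
    · subst hi; simpa [frame] using contDiff_const
    · simpa [frame, hi] using contDiff_apply ℝ ℂ i
  have hN : ContDiff ℝ ∞ (nrm c) := by
    unfold nrm
    refine ContDiff.sum fun i _ => ?_
    simp only [Complex.normSq_apply]
    have hre := Complex.reCLM.contDiff.comp (hf i)
    have him := Complex.imCLM.contDiff.comp (hf i)
    exact (hre.mul hre).add (him.mul him)
  cases b
  · simpa [weight] using hN.pow k
  · simp only [weight, cond_true, zpow_neg, zpow_natCast]
    exact (hN.pow k).inv fun x => (pow_pos (nrm_pos c x) k).ne'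

theorem contDiff_ofReal_comp {V : Type*} [NormedAddCommGroup V] [NormedSpace ℝ V] {f : V → ℝ}
    (hf : ContDiff ℝ ∞ f) : ContDiff ℝ ∞ fun x => (f x : ℂ) :=
  Complex.ofRealCLM.contDiff.comp hf

theorem contDiff_conj_comp {V : Type*} [NormedAddCommGroup V] [NormedSpace ℝ V] {f : V → ℂ}
    (hf : ContDiff ℝ ∞ f) : ContDiff ℝ ∞ fun x => conj (f x) :=
  (Complex.conjCLE : ℂ →L[ℝ] ℂ).contDiff.comp hf

theorem contDiff_rho (k : ℕ) (c : ChartIdx n) : ContDiff ℝ ∞ (rho k c) := by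
  unfold rho
  refine ContDiff.mul ?_ (contDiff_zpow_nrm c k c.2)
  simp only [Complex.normSq_apply]
  have hre := Complex.reCLM.contDiff.comp (contDiff_apply ℝ ℂ c.1 : ContDiff ℝ ∞ _)
  have him := Complex.imCLM.contDiff.comp (contDiff_apply ℝ ℂ c.1 : ContDiff ℝ ∞ _)
  exact (hre.mul hre).add (him.mul him)

theorem contDiff_inn_frame (c : ChartIdx n) (v : Fin n → ℂ) :
    ContDiff ℝ ∞ fun x => inn v (frame c x) := by
  unfold inn
  refine ContDiff.sum fun i _ => contDiff_const.mul (contDiff_conj_comp ?_)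
  by_cases hi : i = c.1
  · subst hi; simpa [frame] using contDiff_const
  · simpa [frame, hi] using contDiff_apply ℝ ℂ i

theorem contDiff_inv_nrm (c : ChartIdx n) : ContDiff ℝ ∞ fun x => ((nrm c x : ℂ))⁻¹ := by
  have := contDiff_ofReal_comp (contDiff_zpow_nrm c 1 true)
  simpa [weight] using this

theorem contDiff_vert (k : ℕ) (c : ChartIdx n) (v : Fin n → ℂ) :
    ContDiff ℝ ∞ fun x => vert k c x v := by
  unfold vert
  simp only [div_eq_mul_inv]
  exact contDiff_const.sub ((contDiff_const.mul (contDiff_apply ℝ ℂ c.1)).mul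
    ((contDiff_inn_frame c _).mul (contDiff_inv_nrm c)))

theorem contDiff_fubini (c : ChartIdx n) (v w : Fin n → ℂ) :
    ContDiff ℝ ∞ fun x => fubini c x v w := by
  unfold fubini
  simp only [div_eq_mul_inv, ← inv_pow]
  have h := contDiff_conj_comp (contDiff_inn_frame c (hor c w))
  simp only [conj_inn] at h
  exact (contDiff_const.mul (contDiff_inv_nrm c)).sub
    (((contDiff_inn_frame c _).mul h).mul ((contDiff_inv_nrm c).pow 2))

/-- Joint smoothness of an invariant tensor in the point and in parameters. -/
theorem contDiff_tensor {P : Type*} [NormedAddCommGroup P] [NormedSpace ℝ P] {k : ℕ}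
    {F E : P → Bool → ℝ → ℝ}
    (hF : ∀ b s r, 0 ≤ r → ContDiffAt ℝ ∞ (fun p : P × ℝ => F p.1 b p.2) (s, r))
    (hE : ∀ b s r, 0 ≤ r → ContDiffAt ℝ ∞ (fun p : P × ℝ => E p.1 b p.2) (s, r))
    (c : ChartIdx n) (v w : Fin n → ℂ) :
    ContDiff ℝ ∞ fun p : P × (Fin n → ℂ) => tensor k (F p.1) (E p.1) c p.2 v w := by
  have hr : ContDiff ℝ ∞ fun p : P × (Fin n → ℂ) => (p.1, rho k c p.2) :=
    contDiff_fst.prodMk ((contDiff_rho k c).comp contDiff_snd)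
  have h1 : ContDiff ℝ ∞ fun p : P × (Fin n → ℂ) => F p.1 c.2 (rho k c p.2) :=
    contDiff_iff_contDiffAt.2 fun p =>
      ContDiffAt.comp (g := fun q : P × ℝ => F q.1 c.2 q.2) p
        (hF c.2 p.1 _ (rho_nonneg k c p.2)) hr.contDiffAt
  have h2 : ContDiff ℝ ∞ fun p : P × (Fin n → ℂ) => E p.1 c.2 (rho k c p.2) :=
    contDiff_iff_contDiffAt.2 fun p =>
      ContDiffAt.comp (g := fun q : P × ℝ => E q.1 c.2 q.2) p
        (hE c.2 p.1 _ (rho_nonneg k c p.2)) hr.contDiffAt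
  unfold tensor
  refine ((contDiff_ofReal_comp h1).mul ((contDiff_fubini c v w).comp contDiff_snd)).add
    ((contDiff_ofReal_comp (h2.mul ((contDiff_zpow_nrm c k c.2).comp contDiff_snd))).mul ?_)
  exact ((contDiff_vert k c v).comp contDiff_snd).mul
    (contDiff_conj_comp ((contDiff_vert k c w).comp contDiff_snd))

/-- Functions of the radius that define an invariant Kähler metric. -/
structure RadialPair (k : ℕ) where
  /-- The base coefficient. -/
  F : Bool → ℝ → ℝ
  /-- The fibre coefficient. -/
  E : Bool → ℝ → ℝ
  contDiffAt_F : ∀ b r, 0 ≤ r → ContDiffAt ℝ ∞ (F b) r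
  contDiffAt_E : ∀ b r, 0 ≤ r → ContDiffAt ℝ ∞ (E b) r
  F_not : ∀ b r, 0 < r → F (!b) r⁻¹ = F b r
  E_not : ∀ b r, 0 < r → E (!b) r⁻¹ = E b r * r ^ 2
  F_pos : ∀ b r, 0 ≤ r → 0 < F b r
  E_pos : ∀ b r, 0 ≤ r → 0 < E b r
  hasDerivAt_F : ∀ b r, 0 ≤ r → HasDerivAt (F b) (-weight k b * E b r) r

namespace RadialPair

variable {k : ℕ} (P : RadialPair k)

theorem hasDerivAt_E (b : Bool) {r : ℝ} (hr : 0 ≤ r) : HasDerivAt (P.E b) (deriv (P.E b) r) r :=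
  ((P.contDiffAt_E b r hr).differentiableAt (by simp)).hasDerivAt

theorem hasWirt_tensor (c : ChartIdx n) (x u v w : Fin n → ℂ) :
    HasWirt (fun y => tensor k P.F P.E c y v w)
      (tensorDeriv k (P.F c.2 (rho k c x)) (P.E c.2 (rho k c x))
        (-weight k c.2 * P.E c.2 (rho k c x)) (deriv (P.E c.2) (rho k c x)) c x u v w)
      (conj (tensorDeriv k (P.F c.2 (rho k c x)) (P.E c.2 (rho k c x))
        (-weight k c.2 * P.E c.2 (rho k c x)) (deriv (P.E c.2) (rho k c x)) c x u w v)) x u :=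
  Hirzebruch.hasWirt_tensor c x u v w (P.hasDerivAt_F c.2 _ (rho_nonneg k c x))
    (P.hasDerivAt_E c.2 (rho_nonneg k c x))

/-- The invariant Kähler metric of a `RadialPair`. -/
def metric (n : ℕ) : KahlerMetric n k where
  coeff := tensorCoeff k P.F P.E
  compatible := (preserves_id_iff _).2 (preserves_tensorCoeff P.F_not P.E_not 1)
  smooth c a b := by
    have := contDiff_tensor (P := ℝ) (k := k) (F := fun _ => P.F) (E := fun _ => P.E)
      (fun b s r hr => (P.contDiffAt_F b r hr).comp (s, r) contDiffAt_snd)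
      (fun b s r hr => (P.contDiffAt_E b r hr).comp (s, r) contDiffAt_snd) c
      (Pi.single a 1 : Fin n → ℂ) (Pi.single b 1)
    exact this.comp (contDiff_const.prodMk contDiff_id : ContDiff ℝ ∞ fun x => ((0 : ℝ), x))
  hermitian c x a b := (conj_tensor k P.F P.E c x _ _).symm
  pos c x v hv := by
    rw [herm_tensorCoeff]
    exact tensor_self_re_pos P.F_pos P.E_pos c x hv
  closed c x a b e := by
    change dz e (fun y => tensor k P.F P.E c y (Pi.single a 1) (Pi.single b 1)) x =
      dz a (fun y => tensor k P.F P.E c y (Pi.single e 1) (Pi.single b 1)) x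
    rw [(P.hasWirt_tensor c x (Pi.single e 1) _ _).dz_eq,
      (P.hasWirt_tensor c x (Pi.single a 1) _ _).dz_eq]
    exact tensorDeriv_comm c x _ _ _ _ _ _ _ rfl

theorem isUnitaryInvariant_metric : (P.metric n).IsUnitaryInvariant :=
  fun A => preserves_tensorCoeff P.F_not P.E_not A

end RadialPair

/-! ### Continuous families -/

/-- Joint smoothness is what the induction can carry. Joint continuity of every iterated derivative
then gives, by currying, continuity into the compact-open topology. -/
theorem continuous_iteratedFDeriv_param {P V W : Type*} [NormedAddCommGroup P] [NormedSpace ℝ P]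
    [NormedAddCommGroup V] [NormedSpace ℝ V] [NormedAddCommGroup W] [NormedSpace ℝ W]
    {f : P → V → W} (hf : ContDiff ℝ ∞ (Function.uncurry f)) (m : ℕ) :
    ContDiff ℝ ∞ fun p : P × V => iteratedFDeriv ℝ m (f p.1) p.2 := by
  induction m with
  | zero =>
    have : (fun p : P × V => iteratedFDeriv ℝ 0 (f p.1) p.2) = fun p =>
        (continuousMultilinearCurryFin0 ℝ V W).symm (f p.1 p.2) := by
      funext p; rw [iteratedFDeriv_zero_eq_comp]; rfl
    rw [this]
    exact (continuousMultilinearCurryFin0 ℝ V W).symm.contDiff.comp hf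
  | succ m ih =>
    have : (fun p : P × V => iteratedFDeriv ℝ (m + 1) (f p.1) p.2) = fun p =>
        (continuousMultilinearCurryLeftEquiv ℝ (fun _ : Fin (m + 1) => V) W).symm
          (fderiv ℝ (fun y => iteratedFDeriv ℝ m (f p.1) y) p.2) := by
      funext p; rw [iteratedFDeriv_succ_eq_comp_left]; rfl
    rw [this]
    have hI : ContDiff ℝ ∞ fun φ : V →L[ℝ] (V [×m]→L[ℝ] W) =>
        (continuousMultilinearCurryLeftEquiv ℝ (fun _ : Fin (m + 1) => V) W).symm φ :=
      IsBoundedLinearMap.contDiff ⟨⟨fun x y => map_add _ x y, fun x y => map_smul _ x y⟩, 1, one_pos,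
        fun x => by rw [one_mul]; exact (LinearIsometryEquiv.norm_map _ x).le⟩
    refine hI.comp ?_
    refine ContDiff.fderiv (f := fun p : P × V => fun y => iteratedFDeriv ℝ m (f p.1) y) (n := ∞)
      (m := ∞) ?_ contDiff_snd (by norm_num)
    exact ih.comp ((contDiff_fst.comp contDiff_fst).prodMk contDiff_snd)

theorem continuous_of_contDiff_coeff {k : ℕ} {g : ℝ → KahlerMetric n k}
    (hg : ∀ c a b, ContDiff ℝ ∞ fun p : ℝ × (Fin n → ℂ) => (g p.1).coeff c p.2 a b) :
    Continuous g := by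
  refine continuous_iInf_rng.2 fun c => continuous_iInf_rng.2 fun a => continuous_iInf_rng.2
    fun b => continuous_iInf_rng.2 fun m => continuous_induced_rng.2 ?_
  refine ContinuousMap.continuous_of_continuous_uncurry _ ?_
  exact (continuous_iteratedFDeriv_param (f := fun s x => (g s).coeff c x a b) (hg c a b) m).continuous

theorem continuous_metric {k : ℕ} {P : ℝ → RadialPair k}
    (hF : ∀ b s r, 0 ≤ r → ContDiffAt ℝ ∞ (fun p : ℝ × ℝ => (P p.1).F b p.2) (s, r))
    (hE : ∀ b s r, 0 ≤ r → ContDiffAt ℝ ∞ (fun p : ℝ × ℝ => (P p.1).E b p.2) (s, r)) :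
    Continuous fun s => (P s).metric n :=
  continuous_of_contDiff_coeff fun c _ _ =>
    contDiff_tensor (F := fun s => (P s).F) (E := fun s => (P s).E) hF hE c _ _

/-! ### Moving points to a slice -/

/-- The Householder reflection in the hyperplane orthogonal to `w`. -/
def householder (w : Fin n → ℂ) : Matrix (Fin n) (Fin n) ℂ :=
  1 - (2 / inn w w) • Matrix.vecMulVec w (star w)

theorem star_dotProduct_self (w : Fin n → ℂ) : star w ⬝ᵥ w = inn w w := by
  rw [dotProduct_comm]; rfl

/-- The rank-one matrix `P = w w*` satisfies `P² = |w|² P`. For `w = 0` the coefficient `2 / 0` is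
`0` and the matrix is the identity. -/
theorem householder_mem (w : Fin n → ℂ) : householder w ∈ Matrix.unitaryGroup (Fin n) ℂ := by
  have hstar : star (householder w) = householder w := by
    have h1 : star (inn w w) = inn w w := conj_inn w w
    have h2 : star (Matrix.vecMulVec w (star w)) = Matrix.vecMulVec w (star w) := by
      rw [Matrix.star_eq_conjTranspose, Matrix.conjTranspose_vecMulVec, star_star]
    rw [householder, star_sub, star_one, star_smul, star_div₀, h1, h2]
    simp
  rw [Matrix.mem_unitaryGroup_iff, hstar, householder]
  set P := Matrix.vecMulVec w (star w) with hP
  set m := inn w w with hm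
  have hPP : P * P = m • P := by
    rw [hP, Matrix.vecMulVec_mul_vecMulVec, star_dotProduct_self]
    ext i j
    simp [Matrix.vecMulVec_apply, hm]
    ring
  rw [sub_mul, mul_sub, mul_sub, one_mul, mul_one, one_mul, smul_mul_smul_comm, hPP]
  by_cases h0 : m = 0
  · simp [h0]
  · have : 2 / m * (2 / m) * m = 2 * (2 / m) := by field_simp
    rw [smul_smul, this]
    module

theorem householder_mulVec (w z : Fin n → ℂ) :
    (householder w).mulVec z = z - (2 / inn w w * inn z w) • w := by
  rw [householder, Matrix.sub_mulVec, Matrix.one_mulVec, Matrix.smul_mulVec,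
    Matrix.vecMulVec_mulVec, dotProduct_comm]
  rw [show z ⬝ᵥ star w = inn z w from rfl]
  ext i
  simp
  ring

/-- Since `z` has `j`-th entry `1`, its product with `|z| e_j` is real, so the reflection along `z -
|z| e_j` exchanges two vectors of equal length. If `|z|² = |z|`, that difference is `0` and there is
nothing to move. -/
theorem exists_unitary_mulVec_frame (c : ChartIdx n) (x : Fin n → ℂ) :
    ∃ A : Matrix.unitaryGroup (Fin n) ℂ,
      A.1.mulVec (frame c x) = Pi.single c.1 ((√(nrm c x) : ℝ) : ℂ) := by
  set z := frame c x
  set q : ℂ := ((√(nrm c x) : ℝ) : ℂ)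
  have hq : q * q = nrm c x := by
    rw [← Complex.ofReal_mul, Real.mul_self_sqrt (nrm_pos c x).le]
  have hqc : conj q = q := Complex.conj_ofReal _
  have hz : z c.1 = 1 := by simp [z, frame]
  set w := z - Pi.single c.1 q
  refine ⟨⟨householder w, householder_mem w⟩, ?_⟩
  have h1 : inn z (Pi.single c.1 q) = q := by
    rw [inn, Finset.sum_eq_single c.1]
    · simp [hz, hqc]
    · intro i _ hi; simp [Pi.single_eq_of_ne hi]
    · simp
  have h2 : inn (Pi.single c.1 q) z = q := by rw [← conj_inn, h1, hqc]
  have h3 : inn (Pi.single c.1 q) (Pi.single c.1 q) = q * q := by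
    rw [inn, Finset.sum_eq_single c.1]
    · simp [hqc]
    · intro i _ hi; simp [Pi.single_eq_of_ne hi]
    · simp
  have h4 : inn z z = q * q := by rw [hq]; exact inn_frame c x
  have h5 : inn z w = q * q - q := by rw [inn_sub_right, h1, h4]
  have h6 : inn w w = 2 * (q * q - q) := by
    rw [inn_sub_left, h5, inn_sub_right, h2, h3]; ring
  rw [householder_mulVec, h5, h6]
  by_cases h0 : q * q - q = 0
  · have hw : w = 0 := by
      have : inn w w = 0 := by rw [h6, h0, mul_zero]
      rw [inn_self] at this
      have h7 : ∑ i, Complex.normSq (w i) = 0 := by exact_mod_cast this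
      rw [Finset.sum_eq_zero_iff_of_nonneg fun i _ => Complex.normSq_nonneg _] at h7
      funext i
      exact Complex.normSq_eq_zero.1 (h7 i (Finset.mem_univ i))
    rw [hw, smul_zero, sub_zero]
    exact sub_eq_zero.1 hw
  · have h7 : ∀ a : ℂ, a ≠ 0 → 2 / (2 * a) * a = 1 := fun a ha => by field_simp
    rw [h7 _ h0, one_smul]
    simp [w]

/-- The diagonal unitary matrix with entry `u` at `j` and `1` elsewhere. -/
theorem exists_unitary_phase (j : Fin n) {u : ℂ} (hu : u * conj u = 1) :
    ∃ A : Matrix.unitaryGroup (Fin n) ℂ,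
      ∀ a : ℂ, A.1.mulVec (Pi.single j a) = Pi.single j (u * a) := by
  refine ⟨⟨Matrix.diagonal (Function.update 1 j u), ?_⟩, fun a => ?_⟩
  · rw [Matrix.mem_unitaryGroup_iff, Matrix.star_eq_conjTranspose, Matrix.diagonal_conjTranspose,
      Matrix.diagonal_mul_diagonal, ← Matrix.diagonal_one]
    congr 1
    funext i
    by_cases hi : i = j
    · subst hi; simpa using hu
    · simp [hi]
  · funext i
    by_cases hi : i = j
    · subst hi; simp [Matrix.mulVec_diagonal]
    · simp [Matrix.mulVec_diagonal, hi]

/-- A unit complex number with a prescribed power. -/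
theorem exists_unit_zpow_eq {m : ℤ} (hm : m ≠ 0) (y : ℂ) :
    ∃ u : ℂ, u * conj u = 1 ∧ y = ‖y‖ * u ^ m := by
  have hm' : (m : ℂ) ≠ 0 := by exact_mod_cast hm
  refine ⟨Complex.exp ((Complex.arg y / m : ℝ) * Complex.I), ?_, ?_⟩
  · rw [Complex.mul_conj, Complex.normSq_eq_norm_sq, Complex.norm_exp_ofReal_mul_I]; simp
  · rw [← Complex.exp_int_mul]
    have : (m : ℂ) * (((Complex.arg y / m : ℝ) : ℂ) * Complex.I) = Complex.arg y * Complex.I := by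
      push_cast; field_simp
    rw [this, Complex.norm_mul_exp_arg_mul_I]

/-- The point of the slice of the chart `c` with fibre coordinate `t`. -/
def slicePt (c : ChartIdx n) (t : ℂ) : Fin n → ℂ := Pi.single c.1 t

theorem weight_ne_zero {k : ℕ} (hk : 1 ≤ k) (b : Bool) : weight k b ≠ 0 := by
  cases b <;> simp [weight] <;> omega

/-- A reflection moves the base point to a coordinate axis; a phase `u` on that axis then multiplies
the fibre coordinate by `u ^ (-weight)`. Every argument can be removed this way because `k ≥ 1`
makes the weight non-zero. -/
theorem exists_actMap_eq_slicePt {k : ℕ} (hk : 1 ≤ k) (c : ChartIdx n) (x : Fin n → ℂ) :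
    ∃ A : Matrix.unitaryGroup (Fin n) ℂ,
      A • ((chart (k := k) c).symm x) ∈ (chart (k := k) c).source ∧
      ∃ t : ℝ, 0 ≤ t ∧ actMap A c c k x = slicePt c t := by
  obtain ⟨A, hA⟩ := exists_unitary_mulVec_frame c x
  obtain ⟨u, hu, hx⟩ := exists_unit_zpow_eq (weight_ne_zero hk c.2) (x c.1)
  obtain ⟨B, hB⟩ := exists_unitary_phase c.1 hu
  have hu0 : u ≠ 0 := fun h => by simp [h] at hu
  have hBA : (B * A).1.mulVec (frame c x) = Pi.single c.1 (u * ((√(nrm c x) : ℝ) : ℂ)) := by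
    rw [Submonoid.coe_mul, ← Matrix.mulVec_mulVec, hA, hB]
  have hs : scale (B * A) c c x = u * ((√(nrm c x) : ℝ) : ℂ) := by
    rw [scale, hBA, Pi.single_eq_same]
  have hN : 0 < √(nrm c x) := Real.sqrt_pos.2 (nrm_pos c x)
  have hs0 : scale (B * A) c c x ≠ 0 := by
    rw [hs]; exact mul_ne_zero hu0 (by exact_mod_cast hN.ne')
  refine ⟨B * A, mem_source_iff.2 ⟨hs0, fun h => absurd rfl h⟩,
    ‖x c.1‖ * √(nrm c x) ^ (-weight k c.2), by positivity, ?_⟩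
  funext i
  by_cases hi : i = c.1
  · subst hi
    rw [actMap_fibre_eq rfl, hs, slicePt, Pi.single_eq_same, mul_zpow]
    nth_rewrite 1 [hx]
    push_cast
    have : u ^ weight k c.2 * u ^ (-weight k c.2) = 1 := by
      rw [← zpow_add₀ hu0]; simp
    linear_combination (‖x c.1‖ * (√(nrm c x) : ℂ) ^ (-weight k c.2)) * this
  · rw [actMap_of_ne hi, hBA, slicePt, Pi.single_eq_of_ne hi, Pi.single_eq_of_ne hi, zero_div]

theorem ext_of_herm {G G' : Matrix (Fin n) (Fin n) ℂ} (h : ∀ v w, herm G v w = herm G' v w) :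
    G = G' := by
  ext a b
  rw [← herm_single G, ← herm_single G', h]

/-- Invariant tensors are determined by their values on the slices. -/
theorem eq_of_eq_on_slices {k : ℕ} (hk : 1 ≤ k)
    {G G' : ChartIdx n → (Fin n → ℂ) → Matrix (Fin n) (Fin n) ℂ}
    (hG : ∀ A : Matrix.unitaryGroup (Fin n) ℂ,
      Preserves (fun p : HirzebruchManifold n k => A • p) G)
    (hG' : ∀ A : Matrix.unitaryGroup (Fin n) ℂ,
      Preserves (fun p : HirzebruchManifold n k => A • p) G')
    (h : ∀ (c : ChartIdx n) (t : ℝ), 0 ≤ t → G c (slicePt c t) = G' c (slicePt c t)) :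
    G = G' := by
  funext c x
  obtain ⟨A, hA, t, ht, hAt⟩ := exists_actMap_eq_slicePt hk c x
  refine ext_of_herm fun v w => ?_
  rw [← hG A c c x hA, ← hG' A c c x hA]
  rw [show inCharts (fun p : HirzebruchManifold n k => A • p) c c x = slicePt c t from hAt,
    h c t ht]

/-! ### Monomial matrices -/

/-- The matrix sending the basis vector `e_i` to `ε_i e_{σ i}`. -/
def monomialMatrix (σ : Equiv.Perm (Fin n)) (ε : Fin n → ℂ) : Matrix (Fin n) (Fin n) ℂ :=
  Matrix.of fun p q => if p = σ q then ε q else 0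

theorem monomialMatrix_mulVec (σ : Equiv.Perm (Fin n)) (ε z : Fin n → ℂ) (i : Fin n) :
    (monomialMatrix σ ε).mulVec z (σ i) = ε i * z i := by
  simp [Matrix.mulVec, dotProduct, monomialMatrix]

theorem monomialMatrix_mem (σ : Equiv.Perm (Fin n)) {ε : Fin n → ℂ}
    (hε : ∀ i, ε i * conj (ε i) = 1) : monomialMatrix σ ε ∈ Matrix.unitaryGroup (Fin n) ℂ := by
  rw [Matrix.mem_unitaryGroup_iff']
  ext a b
  rw [Matrix.star_eq_conjTranspose, Matrix.mul_apply, Matrix.one_apply]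
  simp only [Matrix.conjTranspose_apply, monomialMatrix, Matrix.of_apply]
  rw [Finset.sum_eq_single (σ b)]
  · by_cases hab : a = b
    · subst hab
      simpa [mul_comm] using hε a
    · have : σ b ≠ σ a := fun h => hab (σ.injective h).symm
      simp [this, hab]
  · intro p _ hp; simp [hp]
  · simp

/-- A monomial matrix acts linearly in the charts `(j, b)` and `(σ j, b)` and carries slice to
slice. Sign changes will kill the off-diagonal entries, permutations will identify the diagonal
ones, and a common phase will give evenness in `t`. -/
theorem coeff_monomial {k : ℕ} {G : ChartIdx n → (Fin n → ℂ) → Matrix (Fin n) (Fin n) ℂ}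
    (hG : ∀ A : Matrix.unitaryGroup (Fin n) ℂ,
      Preserves (fun p : HirzebruchManifold n k => A • p) G)
    (σ : Equiv.Perm (Fin n)) {ε : Fin n → ℂ} (hε : ∀ i, ε i * conj (ε i) = 1)
    (j : Fin n) (b : Bool) (t : ℂ) :
    G (j, b) (slicePt (j, b) t) j j =
      G (σ j, b) (slicePt (σ j, b) (t * ε j ^ (-weight k b))) (σ j) (σ j) ∧
    (∀ a a', a ≠ j → a' ≠ j → G (j, b) (slicePt (j, b) t) a a' = ε a * conj (ε a') *
      G (σ j, b) (slicePt (σ j, b) (t * ε j ^ (-weight k b))) (σ a) (σ a')) ∧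
    (∀ a, a ≠ j → G (j, b) (slicePt (j, b) t) j a = ε j ^ (-weight k b) * (ε j * conj (ε a)) *
      G (σ j, b) (slicePt (σ j, b) (t * ε j ^ (-weight k b))) (σ j) (σ a)) := by
  let A : Matrix.unitaryGroup (Fin n) ℂ := ⟨monomialMatrix σ ε, monomialMatrix_mem σ hε⟩
  have hε0 : ∀ i, ε i ≠ 0 := fun i h => by have := hε i; simp [h] at this
  have hinv : ∀ i, (ε i)⁻¹ = conj (ε i) := fun i => inv_eq_of_mul_eq_one_right (hε i)
  have hz : ∀ m : ℤ, ε j ^ m * conj (ε j ^ m) = 1 := fun m => by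
    rw [map_zpow₀, ← mul_zpow, hε, one_zpow]
  have hscale : ∀ x, scale A (j, b) (σ j, b) x = ε j := fun x => by
    rw [scale]
    change (monomialMatrix σ ε).mulVec _ (σ j) = _
    rw [monomialMatrix_mulVec]; simp [frame]
  let m : Fin n → ℂ := fun i => if i = j then ε j ^ (-weight k b) else ε i * conj (ε j)
  have hact : ∀ x i, actMap A (j, b) (σ j, b) k x (σ i) = m i * x i := fun x i => by
    by_cases hi : i = j
    · subst hi
      have := actMap_fibre_eq (k := k) (A := A) (c := (i, b)) (d := (σ i, b)) (x := x) rfl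
      rw [hscale] at this
      refine this.trans ?_
      simp [m, mul_comm]
    · rw [actMap_of_ne (fun h => hi (σ.injective h)), hscale]
      change (monomialMatrix σ ε).mulVec _ (σ i) / _ = _
      rw [monomialMatrix_mulVec, div_eq_mul_inv, hinv]
      simp [m, hi, frame]
      ring
  let M : (Fin n → ℂ) →L[ℂ] (Fin n → ℂ) := LinearMap.toContinuousLinearMap
    ⟨⟨fun x p => m (σ.symm p) * x (σ.symm p), fun x y => by ext; simp [mul_add]⟩,
      fun a x => by ext; simp [mul_left_comm]⟩
  have hMe : actMap A (j, b) (σ j, b) k = M := by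
    funext x p
    obtain ⟨i, rfl⟩ := σ.surjective p
    rw [hact]
    simp [M]
  have hMs : ∀ i (a : ℂ), M (Pi.single i a) = Pi.single (σ i) (m i * a) := fun i a => by
    funext p
    obtain ⟨l, rfl⟩ := σ.surjective p
    by_cases hl : l = i
    · subst hl; simp [M]
    · have : σ l ≠ σ i := fun h => hl (σ.injective h)
      simp [M, hl, this]
  have hsrc : ∀ x, A • ((chart (k := k) (j, b)).symm x) ∈ (chart (k := k) (σ j, b)).source :=
    fun x => mem_source_iff.2 ⟨by rw [hscale]; exact hε0 j, fun h => absurd rfl h⟩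
  have key : ∀ a a', G (j, b) (slicePt (j, b) t) a a' = m a * conj (m a') *
      G (σ j, b) (slicePt (σ j, b) (t * ε j ^ (-weight k b))) (σ a) (σ a') := fun a a' => by
    have h := hG A (j, b) (σ j, b) (slicePt (j, b) t) (hsrc _) (Pi.single a 1) (Pi.single a' 1)
    have h' : inCharts (fun p : HirzebruchManifold n k => A • p) (j, b) (σ j, b) = M := hMe
    rw [h', M.fderiv, herm_single, hMs, hMs] at h
    have hsl : M (slicePt (j, b) t) = slicePt (σ j, b) (t * ε j ^ (-weight k b)) := by
      rw [slicePt, hMs]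
      simp [m, slicePt, mul_comm]
    rw [hsl] at h
    rw [← h]
    have hsm : ∀ i, (Pi.single (σ i) (m i * 1) : Fin n → ℂ) = m i • Pi.single (σ i) 1 := fun i => by
      rw [← Pi.single_smul, smul_eq_mul]
    rw [hsm, hsm]
    rw [← herm_single (G (σ j, b) _)]
    simp only [herm, Pi.smul_apply, smul_eq_mul, map_mul, Finset.mul_sum]
    refine Finset.sum_congr rfl fun i _ => Finset.sum_congr rfl fun l _ => ?_
    ring
  refine ⟨?_, fun a a' ha ha' => ?_, fun a ha => ?_⟩
  · rw [key]
    simp only [m, if_true, hz, one_mul]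
  · rw [key]
    simp only [m, ha, ha', if_false, map_mul, Complex.conj_conj]
    linear_combination (ε a * conj (ε a') * G (σ j, b) (slicePt (σ j, b)
      (t * ε j ^ (-weight k b))) (σ a) (σ a')) * (hε j)
  · rw [key]
    simp only [m, ha, if_true, if_false, map_mul, Complex.conj_conj]
    ring

/-! ### Every invariant Kähler metric comes from functions of the radius -/

section Slice

variable (c : ChartIdx n) (t : ℂ)

theorem hor_slicePt : hor c (slicePt c t) = 0 := by
  funext i
  by_cases hi : i = c.1
  · subst hi; simp [hor]
  · simp [hor, slicePt, hi]

theorem inn_hor_frame_slicePt (v : Fin n → ℂ) : inn (hor c v) (frame c (slicePt c t)) = 0 := by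
  rw [inn_hor_frame, hor_slicePt]; simp [inn]

theorem inn_frame_slicePt_hor (v : Fin n → ℂ) : inn (frame c (slicePt c t)) (hor c v) = 0 := by
  rw [← conj_inn, inn_hor_frame_slicePt, map_zero]

theorem nrm_slicePt : nrm c (slicePt c t) = 1 := by
  rw [nrm_eq, hor_slicePt]; simp

theorem rho_slicePt (k : ℕ) : rho k c (slicePt c t) = Complex.normSq t := by
  rw [rho, nrm_slicePt]; simp [slicePt]

theorem vert_slicePt (k : ℕ) (v : Fin n → ℂ) : vert k c (slicePt c t) v = v c.1 := by
  rw [vert, inn_hor_frame_slicePt]; simp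

theorem fubini_slicePt (v w : Fin n → ℂ) :
    fubini c (slicePt c t) v w = inn (hor c v) (hor c w) := by
  rw [fubini, inn_hor_frame_slicePt, nrm_slicePt]; simp

theorem tensor_slicePt (k : ℕ) (F E : Bool → ℝ → ℝ) (v w : Fin n → ℂ) :
    tensor k F E c (slicePt c t) v w =
      F c.2 (Complex.normSq t) * inn (hor c v) (hor c w) +
        E c.2 (Complex.normSq t) * (v c.1 * conj (w c.1)) := by
  rw [tensor, fubini_slicePt, vert_slicePt, vert_slicePt, rho_slicePt, nrm_slicePt]
  simp

theorem tensorDeriv_slicePt (k : ℕ) (F E F' E' : ℝ) (u v w : Fin n → ℂ) :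
    tensorDeriv k F E F' E' c (slicePt c t) u v w =
      F' * conj t * u c.1 * inn (hor c v) (hor c w) +
      E' * conj t * u c.1 * (v c.1 * conj (w c.1)) -
      E * weight k c.2 * conj t * v c.1 * inn (hor c u) (hor c w) := by
  simp only [tensorDeriv, fubini_slicePt, vert_slicePt, nrm_slicePt, inn_hor_frame_slicePt,
    inn_frame_slicePt_hor]
  simp [slicePt]
  ring

end Slice

theorem hor_single_self (c : ChartIdx n) : hor c (Pi.single c.1 1) = 0 := hor_slicePt c 1

theorem hor_single_of_ne (c : ChartIdx n) {a : Fin n} (ha : a ≠ c.1) :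
    hor c (Pi.single a 1) = Pi.single a 1 := by
  funext i
  by_cases hi : i = c.1
  · subst hi; simp [hor, ha.symm]
  · simp [hor, hi]

theorem inn_single_single (a b : Fin n) :
    inn (Pi.single a 1 : Fin n → ℂ) (Pi.single b 1) = if a = b then 1 else 0 := by
  rw [inn, Finset.sum_eq_single a]
  · by_cases h : a = b
    · subst h; simp
    · simp [h]
  · intro i _ hi; simp [Pi.single_eq_of_ne hi]
  · simp

theorem tensorCoeff_slicePt (k : ℕ) (F E : Bool → ℝ → ℝ) (c : ChartIdx n) (t : ℂ) (a b : Fin n) :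
    tensorCoeff k F E c (slicePt c t) a b = if a = b then
      (if a = c.1 then (E c.2 (Complex.normSq t) : ℂ) else F c.2 (Complex.normSq t)) else 0 := by
  rw [tensorCoeff, Matrix.of_apply, tensor_slicePt]
  by_cases ha : a = c.1
  · subst ha
    rw [hor_single_self]
    by_cases hb : c.1 = b
    · subst hb; simp [inn]
    · simp [inn, hb]
  · by_cases hb : b = c.1
    · subst hb
      rw [hor_single_self]
      simp [inn, ha]
    · rw [hor_single_of_ne c ha, hor_single_of_ne c hb, inn_single_single]
      by_cases hab : a = b
      · subst hab; simp [ha]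
      · simp [hab, Ne.symm ha]

/-! ### Coefficients of an invariant metric along a slice. -/

namespace KahlerMetric

variable {k : ℕ} {g : KahlerMetric n k}

theorem coeff_self_eq_re (g : KahlerMetric n k) (c : ChartIdx n) (x : Fin n → ℂ) (a : Fin n) :
    g.coeff c x a a = ((g.coeff c x a a).re : ℂ) :=
  (Complex.conj_eq_iff_re.1 (g.hermitian c x a a).symm).symm

theorem coeff_self_pos (g : KahlerMetric n k) (c : ChartIdx n) (x : Fin n → ℂ) (a : Fin n) :
    0 < (g.coeff c x a a).re := by
  have := g.pos c x (Pi.single a 1) (by simp)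
  rwa [herm_single] at this

theorem coeff_slicePt_of_ne (hg : g.IsUnitaryInvariant) (c : ChartIdx n) (t : ℂ) {a b : Fin n}
    (hab : a ≠ b) : g.coeff c (slicePt c t) a b = 0 := by
  have key : ∀ a b, a ≠ b → b ≠ c.1 → g.coeff c (slicePt c t) a b = 0 := by
    intro a b hab hb
    let ε : Fin n → ℂ := Function.update 1 b (-1)
    have hε : ∀ i, ε i * conj (ε i) = 1 := fun i => by
      by_cases hi : i = b
      · subst hi; simp [ε]
      · simp [ε, hi]
    have hεj : ε c.1 = 1 := by simp [ε, hb.symm]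
    have hεa : ε a = 1 := by simp [ε, hab]
    have hεb : ε b = -1 := by simp [ε]
    obtain ⟨-, h2, h3⟩ := coeff_monomial hg 1 hε c.1 c.2 t
    simp only [hεj, one_zpow, mul_one, Equiv.Perm.coe_one, id] at h2 h3
    by_cases ha : a = c.1
    · have := h3 b hb
      rw [hεb] at this
      simp only [map_neg, map_one, one_mul, neg_mul] at this
      rw [ha]
      exact self_eq_neg.1 this
    · have := h2 a b ha hb
      rw [hεa, hεb] at this
      simp only [map_neg, map_one, one_mul, mul_neg, mul_one, neg_mul] at this
      exact self_eq_neg.1 this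
  by_cases hb : b = c.1
  · rw [← Complex.conj_conj (g.coeff c _ a b), ← g.hermitian, key b a hab.symm
      (fun h => hab (h.trans hb.symm)), map_zero]
  · exact key a b hab hb

theorem coeff_slicePt_fibre (hg : g.IsUnitaryInvariant) (j j₀ : Fin n) (b : Bool) (t : ℂ) :
    g.coeff (j, b) (slicePt (j, b) t) j j = g.coeff (j₀, b) (slicePt (j₀, b) t) j₀ j₀ := by
  have := (coeff_monomial hg (Equiv.swap j j₀) (ε := 1) (by simp) j b t).1
  simpa using this

theorem coeff_slicePt_base (hg : g.IsUnitaryInvariant) {j a j₀ i₀ : Fin n} (ha : a ≠ j)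
    (hi : i₀ ≠ j₀) (b : Bool) (t : ℂ) :
    g.coeff (j, b) (slicePt (j, b) t) a a = g.coeff (j₀, b) (slicePt (j₀, b) t) i₀ i₀ := by
  -- The first swap takes `j` to `j₀`; the second takes the image of `a` to `i₀` and fixes `j₀`.
  let σ : Equiv.Perm (Fin n) := Equiv.swap (Equiv.swap j j₀ a) i₀ * Equiv.swap j j₀
  have hσa : σ a = i₀ := by simp [σ]
  have hσj : σ j = j₀ := by
    simp only [σ, Equiv.Perm.mul_apply, Equiv.swap_apply_left]
    refine Equiv.swap_apply_of_ne_of_ne (fun h => ha ?_) hi.symm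
    have := congrArg (Equiv.swap j j₀) h
    simpa using this.symm
  have := (coeff_monomial hg σ (ε := 1) (by simp) j b t).2.1 a a ha ha
  rw [hσa, hσj] at this
  simpa using this

/-- A scalar unitary matrix `u` with `u ^ (-weight) = -1` acts on the slice by `t ↦ -t`. -/
theorem coeff_slicePt_neg (hk : 1 ≤ k) (hg : g.IsUnitaryInvariant) (j : Fin n) (b : Bool) (t : ℂ) :
    g.coeff (j, b) (slicePt (j, b) (-t)) j j = g.coeff (j, b) (slicePt (j, b) t) j j := by
  obtain ⟨u, hu, hu'⟩ := exists_unit_zpow_eq (m := -weight k b)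
    (neg_ne_zero.2 (weight_ne_zero hk b)) (-1)
  have := (coeff_monomial hg 1 (ε := fun _ => u) (fun _ => hu) j b t).1
  simp only [norm_neg, norm_one, Complex.ofReal_one, one_mul] at hu'
  rw [← hu'] at this
  simpa using this.symm

/-- The change of charts sends `t` to `1 / t` on the slice. Its differential there is the identity
on the base and `-1 / t ^ 2` on the fibre, which enters the fibre coefficient squared. -/
theorem coeff_slicePt_inv (hg : g.IsUnitaryInvariant) (j : Fin n) (b : Bool) {t : ℝ} (ht : 0 < t) :
    (∀ a, a ≠ j → g.coeff (j, !b) (slicePt (j, !b) ((t⁻¹ : ℝ) : ℂ)) a a =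
      g.coeff (j, b) (slicePt (j, b) t) a a) ∧
    g.coeff (j, !b) (slicePt (j, !b) ((t⁻¹ : ℝ) : ℂ)) j j =
      g.coeff (j, b) (slicePt (j, b) t) j j * t ^ 4 := by
  have htc : (t : ℂ) ≠ 0 := by exact_mod_cast ht.ne'
  have hscale : ∀ x, scale 1 (j, b) (j, !b) x = 1 := fun x => by
    rw [scale]; simp [frame]
  have hcd : ((j, b) : ChartIdx n).2 ≠ ((j, !b) : ChartIdx n).2 := by simp
  have hsrc : (1 : Matrix.unitaryGroup (Fin n) ℂ) • ((chart (k := k) (j, b)).symm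
      (slicePt (j, b) t)) ∈ (chart (k := k) (j, !b)).source :=
    mem_source_iff.2 ⟨by rw [hscale]; exact one_ne_zero, fun _ => by simpa [slicePt] using htc⟩
  obtain ⟨L, hL, hLv⟩ := exists_hasFDerivAt_actMap hsrc
  have hy : actMap 1 (j, b) (j, !b) k (slicePt (j, b) (t : ℂ)) =
      slicePt (j, !b) ((t⁻¹ : ℝ) : ℂ) := by
    funext i
    by_cases hi : i = j
    · subst hi
      refine (actMap_fibre_ne (d := (i, !b)) hcd).trans ?_
      rw [hscale]
      simp [slicePt]
    · rw [actMap_of_ne hi, hscale]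
      simp [slicePt, frame, hi]
  have hlog : ∀ v, logScale 1 (j, b) (j, !b) (slicePt (j, b) (t : ℂ)) v = 0 := fun v => by
    rw [logScale, hscale]; simp [hor]
  have hLhor : ∀ v, hor (j, !b) (L v) = hor (j, b) v := fun v => by
    rw [(hLv v).1, hscale, hlog]; simp
  have hLj : ∀ v, L v j = -((t : ℂ)⁻¹) ^ 2 * v j := fun v => by
    have := (hLv v).2.2 hcd
    rw [hscale, hlog, hy] at this
    simpa [slicePt] using this
  have hLa : ∀ a, a ≠ j → L (Pi.single a 1) = Pi.single a 1 := fun a ha => by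
    funext i
    by_cases hi : i = j
    · subst hi; rw [hLj]; simp [ha.symm]
    · have := congrFun (hLhor (Pi.single a 1)) i
      simpa [hor, hi] using this
  have hLjj : L (Pi.single j 1) = (-((t : ℂ)⁻¹) ^ 2) • Pi.single j 1 := by
    funext i
    by_cases hi : i = j
    · subst hi; rw [hLj]; simp
    · have := congrFun (hLhor (Pi.single j 1)) i
      simpa [hor, hi] using this
  have hinv : ∀ v w, herm (g.coeff (j, !b) (slicePt (j, !b) ((t⁻¹ : ℝ) : ℂ))) (L v) (L w) =
      herm (g.coeff (j, b) (slicePt (j, b) t)) v w := fun v w => by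
    have := hg 1 (j, b) (j, !b) (slicePt (j, b) t) hsrc v w
    change herm (g.coeff (j, !b) (actMap 1 (j, b) (j, !b) k (slicePt (j, b) (t : ℂ))))
      (fderiv ℂ (actMap 1 (j, b) (j, !b) k) _ v) (fderiv ℂ (actMap 1 (j, b) (j, !b) k) _ w) = _
      at this
    rwa [hL.fderiv, hy] at this
  constructor
  · intro a ha
    have := hinv (Pi.single a 1) (Pi.single a 1)
    rwa [hLa a ha, herm_single, herm_single] at this
  · have := hinv (Pi.single j 1) (Pi.single j 1)
    rw [hLjj, herm_single] at this
    have h2 : ∀ (G : Matrix (Fin n) (Fin n) ℂ) (r : ℂ), herm G (r • Pi.single j 1)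
        (r • Pi.single j 1) = r * conj r * G j j := fun G r => by
      rw [← herm_single G]
      simp only [herm, Pi.smul_apply, smul_eq_mul, map_mul, Finset.mul_sum]
      refine Finset.sum_congr rfl fun i _ => Finset.sum_congr rfl fun l _ => ?_
      ring
    rw [h2] at this
    rw [← this]
    simp only [map_neg, map_pow, map_inv₀, Complex.conj_ofReal]
    field_simp

theorem contDiff_coeff_slice (g : KahlerMetric n k) (c : ChartIdx n) (a : Fin n) :
    ContDiff ℝ ∞ fun t : ℝ => (g.coeff c (slicePt c t) a a).re := by
  have h1 : ContDiff ℝ ∞ fun t : ℝ => slicePt c (t : ℂ) := by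
    rw [contDiff_pi]
    intro i
    by_cases hi : i = c.1
    · subst hi
      simp only [slicePt, Pi.single_eq_same]
      exact Complex.ofRealCLM.contDiff
    · simpa [slicePt, hi] using contDiff_const
  exact Complex.reCLM.contDiff.comp ((g.smooth c a a).comp h1)

/-- The Kähler condition along a slice. -/
theorem hasDerivAt_coeff_slice {E : Bool → ℝ → ℝ} (hE : ∀ b, ContDiff ℝ ∞ (E b))
    {F : Bool → ℝ → ℝ} (hg : g.coeff = tensorCoeff k F E) (c : ChartIdx n) {i : Fin n}
    (hi : i ≠ c.1) (t : ℝ) :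
    HasDerivAt (fun t : ℝ => (g.coeff c (slicePt c t) i i).re)
      (-weight k c.2 * (2 * t * E c.2 (t ^ 2))) t := by
  have hcl := g.closed c (slicePt c t) i i c.1
  have hE' : HasDerivAt (E c.2) (deriv (E c.2) (rho k c (slicePt c t))) (rho k c (slicePt c t)) :=
    ((hE c.2).differentiable (by simp) _).hasDerivAt
  -- The fibre direction is annihilated by the Fubini–Study form, so this entry does not see `F`,
  -- which may be replaced by `0`. No differentiability of `F` is needed.
  have h1 : (fun y => g.coeff c y c.1 i) = fun y =>
      tensor k (fun _ _ => 0) E c y (Pi.single c.1 1) (Pi.single i 1) := by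
    funext y
    rw [hg, tensorCoeff, Matrix.of_apply, tensor, tensor]
    have : fubini c y (Pi.single c.1 1) (Pi.single i 1) = 0 := by
      rw [fubini, hor_single_self]; simp [inn]
    rw [this]; simp
  rw [h1, (Hirzebruch.hasWirt_tensor (F := fun _ _ => 0) (F' := 0) c (slicePt c t) (Pi.single i 1)
    (Pi.single c.1 1) (Pi.single i 1) (hasDerivAt_const _ _) hE').dz_eq, tensorDeriv_slicePt,
    rho_slicePt, hor_single_of_ne c hi, inn_single_single] at hcl
  simp only [Complex.ofReal_zero, zero_mul, Complex.conj_ofReal, Pi.single_eq_same,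
    Pi.single_eq_of_ne hi.symm, mul_zero, zero_add, mul_one, if_true, zero_sub,
    Complex.normSq_ofReal] at hcl
  have hd : DifferentiableAt ℝ (fun y => g.coeff c y i i) (slicePt c t) :=
    (g.smooth c i i).differentiable (by simp) _
  set D := fderiv ℝ (fun y => g.coeff c y i i) (slicePt c t) with hD
  -- The diagonal entry is real, so its derivative in the real direction of the slice is twice the
  -- real part of its `∂`-derivative.
  have hreal : ∀ v, (D v).im = 0 := fun v => by
    have h2 := Complex.imCLM.hasFDerivAt.comp (slicePt c t) hd.hasFDerivAt
    have h3 : (fun y => (g.coeff c y i i).im) = fun _ => (0 : ℝ) := by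
      funext y
      rw [g.coeff_self_eq_re c y i]; simp
    have h4 : HasFDerivAt (fun _ : Fin n → ℂ => (0 : ℝ)) (Complex.imCLM.comp D) (slicePt c t) := by
      rw [← h3]; exact h2
    have := h4.unique (hasFDerivAt_const _ _)
    exact congrArg (fun L : (Fin n → ℂ) →L[ℝ] ℝ => L v) this
  have hpath : HasDerivAt (fun t : ℝ => slicePt c (t : ℂ)) (Pi.single c.1 1) t := by
    rw [hasDerivAt_pi]
    intro l
    by_cases hl : l = c.1
    · subst hl
      simp only [slicePt, Pi.single_eq_same]
      exact Complex.ofRealCLM.hasDerivAt (x := t)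
    · simpa [slicePt, hl] using hasDerivAt_const t (0 : ℂ)
  have h5 := Complex.reCLM.hasFDerivAt.comp_hasDerivAt t (hd.hasFDerivAt.comp_hasDerivAt t hpath)
  refine h5.congr_deriv ?_
  change (D (Pi.single c.1 1)).re = _
  rw [dz, ← hD] at hcl
  have h6 := congrArg Complex.re hcl
  have h7 : (weight k c.2 : ℂ) = ((weight k c.2 : ℝ) : ℂ) := by push_cast; rfl
  rw [h7] at h6
  simp only [Complex.div_ofNat_re, Complex.sub_re, Complex.mul_re, Complex.I_re, Complex.I_im,
    zero_mul, hreal, mul_zero, Complex.neg_re, Complex.ofReal_re,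
    Complex.ofReal_im, sub_zero] at h6
  rw [sq]
  linarith

end KahlerMetric

theorem contDiff_of_hasDerivAt {f f' : ℝ → ℝ} (h : ∀ x, HasDerivAt f (f' x) x)
    (hf' : ContDiff ℝ ∞ f') : ContDiff ℝ ∞ f :=
  contDiff_infty_iff_deriv.2 ⟨fun x => (h x).differentiableAt, by
    rwa [show deriv f = f' from funext fun x => (h x).deriv]⟩

/-! ### Extracting the radial functions from an invariant metric. -/

namespace KahlerMetric

variable {k : ℕ} {g : KahlerMetric n k}

/-- Every invariant Kähler metric is given by functions of the radius, and these extend smoothly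
to the real line. -/
theorem exists_radialPair (hn : 2 ≤ n) (hk : 1 ≤ k) (hg : g.IsUnitaryInvariant) :
    ∃ P : RadialPair k, g = P.metric n ∧ (∀ b, ContDiff ℝ ∞ (P.E b)) ∧ (∀ b r, 0 < P.E b r) ∧
      ∀ b r, HasDerivAt (P.F b) (-weight k b * P.E b r) r := by
  let j₀ : Fin n := ⟨0, by omega⟩
  let i₀ : Fin n := ⟨1, by omega⟩
  have hij : i₀ ≠ j₀ := by simp [i₀, j₀]
  let fE : Bool → ℝ → ℝ := fun b t => (g.coeff (j₀, b) (slicePt (j₀, b) t) j₀ j₀).re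
  let fF : Bool → ℝ → ℝ := fun b t => (g.coeff (j₀, b) (slicePt (j₀, b) t) i₀ i₀).re
  have hfE : ∀ b, ContDiff ℝ ∞ (fE b) := fun b => g.contDiff_coeff_slice (j₀, b) j₀
  have hfEpos : ∀ b t, 0 < fE b t := fun b t => g.coeff_self_pos _ _ _
  have hfEeven : ∀ b, Function.Even (fE b) := fun b t => by
    simp only [fE, Complex.ofReal_neg]
    rw [coeff_slicePt_neg hk hg]
  -- Whitney's theorem is applied to the logarithm so that the extension `E` to the whole line is
  -- again positive.
  have hW : ∀ b, ∃ h : ℝ → ℝ, ContDiff ℝ ∞ h ∧ ∀ t, Real.log (fE b t) = h (t ^ 2) := fun b =>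
    exists_contDiff_comp_sq ((hfE b).log fun t => (hfEpos b t).ne') fun t => by
      rw [hfEeven b t]
  choose h hh hhE using hW
  let E : Bool → ℝ → ℝ := fun b r => Real.exp (h b r)
  have hE : ∀ b, ContDiff ℝ ∞ (E b) := fun b => (hh b).exp
  have hEpos : ∀ b r, 0 < E b r := fun b r => Real.exp_pos _
  have hEt : ∀ b t, E b (t ^ 2) = fE b t := fun b t => by
    simp only [E]; rw [← hhE, Real.exp_log (hfEpos b t)]
  have hinvF : ∀ b t, 0 < t → fF (!b) t⁻¹ = fF b t := fun b t ht =>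
    congrArg Complex.re ((coeff_slicePt_inv hg j₀ b ht).1 i₀ hij)
  have hinvE : ∀ b t, 0 < t → fE (!b) t⁻¹ = fE b t * t ^ 4 := fun b t ht => by
    have := congrArg Complex.re (coeff_slicePt_inv hg j₀ b ht).2
    rw [← Complex.ofReal_pow, Complex.re_mul_ofReal] at this
    exact this
  have hE_not : ∀ b r, 0 < r → E (!b) r⁻¹ = E b r * r ^ 2 := fun b r hr => by
    have hs := Real.sq_sqrt hr.le
    have h1 := hinvE b _ (Real.sqrt_pos.2 hr)
    rw [← hEt, ← hEt, inv_pow, hs, show √r ^ 4 = (√r ^ 2) ^ 2 by ring, hs] at h1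
    exact h1
  -- Smoothness of `F` is not required here. The first use takes `F b r = fF b √r`, whose regularity
  -- at `0` is not yet known.
  have hslice : ∀ F : Bool → ℝ → ℝ, (∀ b t, 0 ≤ t → F b (t ^ 2) = fF b t) →
      (∀ b r, 0 < r → F (!b) r⁻¹ = F b r) → g.coeff = tensorCoeff k F E := by
    intro F hF hF_not
    refine eq_of_eq_on_slices hk hg (fun A => preserves_tensorCoeff hF_not hE_not A) ?_
    rintro ⟨j, b⟩ t ht
    ext a a'
    rw [tensorCoeff_slicePt]
    by_cases haa : a = a'
    · subst haa
      rw [if_pos rfl, Complex.normSq_ofReal, ← sq, hEt, hF b t ht]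
      by_cases ha : a = j
      · subst ha
        rw [if_pos rfl, coeff_slicePt_fibre hg a j₀, coeff_self_eq_re]
      · rw [if_neg ha, coeff_slicePt_base hg ha hij, coeff_self_eq_re]
    · rw [if_neg haa, coeff_slicePt_of_ne hg _ _ haa]
  have hsqrt_not : ∀ b r, 0 < r → fF (!b) (√r⁻¹) = fF b (√r) := fun b r hr => by
    rw [Real.sqrt_inv]; exact hinvF b _ (Real.sqrt_pos.2 hr)
  have hfF : ∀ b t, HasDerivAt (fF b) (-weight k b * (2 * t * E b (t ^ 2))) t := fun b t =>
    hasDerivAt_coeff_slice hE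
      (hslice (fun b r => fF b (√r)) (fun b t ht => by rw [Real.sqrt_sq ht]) hsqrt_not)
      (j₀, b) hij t
  -- Integrating the Kähler condition gives a version of the base coefficient that is smooth on the
  -- whole line; it agrees with `fF` because the derivatives and the values at `0` agree.
  let F : Bool → ℝ → ℝ := fun b r => fF b 0 + -weight k b * ∫ t in (0 : ℝ)..r, E b t
  have hFd : ∀ b r, HasDerivAt (F b) (-weight k b * E b r) r := fun b r =>
    ((intervalIntegral.integral_hasDerivAt_right ((hE b).continuous.intervalIntegrable _ _)
      (hE b).continuous.aestronglyMeasurable.stronglyMeasurableAtFilter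
      (hE b).continuous.continuousAt).const_mul _).const_add _
  have hFt : ∀ b t, F b (t ^ 2) = fF b t := by
    intro b t
    have hd : ∀ s, HasDerivAt (fun s => F b (s ^ 2) - fF b s) 0 s := fun s => by
      have h1 : HasDerivAt (fun s : ℝ => s ^ 2) (2 * s) s := by simpa using hasDerivAt_pow 2 s
      refine (((hFd b (s ^ 2)).comp s h1).sub (hfF b s)).congr_deriv ?_
      ring
    have := is_const_of_deriv_eq_zero (fun s => (hd s).differentiableAt) (fun s => (hd s).deriv) t 0
    simp only [F] at this ⊢
    simp at this ⊢
    linarith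
  have hF_sqrt : ∀ b r, 0 ≤ r → F b r = fF b (√r) := fun b r hr => by
    rw [← hFt, Real.sq_sqrt hr]
  have hF_not : ∀ b r, 0 < r → F (!b) r⁻¹ = F b r := fun b r hr => by
    rw [hF_sqrt _ _ (inv_pos.2 hr).le, hF_sqrt _ _ hr.le, hsqrt_not b r hr]
  refine ⟨⟨F, E, fun b r _ => ?_, fun b r _ => (hE b).contDiffAt, hF_not, hE_not, fun b r hr => ?_,
    fun b r _ => hEpos b r, fun b r _ => hFd b r⟩, ?_, hE, hEpos, hFd⟩
  · exact (contDiff_of_hasDerivAt (hFd b) (contDiff_const.mul (hE b))).contDiffAt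
  · rw [hF_sqrt b r hr]
    exact g.coeff_self_pos _ _ _
  · exact KahlerMetric.ext (hslice F (fun b t _ => hFt b t) hF_not)

end KahlerMetric

/-! ### Metrics from profiles -/

/-- A parametrisation of the invariant Kähler metrics: `F` runs over `[a, a + l]`, and the radius is
`(1 - u) / u * exp (q + ∫ e)` where `F = a + l u`. -/
@[ext] structure ProfileData where
  /-- The minimum of the base coefficient. -/
  a : ℝ
  /-- The length of the range of the base coefficient. -/
  l : ℝ
  /-- The constant of integration. -/
  q : ℝ
  /-- The logarithmic derivative of the radius, without its singular part. -/
  e : ℝ → ℝ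
  a_pos : 0 < a
  l_pos : 0 < l
  contDiff_e : ContDiff ℝ ∞ e
  den_pos : ∀ u, 0 < den e u

namespace ProfileData

variable (D : ProfileData)

/-- The constant of integration in the two kinds of charts. -/
def const (b : Bool) : ℝ := cond b D.q (reflectConst D.q D.e)

/-- The function `e` in the two kinds of charts. -/
def fn (b : Bool) : ℝ → ℝ := cond b D.e (reflectFun D.e)

theorem contDiff_fn (b : Bool) : ContDiff ℝ ∞ (D.fn b) := by
  cases b
  · exact contDiff_reflectFun D.contDiff_e
  · exact D.contDiff_e

theorem den_fn_pos (b : Bool) (u : ℝ) : 0 < den (D.fn b) u := by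
  cases b
  · exact (den_reflectFun D.e u).symm ▸ D.den_pos _
  · exact D.den_pos u

/-- The normalised base coefficient, as a function of the radius. -/
def height (b : Bool) (r : ℝ) : ℝ :=
  cond b (profile (D.const b) (D.fn b) r) (1 - profile (D.const b) (D.fn b) r)

/-- The base coefficient. -/
def base (b : Bool) (r : ℝ) : ℝ := D.a + D.l * D.height b r

/-- The fibre coefficient. -/
def fibre (k : ℕ) (b : Bool) (r : ℝ) : ℝ := D.l / k * slope (D.const b) (D.fn b) r

theorem eventually_hasDerivAt_height (b : Bool) {r : ℝ} (hr : 0 ≤ r) :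
    ∀ᶠ t in 𝓝 r, HasDerivAt (D.height b) (-(cond b 1 (-1) * slope (D.const b) (D.fn b) t)) t := by
  filter_upwards [hasDerivAt_profile (q := D.const b) (D.contDiff_fn b) (D.den_fn_pos b) hr]
    with t ht
  cases b
  · exact (ht.const_sub 1).congr_deriv (by simp)
  · exact ht.congr_deriv (by simp)

theorem eventually_hasDerivAt_base {k : ℕ} (hk : 1 ≤ k) (b : Bool) {r : ℝ} (hr : 0 ≤ r) :
    ∀ᶠ t in 𝓝 r, HasDerivAt (D.base b) (-weight k b * D.fibre k b t) t := by
  have hk' : (k : ℝ) ≠ 0 := by positivity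
  filter_upwards [D.eventually_hasDerivAt_height b hr] with t ht
  refine ((ht.const_mul D.l).const_add D.a).congr_deriv ?_
  cases b <;> simp [weight, fibre] <;> field_simp

theorem height_nonneg (b : Bool) {r : ℝ} (hr : 0 ≤ r) : 0 ≤ D.height b r := by
  cases b
  · exact sub_nonneg.2 (profile_le_one (D.contDiff_fn _) (D.den_fn_pos _) hr)
  · exact (profile_pos (D.contDiff_fn _) hr).le

theorem height_le_one (b : Bool) {r : ℝ} (hr : 0 ≤ r) : D.height b r ≤ 1 := by
  cases b
  · exact sub_le_self _ (profile_pos (D.contDiff_fn _) hr).le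
  · exact profile_le_one (D.contDiff_fn _) (D.den_fn_pos _) hr

theorem height_not (b : Bool) {r : ℝ} (hr : 0 < r) : D.height (!b) r⁻¹ = D.height b r := by
  have key : ∀ {r : ℝ}, 0 < r → D.height false r⁻¹ = D.height true r := fun hr => by
    have := profile_reflect (q := D.q) D.contDiff_e D.den_pos hr
    simp only [height, const, fn, cond_true, cond_false]
    linarith
  cases b
  · have := key (inv_pos.2 hr)
    rw [inv_inv] at this
    exact this.symm
  · exact key hr

/-- Differentiating the symmetry of `base` under `r ↦ 1 / r` gives the factor `r ^ 2`; the non-zero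
weight is cancelled. -/
theorem fibre_not {k : ℕ} (hk : 1 ≤ k) (b : Bool) {r : ℝ} (hr : 0 < r) :
    D.fibre k (!b) r⁻¹ = D.fibre k b r * r ^ 2 := by
  have h1 := (D.eventually_hasDerivAt_base hk (!b) (inv_pos.2 hr).le).self_of_nhds.comp r
    (hasDerivAt_inv hr.ne')
  have h2 := (D.eventually_hasDerivAt_base hk b hr.le).self_of_nhds
  have h3 : (D.base (!b)) ∘ (fun y => y⁻¹) =ᶠ[𝓝 r] D.base b := by
    filter_upwards [lt_mem_nhds hr] with t ht
    simp only [Function.comp, base, D.height_not b ht]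
  have h4 := h1.unique (h2.congr_of_eventuallyEq h3)
  have hw : (weight k b : ℝ) ≠ 0 := by exact_mod_cast weight_ne_zero hk b
  rw [weight_not] at h4
  push_cast at h4
  field_simp at h4
  rw [one_div] at h4
  linarith

theorem contDiffAt_height (b : Bool) {r : ℝ} (hr : 0 ≤ r) : ContDiffAt ℝ ∞ (D.height b) r := by
  have := contDiffAt_profile_right (q := D.const b) (D.contDiff_fn b) (D.den_fn_pos b) hr
  cases b
  · exact contDiffAt_const.sub this
  · exact this

/-- The functions of the radius of a metric given by profiles. -/
def radialPair {k : ℕ} (hk : 1 ≤ k) : RadialPair k where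
  F := D.base
  E := D.fibre k
  contDiffAt_F b _ hr := contDiffAt_const.add (contDiffAt_const.mul (D.contDiffAt_height b hr))
  contDiffAt_E b _ hr :=
    contDiffAt_const.mul (contDiffAt_slope_right (D.contDiff_fn b) (D.den_fn_pos b) hr)
  F_not b _ hr := by rw [base, base, D.height_not b hr]
  E_not b _ hr := D.fibre_not hk b hr
  F_pos b _ hr := by
    have := D.height_nonneg b hr
    have := D.a_pos
    have := D.l_pos
    unfold base
    positivity
  E_pos b _ hr := by
    have := slope_pos (q := D.const b) (D.contDiff_fn b) (D.den_fn_pos b) hr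
    have := D.l_pos
    unfold fibre
    positivity
  hasDerivAt_F b _ hr := (D.eventually_hasDerivAt_base hk b hr).self_of_nhds

/-- The metric given by profiles. -/
def metric {k : ℕ} (hk : 1 ≤ k) (n : ℕ) : KahlerMetric n k := (D.radialPair hk).metric n

end ProfileData

theorem continuous_profileData_metric {k : ℕ} (hk : 1 ≤ k) {D : ℝ → ProfileData}
    (ha : ContDiff ℝ ∞ fun s => (D s).a) (hl : ContDiff ℝ ∞ fun s => (D s).l)
    (hq : ContDiff ℝ ∞ fun s => (D s).q) (he : ContDiff ℝ ∞ fun p : ℝ × ℝ => (D p.1).e p.2) :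
    Continuous fun s => (D s).metric hk n := by
  have hcq : ∀ b, ContDiff ℝ ∞ fun s => (D s).const b := fun b => by
    cases b
    · exact ((contDiff_primitive (e := fun s => (D s).e) hq he).comp
        (contDiff_id.prodMk (contDiff_const (c := (1 : ℝ))))).neg
    · exact hq
  have hfn : ∀ b, ContDiff ℝ ∞ (Function.uncurry fun s => (D s).fn b) := fun b => by
    cases b
    · exact he.comp (contDiff_fst.prodMk (contDiff_const.sub contDiff_snd))
    · exact he
  have hprof : ∀ b s r, 0 ≤ r → ContDiffAt ℝ ∞ (fun p : ℝ × ℝ => (D p.1).height b p.2) (s, r) :=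
    fun b s r hr => by
      have := contDiffAt_profile (hcq b) (hfn b) (fun s => (D s).den_fn_pos b) s hr
      cases b
      · exact contDiffAt_const.sub this
      · exact this
  refine continuous_metric (fun b s r hr => ?_) fun b s r hr => ?_
  · exact (ha.comp contDiff_fst).contDiffAt.add
      ((hl.comp contDiff_fst).contDiffAt.mul (hprof b s r hr))
  · exact ((hl.comp contDiff_fst).div_const _).contDiffAt.mul
      (contDiffAt_slope (hcq b) (hfn b) (fun s => (D s).den_fn_pos b) s hr)

/-! ### Recovering the profile data -/

/-- Multiplying `e₀` by a cutoff `χ` preserves positivity, because `den (χ e₀) = (1 - χ) + χ * den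
e₀` is a convex combination of `1` and `den e₀`. -/
theorem exists_extension_den_pos {Ω : Set ℝ} (hΩ : IsOpen Ω) (h01 : Set.Icc 0 1 ⊆ Ω) {e₀ : ℝ → ℝ}
    (he₀ : ContDiffOn ℝ ∞ e₀ Ω) (hD : ∀ u ∈ Set.Icc (0 : ℝ) 1, 0 < den e₀ u) :
    ∃ e : ℝ → ℝ, ContDiff ℝ ∞ e ∧ (∀ u, 0 < den e u) ∧
      ∀ u ∈ Set.Icc (0 : ℝ) 1, e =ᶠ[𝓝 u] e₀ := by
  have hden : ContinuousOn (den e₀) Ω := by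
    unfold den
    exact continuousOn_const.sub
      ((continuousOn_id.mul (continuousOn_const.sub continuousOn_id)).mul he₀.continuousOn)
  have hopen : IsOpen (Ω ∩ den e₀ ⁻¹' Set.Ioi 0) := hden.isOpen_inter_preimage hΩ isOpen_Ioi
  obtain ⟨δ, hδ, hsub⟩ := isCompact_Icc.exists_cthickening_subset_open hopen
    (fun u hu => ⟨h01 hu, hD u hu⟩ : Set.Icc (0 : ℝ) 1 ⊆ Ω ∩ den e₀ ⁻¹' Set.Ioi 0)
  let χ : ContDiffBump (1 / 2 : ℝ) := ⟨1 / 2 + δ / 2, 1 / 2 + δ, by linarith, by linarith⟩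
  have hball : Metric.closedBall (1 / 2 : ℝ) (1 / 2) = Set.Icc 0 1 := by
    rw [Real.closedBall_eq_Icc]; norm_num
  have hts : tsupport χ ⊆ Ω ∩ den e₀ ⁻¹' Set.Ioi 0 := by
    refine subset_trans ?_ hsub
    rw [χ.tsupport_eq, ← hball, cthickening_closedBall hδ.le (by norm_num)]
    exact Metric.closedBall_subset_closedBall (by simp [χ, add_comm])
  refine ⟨fun u => χ u * e₀ u, contDiff_iff_contDiffAt.2 fun u => ?_, fun u => ?_, fun u hu => ?_⟩
  · by_cases hu : u ∈ tsupport χ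
    · exact χ.contDiff.contDiffAt.mul (he₀.contDiffAt (hΩ.mem_nhds (hts hu).1))
    · refine (contDiffAt_const (c := (0 : ℝ))).congr_of_eventuallyEq ?_
      filter_upwards [(isClosed_tsupport χ).isOpen_compl.mem_nhds hu] with v hv
      rw [image_eq_zero_of_notMem_tsupport hv, zero_mul]
  · by_cases hu : u ∈ tsupport χ
    · have h1 : 0 < den e₀ u := (hts hu).2
      have h2 := χ.nonneg (x := u)
      have h3 := χ.le_one (x := u)
      simp only [den] at h1 ⊢
      rcases h2.eq_or_lt with h | h
      · rw [← h]; simp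
      · nlinarith [mul_pos h h1]
    · simp only [den]
      rw [image_eq_zero_of_notMem_tsupport hu]
      simp
  · rw [← hball] at hu
    filter_upwards [Metric.isOpen_ball.mem_nhds (Metric.closedBall_subset_ball
      (show (1 / 2 : ℝ) < χ.rIn from lt_add_of_pos_right _ (half_pos hδ)) hu)] with v hv
    rw [χ.one_of_mem_closedBall (Metric.ball_subset_closedBall hv), one_mul]

theorem exists_hadamard_pos {f d : ℝ → ℝ} (hf : ∀ r, HasDerivAt f (d r) r) (hd : ContDiff ℝ ∞ d)
    (hpos : ∀ r, 0 < d r) : ∃ ν : ℝ → ℝ, ContDiff ℝ ∞ ν ∧ (∀ r, 0 < ν r) ∧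
      ∀ r, f r - f 0 = r * ν r := by
  refine ⟨fun r => ∫ t in (0 : ℝ)..1, d (t * r), ?_, fun r => ?_,
    sub_eq_mul_intervalIntegral_deriv hf hd.continuous⟩
  · exact contDiff_intervalIntegral (K := fun r t => d (t * r))
      (hd.comp (contDiff_snd.mul contDiff_fst))
  · have : Continuous fun t => d (t * r) := hd.continuous.comp (by fun_prop)
    exact intervalIntegral.intervalIntegral_pos_of_pos (this.intervalIntegrable _ _)
      (fun t => hpos _) one_pos

theorem contDiffAt_invFun {f d : ℝ → ℝ} (hf : ∀ r, HasDerivAt f (d r) r) (hd : ContDiff ℝ ∞ d)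
    (h0 : ∀ r, d r ≠ 0) (hinj : Function.Injective f) (r : ℝ) :
    ContDiffAt ℝ ∞ (Function.invFun f) (f r) := by
  have hfs := contDiff_of_hasDerivAt hf hd
  have := contDiffAt_parametric_inverse (Ψ := fun p => f p.2) (V := fun _ => Function.invFun f)
    isOpen_univ (fun p _ => Function.leftInverse_invFun hinj p.2) (p := (0, r)) (Set.mem_univ _)
    (hfs.comp contDiff_snd).contDiffAt (hf r) (h0 r)
  exact this.comp (f r) (contDiffAt_const.prodMk contDiffAt_id)

theorem isOpen_range_of_hasDerivAt {f d : ℝ → ℝ} (hf : ∀ r, HasDerivAt f (d r) r)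
    (hd : ContDiff ℝ ∞ d) (h0 : ∀ r, d r ≠ 0) : IsOpen (Set.range f) := by
  have hfs := contDiff_of_hasDerivAt hf hd
  refine (isOpenMap_of_hasStrictDerivAt (f' := d) (fun r => ?_) h0).isOpen_range
  have := hfs.contDiffAt.hasStrictDerivAt (x := r) (by simp)
  rwa [(hf r).deriv] at this

/-- The functions `u₀` and `u₁` describe the same profile near `r = 0` and near `r = ∞`. Each is
inverted at its own end, and the logarithm of `r u / (1 - u)` turns out to be smooth in `u` across
both ends; its derivative is `e`. Monotonicity of `u₀` and `u₁` on the whole line lets the inverses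
extend past `u = 1` and `u = 0`. -/
theorem exists_profile_eq {u₀ u₁ d₀ d₁ : ℝ → ℝ} (h₀ : ∀ r, HasDerivAt u₀ (-d₀ r) r)
    (h₁ : ∀ r, HasDerivAt u₁ (d₁ r) r) (hd₀ : ContDiff ℝ ∞ d₀) (hd₁ : ContDiff ℝ ∞ d₁)
    (hpos₀ : ∀ r, 0 < d₀ r) (hpos₁ : ∀ r, 0 < d₁ r) (h00 : u₀ 0 = 1) (h10 : u₁ 0 = 0)
    (hinv : ∀ r, 0 < r → u₁ r⁻¹ = u₀ r) :
    ∃ (q : ℝ) (e : ℝ → ℝ), ContDiff ℝ ∞ e ∧ (∀ u, 0 < den e u) ∧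
      ∀ r, 0 ≤ r → profile q e r = u₀ r := by
  have hanti : StrictAnti u₀ := strictAnti_of_deriv_neg fun r => by
    rw [(h₀ r).deriv]; exact neg_neg_of_pos (hpos₀ r)
  have hmono : StrictMono u₁ := strictMono_of_deriv_pos fun r => by rw [(h₁ r).deriv]; exact hpos₁ r
  have hc₀ : Continuous u₀ := continuous_iff_continuousAt.2 fun r => (h₀ r).continuousAt
  have hc₁ : Continuous u₁ := continuous_iff_continuousAt.2 fun r => (h₁ r).continuousAt
  have hu₀pos : ∀ r, 0 ≤ r → 0 < u₀ r := fun r hr => by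
    rcases hr.eq_or_lt with rfl | hr
    · rw [h00]; exact one_pos
    · rw [← hinv r hr, ← h10]; exact hmono (inv_pos.2 hr)
  have hu₀le : ∀ r, 0 ≤ r → u₀ r ≤ 1 := fun r hr => by rw [← h00]; exact hanti.antitone hr
  have hsurj : ∀ u, 0 < u → u < 1 → ∃ r, 0 < r ∧ u₀ r = u := by
    intro u hu hu1
    have h2 : ∀ᶠ t in 𝓝[>] (0 : ℝ), u₁ t < u :=
      (hc₁.continuousAt.eventually_lt continuousAt_const (by rwa [h10])).filter_mono
        nhdsWithin_le_nhds
    obtain ⟨t, ht, ht0⟩ := (h2.and self_mem_nhdsWithin).exists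
    have ht0 : 0 < t := ht0
    have h3 : u₀ t⁻¹ < u := by rwa [← hinv _ (inv_pos.2 ht0), inv_inv]
    obtain ⟨r, hr, hru⟩ := intermediate_value_Icc' (inv_pos.2 ht0).le hc₀.continuousOn
      (⟨h3.le, by rw [h00]; exact hu1.le⟩ : u ∈ Set.Icc (u₀ t⁻¹) (u₀ 0))
    refine ⟨r, lt_of_le_of_ne hr.1 ?_, hru⟩
    rintro rfl
    linarith
  obtain ⟨ν₀, hν₀, hν₀pos, hν₀eq⟩ := exists_hadamard_pos (f := fun r => -u₀ r) (d := d₀)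
    (fun r => ((h₀ r).neg).congr_deriv (neg_neg _)) hd₀ hpos₀
  obtain ⟨ν₁, hν₁, hν₁pos, hν₁eq⟩ := exists_hadamard_pos h₁ hd₁ hpos₁
  simp only [h00, h10, sub_zero] at hν₀eq hν₁eq
  -- The function `ψ` sought satisfies `r = (1 - u) / u * exp (ψ u)`. At one end `1 - u = r ν₀(r)`,
  -- so `exp ψ = u / ν₀`; at the other `u = s ν₁(s)` with `s = 1 / r`, so `exp ψ = ν₁ / (1 - u)`.
  let ψ₀ : ℝ → ℝ := fun u => Real.log u - Real.log (ν₀ (Function.invFun u₀ u))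
  let ψ₁ : ℝ → ℝ := fun u => Real.log (ν₁ (Function.invFun u₁ u)) - Real.log (1 - u)
  have hψ₀u : ∀ r, ψ₀ (u₀ r) = Real.log (u₀ r) - Real.log (ν₀ r) := fun r => by
    simp only [ψ₀]; rw [Function.leftInverse_invFun hanti.injective r]
  have hψ₁u : ∀ r, ψ₁ (u₁ r) = Real.log (ν₁ r) - Real.log (1 - u₁ r) := fun r => by
    simp only [ψ₁]; rw [Function.leftInverse_invFun hmono.injective r]
  have hagree : ∀ u, 0 < u → u < 1 → ψ₀ u = ψ₁ u := by
    intro u hu hu1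
    obtain ⟨r, hr, rfl⟩ := hsurj u hu hu1
    rw [hψ₀u, ← hinv r hr, hψ₁u, hinv r hr, show 1 - u₀ r = r * ν₀ r by linarith [hν₀eq r]]
    have h3 : u₀ r = r⁻¹ * ν₁ r⁻¹ := by rw [← hν₁eq, hinv r hr]
    rw [h3, Real.log_mul (inv_ne_zero hr.ne') (hν₁pos _).ne', Real.log_inv,
      Real.log_mul hr.ne' (hν₀pos _).ne']
    ring
  let Ω₀ : Set ℝ := Set.range u₀ ∩ Set.Ioi 0
  let Ω₁ : Set ℝ := Set.range u₁ ∩ Set.Iio 1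
  have hΩ₀ : IsOpen Ω₀ :=
    (isOpen_range_of_hasDerivAt h₀ hd₀.neg fun r => (neg_neg_of_pos (hpos₀ r)).ne).inter isOpen_Ioi
  have hΩ₁ : IsOpen Ω₁ :=
    (isOpen_range_of_hasDerivAt h₁ hd₁ fun r => (hpos₁ r).ne').inter isOpen_Iio
  have hψ₀s : ∀ u ∈ Ω₀, ContDiffAt ℝ ∞ ψ₀ u := by
    rintro _ ⟨⟨r, rfl⟩, hr⟩
    refine (contDiffAt_id.log (ne_of_gt hr)).sub (ContDiffAt.log ?_ (hν₀pos _).ne')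
    exact hν₀.contDiffAt.comp _ (contDiffAt_invFun h₀ hd₀.neg
      (fun r => (neg_neg_of_pos (hpos₀ r)).ne) hanti.injective r)
  have hψ₁s : ∀ u ∈ Ω₁, ContDiffAt ℝ ∞ ψ₁ u := by
    rintro _ ⟨⟨r, rfl⟩, hr⟩
    refine ContDiffAt.sub (ContDiffAt.log ?_ (hν₁pos _).ne')
      ((contDiffAt_const.sub contDiffAt_id).log (sub_pos.2 hr).ne')
    exact hν₁.contDiffAt.comp _ (contDiffAt_invFun h₁ hd₁
      (fun r => (hpos₁ r).ne') hmono.injective r)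
  let ψ : ℝ → ℝ := fun u => if u ≤ 0 then ψ₁ u else ψ₀ u
  have hψpos : ∀ u, 0 < u → ψ =ᶠ[𝓝 u] ψ₀ := fun u hu => by
    filter_upwards [lt_mem_nhds hu] with v hv
    simp only [ψ]; rw [if_neg (not_le.2 hv)]
  have hψs : ∀ u ∈ Ω₀ ∪ Ω₁, ContDiffAt ℝ ∞ ψ u := by
    intro u hu
    rcases lt_or_ge 0 u with h | h
    · refine (hψ₀s u ?_).congr_of_eventuallyEq (hψpos u h)
      rcases hu with hu | hu
      · exact hu
      · obtain ⟨r, -, hr⟩ := hsurj u h hu.2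
        exact ⟨⟨r, hr⟩, h⟩
    · have hu1 : u ∈ Ω₁ := hu.resolve_left fun h' => not_lt.2 h h'.2
      refine (hψ₁s u hu1).congr_of_eventuallyEq ?_
      filter_upwards [hΩ₁.mem_nhds hu1] with v hv
      simp only [ψ]
      split_ifs with hv0
      · rfl
      · exact hagree v (not_le.1 hv0) hv.2
  have h01 : Set.Icc (0 : ℝ) 1 ⊆ Ω₀ ∪ Ω₁ := by
    intro u hu
    rcases hu.1.eq_or_lt with h | h
    · exact Or.inr ⟨⟨0, h10.trans h⟩, by rw [← h, Set.mem_Iio]; exact one_pos⟩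
    · rcases hu.2.eq_or_lt with h1 | h1
      · exact Or.inl ⟨⟨0, h00.trans h1.symm⟩, h⟩
      · obtain ⟨r, -, hr⟩ := hsurj u h h1
        exact Or.inl ⟨⟨r, hr⟩, h⟩
  have hΩ : IsOpen (Ω₀ ∪ Ω₁) := hΩ₀.union hΩ₁
  have hψd : ∀ u ∈ Ω₀ ∪ Ω₁, HasDerivAt ψ (deriv ψ u) u := fun u hu =>
    ((hψs u hu).differentiableAt (by simp)).hasDerivAt
  have hds : ContDiffOn ℝ ∞ (deriv ψ) (Ω₀ ∪ Ω₁) :=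
    ContDiffOn.deriv_of_isOpen (fun u hu => (hψs u hu).contDiffWithinAt) hΩ (by simp)
  have hrad : ∀ r, 0 ≤ r → (1 - u₀ r) / u₀ r * Real.exp (ψ (u₀ r)) = r := fun r hr => by
    have hu := hu₀pos r hr
    rw [(hψpos _ hu).self_of_nhds, hψ₀u, Real.exp_sub, Real.exp_log hu, Real.exp_log (hν₀pos r),
      show 1 - u₀ r = r * ν₀ r by linarith [hν₀eq r]]
    have := hν₀pos r
    field_simp
  -- At `u = 0` and `u = 1` the value is `1`. In between, differentiating `r = (1 - u) / u * exp (ψ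
  -- u)` along `u = u₀ r` writes `1` as `den` times a positive number.
  have hden : ∀ u ∈ Set.Icc (0 : ℝ) 1, 0 < den (deriv ψ) u := by
    intro u hu
    rcases hu.1.eq_or_lt with h | h
    · rw [← h]; simp [den]
    rcases hu.2.eq_or_lt with h1 | h1
    · rw [h1]; simp [den]
    obtain ⟨r, hr, hru⟩ := hsurj u h h1
    have hu0 : u₀ r ≠ 0 := by rw [hru]; exact h.ne'
    have hd : HasDerivAt (fun u : ℝ => (1 - u) / u * Real.exp (ψ u))
        (-(den (deriv ψ) (u₀ r) * Real.exp (ψ (u₀ r)) / u₀ r ^ 2)) (u₀ r) := by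
      have h := (((hasDerivAt_id (u₀ r)).const_sub 1).div (hasDerivAt_id (u₀ r)) hu0).mul
        (hψd (u₀ r) (by rw [hru]; exact h01 hu)).exp
      refine h.congr_deriv ?_
      simp only [id, den, Pi.div_apply]
      field_simp
      ring
    have h5 := (hd.comp r (h₀ r)).congr_of_eventuallyEq (f₁ := fun t => t) (by
      filter_upwards [lt_mem_nhds hr] with t ht using (hrad t ht.le).symm)
    have h6 := h5.unique (hasDerivAt_id r)
    rw [hru] at h6
    have h7 := Real.exp_pos (ψ u)
    have h8 : den (deriv ψ) u * (Real.exp (ψ u) / u ^ 2 * d₀ r) = 1 := by rw [← h6]; ring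
    have h9 : 0 < Real.exp (ψ u) / u ^ 2 * d₀ r := by have := hpos₀ r; positivity
    exact pos_of_mul_pos_left (by rw [h8]; exact one_pos) h9.le
  -- The extension changes `e` only away from `[0, 1]`, so the radius function there is unaffected.
  obtain ⟨e, he, heD, heq⟩ := exists_extension_den_pos hΩ h01 hds hden
  have hprim : ∀ u ∈ Set.Icc (0 : ℝ) 1, primitive (ψ 0) e u = ψ u := by
    intro u hu
    have := intervalIntegral.integral_eq_sub_of_hasDerivAt (f := ψ) (f' := e) (a := 0) (b := u)
      (fun v hv => by
        rw [Set.uIcc_of_le hu.1] at hv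
        have hv' : v ∈ Set.Icc (0 : ℝ) 1 := ⟨hv.1, hv.2.trans hu.2⟩
        rw [(heq v hv').self_of_nhds]
        exact hψd v (h01 hv')) (he.continuous.intervalIntegrable _ _)
    rw [primitive, this]; ring
  refine ⟨ψ 0, e, he, heD, fun r hr => ?_⟩
  have h9 : radius (ψ 0) e (u₀ r) = r := by
    rw [radius, hprim _ ⟨(hu₀pos r hr).le, hu₀le r hr⟩, hrad r hr]
  conv_lhs => rw [← h9]
  exact profile_radius he heD (hu₀pos r hr)

/-- The Kähler condition recovers `E` from `F'`, the weight being non-zero. At `r = 0` a one-sided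
derivative suffices. -/
theorem RadialPair.metric_congr {k : ℕ} (hk : 1 ≤ k) {P Q : RadialPair k}
    (h : ∀ b r, 0 ≤ r → P.F b r = Q.F b r) : P.metric n = Q.metric n := by
  have hE : ∀ b r, 0 ≤ r → P.E b r = Q.E b r := fun b r hr => by
    have h1 := (P.hasDerivAt_F b r hr).hasDerivWithinAt (s := Set.Ici 0)
    have h2 := (Q.hasDerivAt_F b r hr).hasDerivWithinAt (s := Set.Ici 0)
    have h3 := (uniqueDiffOn_Ici (0 : ℝ) r hr).eq_deriv _ h1
      (h2.congr (fun t ht => h b t ht) (h b r hr))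
    have hw : (weight k b : ℝ) ≠ 0 := by exact_mod_cast weight_ne_zero hk b
    exact mul_left_cancel₀ (neg_ne_zero.2 hw) h3
  refine KahlerMetric.ext (funext fun c => funext fun x => ?_)
  ext a b
  simp only [RadialPair.metric, tensorCoeff, Matrix.of_apply, tensor, h _ _ (rho_nonneg k c x),
    hE _ _ (rho_nonneg k c x)]

/-- Every invariant Kähler metric comes from profile data. -/
theorem KahlerMetric.exists_profileData {k : ℕ} (hn : 2 ≤ n) (hk : 1 ≤ k) {g : KahlerMetric n k}
    (hg : g.IsUnitaryInvariant) : ∃ D : ProfileData, g = D.metric hk n := by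
  obtain ⟨P, rfl, hE, hEpos, hF⟩ := g.exists_radialPair hn hk hg
  have hk' : (0 : ℝ) < k := by exact_mod_cast hk
  have hF₀ : ∀ r, HasDerivAt (P.F true) (-(k * P.E true r)) r := fun r =>
    (hF true r).congr_deriv (by simp [weight])
  have hF₁ : ∀ r, HasDerivAt (P.F false) (k * P.E false r) r := fun r =>
    (hF false r).congr_deriv (by simp [weight])
  -- The two branches of `F` coincide at `r = 1`, and monotonicity compares their values at `0`.
  have hlt : P.F false 0 < P.F true 0 := by
    have hanti : StrictAnti (P.F true) := strictAnti_of_deriv_neg fun r => by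
      rw [(hF₀ r).deriv]; exact neg_neg_of_pos (mul_pos hk' (hEpos _ _))
    have hmono : StrictMono (P.F false) := strictMono_of_deriv_pos fun r => by
      rw [(hF₁ r).deriv]; exact mul_pos hk' (hEpos _ _)
    have h1 := P.F_not true 1 one_pos
    rw [inv_one] at h1
    exact ((hmono one_pos).trans_eq h1).trans (hanti one_pos)
  set a := P.F false 0
  set l := P.F true 0 - a with hl
  have hl0 : 0 < l := sub_pos.2 hlt
  obtain ⟨q, e, he, hD, hprof⟩ := exists_profile_eq
    (u₀ := fun r => (P.F true r - a) / l) (u₁ := fun r => (P.F false r - a) / l)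
    (d₀ := fun r => k * P.E true r / l) (d₁ := fun r => k * P.E false r / l)
    (fun r => (((hF₀ r).sub_const a).div_const l).congr_deriv (by ring))
    (fun r => ((hF₁ r).sub_const a).div_const l)
    ((contDiff_const.mul (hE _)).div_const _) ((contDiff_const.mul (hE _)).div_const _)
    (fun r => div_pos (mul_pos hk' (hEpos _ _)) hl0) (fun r => div_pos (mul_pos hk' (hEpos _ _)) hl0)
    (div_self hl0.ne') (by simp [a])
    (fun r hr => by rw [← P.F_not true r hr]; rfl)
  let D : ProfileData := ⟨a, l, q, e, P.F_pos false 0 le_rfl, hl0, he, hD⟩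
  refine ⟨D, RadialPair.metric_congr hk fun b r hr => ?_⟩
  have htrue : ∀ r, 0 ≤ r → P.F true r = D.base true r := fun r hr => by
    have : D.height true r = (P.F true r - a) / l := hprof r hr
    rw [ProfileData.base, this]
    simp only [D]
    field_simp
    ring
  cases b
  · rcases hr.eq_or_lt with rfl | hr
    · change a = a + l * (1 - profile (D.const false) (D.fn false) 0)
      rw [profile_zero (D.contDiff_fn _) (D.den_fn_pos _)]
      ring
    · have h1 := P.F_not true r⁻¹ (inv_pos.2 hr)
      have h2 := (D.radialPair hk).F_not true r⁻¹ (inv_pos.2 hr)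
      rw [inv_inv] at h1 h2
      exact h1.trans ((htrue _ (inv_pos.2 hr).le).trans h2.symm)
  · exact htrue r hr

/-! ### The Levi form of a function of one complex variable -/

/-- `f` has the derivatives `∂f = p`, `∂̄f = q` and `∂∂̄f = m` at the origin. -/
def HasLevi (f : ℂ → ℂ) (p q m : ℂ) : Prop :=
  HasWirt f p q 0 1 ∧ ∃ Q : ℂ → ℂ, Q 0 = q ∧ (∀ᶠ s in 𝓝 0, ∃ p', HasWirt f p' (Q s) s 1) ∧
    ∃ m', HasWirt Q m m' 0 1

theorem HasWirt.of_hasDerivAt {f : ℂ → ℂ} {f' s : ℂ} (h : HasDerivAt f f' s) :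
    HasWirt f f' 0 s 1 :=
  ⟨_, h.hasFDerivAt.restrictScalars ℝ, by simp, by simp⟩

namespace HasLevi

variable {f g : ℂ → ℂ} {p q m p' q' m' : ℂ}

theorem congr_val (h : HasLevi f p q m) (hp : p = p') (hq : q = q') (hm : m = m') :
    HasLevi f p' q' m' := by
  subst hp hq hm; exact h

theorem congr_of_eventuallyEq (h : HasLevi f p q m) (hg : g =ᶠ[𝓝 0] f) : HasLevi g p q m := by
  obtain ⟨h1, Q, h2, h3, h4⟩ := h
  refine ⟨h1.congr_of_eventuallyEq hg, Q, h2, ?_, h4⟩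
  filter_upwards [h3, hg.eventually_nhds] with s ⟨a, ha⟩ hs using ⟨a, ha.congr_of_eventuallyEq hs⟩

theorem unique (h : HasLevi f p q m) (h' : HasLevi f p' q' m') : m = m' := by
  obtain ⟨-, Q, -, h3, _, h4⟩ := h
  obtain ⟨-, Q', -, h3', _, h4'⟩ := h'
  have : Q =ᶠ[𝓝 0] Q' := by
    filter_upwards [h3, h3'] with s ⟨a, ha⟩ ⟨b, hb⟩ using (ha.unique hb).2
  exact (h4.unique (h4'.congr_of_eventuallyEq this)).1

theorem const (a : ℂ) : HasLevi (fun _ => a) 0 0 0 :=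
  ⟨HasWirt.const a 0 1, fun _ => 0, rfl, .of_forall fun s => ⟨0, HasWirt.const a s 1⟩, 0,
    HasWirt.const 0 0 1⟩

theorem add (h : HasLevi f p q m) (h' : HasLevi g p' q' m') :
    HasLevi (fun s => f s + g s) (p + p') (q + q') (m + m') := by
  obtain ⟨h1, Q, rfl, h3, _, h4⟩ := h
  obtain ⟨h1', Q', rfl, h3', _, h4'⟩ := h'
  refine ⟨h1.add h1', fun s => Q s + Q' s, rfl, ?_, _, h4.add h4'⟩
  filter_upwards [h3, h3'] with s ⟨a, ha⟩ ⟨b, hb⟩ using ⟨_, ha.add hb⟩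

theorem mul (h : HasLevi f p q m) (h' : HasLevi g p' q' m') :
    HasLevi (fun s => f s * g s) (f 0 * p' + p * g 0) (f 0 * q' + q * g 0)
      (f 0 * m' + m * g 0 + p * q' + q * p') := by
  obtain ⟨h1, Q, rfl, h3, _, h4⟩ := h
  obtain ⟨h1', Q', rfl, h3', _, h4'⟩ := h'
  refine ⟨h1.mul h1', fun s => f s * Q' s + Q s * g s, rfl, ?_, _,
    ((h1.mul h4').add (h4.mul h1')).congr_val (by ring) rfl⟩
  filter_upwards [h3, h3'] with s ⟨a, ha⟩ ⟨b, hb⟩ using ⟨_, ha.mul hb⟩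

theorem sum {ι : Type*} (s : Finset ι) {f : ι → ℂ → ℂ} {p q m : ι → ℂ}
    (h : ∀ i ∈ s, HasLevi (f i) (p i) (q i) (m i)) :
    HasLevi (fun y => ∑ i ∈ s, f i y) (∑ i ∈ s, p i) (∑ i ∈ s, q i) (∑ i ∈ s, m i) := by
  classical
  induction s using Finset.induction_on with
  | empty => simpa using const 0
  | insert i s hi ih =>
    simp only [Finset.sum_insert hi]
    exact (h i (Finset.mem_insert_self i s)).add
      (ih fun j hj => h j (Finset.mem_insert_of_mem hj))

theorem holomorphic {d : ℂ} (hf : ∀ᶠ s in 𝓝 0, DifferentiableAt ℂ f s) (hd : deriv f 0 = d) :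
    HasLevi f d 0 0 := by
  subst hd
  refine ⟨.of_hasDerivAt hf.self_of_nhds.hasDerivAt, fun _ => 0, rfl, ?_, 0, HasWirt.const 0 0 1⟩
  filter_upwards [hf] with s hs using ⟨_, .of_hasDerivAt hs.hasDerivAt⟩

theorem eventually_differentiableAt_deriv {E : Type*} [NormedAddCommGroup E] [NormedSpace ℂ E]
    [CompleteSpace E] {f : ℂ → E} {z : ℂ} (hf : ∀ᶠ s in 𝓝 z, DifferentiableAt ℂ f s) :
    ∀ᶠ s in 𝓝 z, DifferentiableAt ℂ (deriv f) s := by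
  filter_upwards [hf.eventually_nhds] with s hs
  exact (Complex.analyticAt_iff_eventually_differentiableAt.2 hs).deriv.differentiableAt

theorem antiholomorphic {d : ℂ} (hf : ∀ᶠ s in 𝓝 0, DifferentiableAt ℂ f s) (hd : deriv f 0 = d) :
    HasLevi (fun s => conj (f s)) 0 (conj d) 0 := by
  subst hd
  have key : ∀ {f : ℂ → ℂ} {s : ℂ}, DifferentiableAt ℂ f s →
      HasWirt (fun s => conj (f s)) 0 (conj (deriv f s)) s 1 := fun h =>
    (HasWirt.of_hasDerivAt h.hasDerivAt).star.congr_val (map_zero _) rfl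
  refine ⟨key hf.self_of_nhds, fun s => conj (deriv f s), rfl, ?_, _,
    key (eventually_differentiableAt_deriv hf).self_of_nhds⟩
  filter_upwards [hf] with s hs using ⟨_, key hs⟩

theorem realComp {g : ℂ → ℝ} {φ φ' : ℝ → ℝ} {φ'' : ℝ} (h : HasLevi (fun s => (g s : ℂ)) p q m)
    (hφ : ∀ᶠ s in 𝓝 0, HasDerivAt φ (φ' (g s)) (g s)) (hφ' : HasDerivAt φ' φ'' (g 0)) :
    HasLevi (fun s => (φ (g s) : ℂ)) (φ' (g 0) * p) (φ' (g 0) * q)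
      (φ' (g 0) * m + φ'' * p * q) := by
  obtain ⟨h1, Q, rfl, h3, _, h4⟩ := h
  refine ⟨h1.realComp hφ.self_of_nhds, fun s => φ' (g s) * Q s, rfl, ?_, _,
    ((h1.realComp hφ').mul h4).congr_val (by ring) rfl⟩
  filter_upwards [h3, hφ] with s ⟨a, ha⟩ hs using ⟨_, ha.realComp hs⟩

end HasLevi

theorem fderiv_eq_sum_dz (f : (Fin n → ℂ) → ℂ) (x u : Fin n → ℂ) :
    fderiv ℝ f x u = ∑ e, dz e f x * u e + ∑ e, dzbar e f x * conj (u e) := by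
  set L := fderiv ℝ f x with hL
  have h1 : ∀ e (z : ℂ), L (Pi.single e z) = z.re * L (Pi.single e 1) +
      z.im * L (Pi.single e Complex.I) := fun e z => by
    have : (Pi.single e z : Fin n → ℂ) =
        z.re • (Pi.single e 1 : Fin n → ℂ) + z.im • (Pi.single e Complex.I : Fin n → ℂ) := by
      rw [← Pi.single_smul, ← Pi.single_smul, ← Pi.single_add]
      congr 1
      simp
    rw [this, map_add, map_smul, map_smul]
    simp
  have h2 : u = ∑ e, Pi.single e (u e) := (Finset.univ_sum_single u).symm
  conv_lhs => rw [h2, map_sum]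
  rw [← Finset.sum_add_distrib]
  refine Finset.sum_congr rfl fun e _ => ?_
  rw [h1, dz, dzbar, ← hL]
  have h3 := Complex.re_add_im (u e)
  have h4 : conj (u e) = (u e).re - (u e).im * Complex.I := by
    apply Complex.ext <;> simp
  rw [h4]
  conv_rhs => enter [1, 2]; rw [← h3]
  linear_combination ((u e).im * L (Pi.single e Complex.I)) * Complex.I_sq

theorem HasWirt.comp_hasDerivAt {f : (Fin n → ℂ) → ℂ} {γ : ℂ → Fin n → ℂ} {v : Fin n → ℂ} {s : ℂ}
    (hf : DifferentiableAt ℝ f (γ s)) (hγ : HasDerivAt γ v s) :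
    HasWirt (fun s => f (γ s)) (∑ e, dz e f (γ s) * v e) (∑ e, dzbar e f (γ s) * conj (v e)) s 1 := by
  refine ⟨_, hf.hasFDerivAt.comp s (hγ.hasFDerivAt.restrictScalars ℝ), ?_, ?_⟩
  · rw [← fderiv_eq_sum_dz]
    simp
  · simp only [ContinuousLinearMap.comp_apply, ContinuousLinearMap.coe_restrictScalars',
      ContinuousLinearMap.toSpanSingleton_apply, smul_eq_mul, mul_one]
    rw [fderiv_eq_sum_dz, mul_sub, Finset.mul_sum, Finset.mul_sum, sub_eq_add_neg,
      ← Finset.sum_neg_distrib]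
    congr 1 <;> refine Finset.sum_congr rfl fun e _ => ?_
    · simp only [Pi.smul_apply, smul_eq_mul]; ring
    · simp only [Pi.smul_apply, smul_eq_mul, map_mul, Complex.conj_I]; ring

theorem differentiable_dzbar {f : (Fin n → ℂ) → ℂ} (hf : ContDiff ℝ ∞ f) (a : Fin n) :
    Differentiable ℝ (dzbar a f) := by
  have h1 : ∀ v, Differentiable ℝ fun x => fderiv ℝ f x v := fun v =>
    ((hf.fderiv_right (m := ∞) (by simp)).clm_apply contDiff_const).differentiable (by simp)
  unfold dzbar
  simp only [div_eq_mul_inv]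
  exact ((h1 _).add ((h1 _).const_mul _)).mul_const _

/-- The conjugate of `γ'` is antiholomorphic, so `γ''` does not enter the Levi form. -/
theorem HasLevi.comp_holomorphic {f : (Fin n → ℂ) → ℂ} (hf : ContDiff ℝ ∞ f) {γ : ℂ → Fin n → ℂ}
    (hγ : ∀ᶠ s in 𝓝 0, DifferentiableAt ℂ γ s) {v : Fin n → ℂ} (hv : deriv γ 0 = v) :
    HasLevi (fun s => f (γ s)) (∑ e, dz e f (γ 0) * v e) (∑ e, dzbar e f (γ 0) * conj (v e))
      (∑ b, (∑ e, dz e (dzbar b f) (γ 0) * v e) * conj (v b)) := by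
  subst hv
  have hfd := hf.differentiable (by simp)
  have hγ' := HasLevi.eventually_differentiableAt_deriv hγ
  refine ⟨.comp_hasDerivAt (hfd _) hγ.self_of_nhds.hasDerivAt,
    fun s => ∑ e, dzbar e f (γ s) * conj (deriv γ s e), rfl, ?_, _,
    (HasWirt.sum _ fun b _ => (HasWirt.comp_hasDerivAt (differentiable_dzbar hf b _)
      hγ.self_of_nhds.hasDerivAt).mul (HasWirt.of_hasDerivAt
        (hasDerivAt_pi.1 hγ'.self_of_nhds.hasDerivAt b)).star).congr_val ?_ rfl⟩
  · filter_upwards [hγ] with s hs using ⟨_, .comp_hasDerivAt (hfd _) hs.hasDerivAt⟩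
  · simp

/-! ### Curvature along holomorphic curves -/

theorem hasWirt_dz_dzbar {f : (Fin n → ℂ) → ℂ} {x : Fin n → ℂ} (hf : DifferentiableAt ℝ f x)
    (a : Fin n) : HasWirt f (dz a f x) (dzbar a f x) x (Pi.single a 1) := by
  have : Complex.I • (Pi.single a 1 : Fin n → ℂ) = Pi.single a Complex.I := by
    rw [← Pi.single_smul, smul_eq_mul, mul_one]
  refine ⟨_, hf.hasFDerivAt, ?_, ?_⟩
  · rw [dz, dzbar]; ring
  · rw [this, dz, dzbar]
    linear_combination (fderiv ℝ f x (Pi.single a Complex.I)) * Complex.I_sq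

theorem dzbar_conj {f : (Fin n → ℂ) → ℂ} {x : Fin n → ℂ} (hf : DifferentiableAt ℝ f x)
    (a : Fin n) : dzbar a (fun y => conj (f y)) x = conj (dz a f x) := by
  have h1 := (hasWirt_dz_dzbar hf a).star
  obtain ⟨L, hL, -⟩ := h1
  exact ((hasWirt_dz_dzbar hL.differentiableAt a).unique (hasWirt_dz_dzbar hf a).star).2

theorem herm_add_add (G : Matrix (Fin n) (Fin n) ℂ) (v w : Fin n → ℂ) :
    herm G (v + w) (v + w) = herm G v v + herm G v w + herm G w v + herm G w w := by
  simp only [herm, ← Finset.sum_add_distrib]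
  refine Finset.sum_congr rfl fun a _ => Finset.sum_congr rfl fun b _ => ?_
  simp only [Pi.add_apply, map_add]
  ring

theorem sum_reorder {ι : Type*} [Fintype ι] (X : ι → ι → ι → ι → ι → ι → ℂ) :
    ∑ a, ∑ b, ∑ e, ∑ f, ∑ p, ∑ q, X a b e f p q =
      ∑ q, ∑ p, ∑ b, ∑ f, ∑ a, ∑ e, X a b e f p q := by
  let σ : (ι × ι × ι × ι × ι × ι) ≃ (ι × ι × ι × ι × ι × ι) :=
    { toFun := fun (a, b, e, f, p, q) => (q, p, b, f, a, e)
      invFun := fun (q, p, b, f, a, e) => (a, b, e, f, p, q)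
      left_inv := fun _ => rfl
      right_inv := fun _ => rfl }
  have := Fintype.sum_equiv σ (fun i => X i.1 i.2.1 i.2.2.1 i.2.2.2.1 i.2.2.2.2.1 i.2.2.2.2.2)
    (fun i => X i.2.2.2.2.1 i.2.2.1 i.2.2.2.2.2 i.2.2.2.1 i.2.1 i.1) fun _ => rfl
  simpa only [Fintype.sum_prod_type] using this

namespace KahlerMetric

variable {k : ℕ} (g : KahlerMetric n k) (c : ChartIdx n) (x v : Fin n → ℂ)

/-- `R(v, v̄, v, v̄)`. -/
def curvForm : ℂ :=
  ∑ a, ∑ b, ∑ e, ∑ f, g.curv c x a b e f * v a * conj (v b) * v e * conj (v f)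

/-- The lowered connection term `∂_v g(v, ·)`. -/
def connForm (b : Fin n) : ℂ := ∑ a, ∑ e, dz e (fun y => g.coeff c y a b) x * v e * v a

/-- `∂_v ∂̄_v g(v, v)`. -/
def leviForm : ℂ :=
  ∑ a, ∑ b, (∑ f, (∑ e, dz e (dzbar f fun y => g.coeff c y a b) x * v e) * conj (v f)) *
    v a * conj (v b)

variable {g c x v}

theorem herm_nonneg (w : Fin n → ℂ) : 0 ≤ (herm (g.coeff c x) w w).re := by
  by_cases hw : w = 0
  · subst hw; simp [herm]
  · exact (g.pos c x w hw).le

theorem isUnit_coeff : IsUnit (g.coeff c x) := by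
  refine Matrix.vecMul_injective_iff_isUnit.1 ?_
  refine (injective_iff_map_eq_zero (Matrix.vecMulLinear (g.coeff c x))).2 fun w hw => ?_
  by_contra h
  have h1 := g.pos c x w h
  have h2 : herm (g.coeff c x) w w = 0 := by
    rw [herm, Finset.sum_comm]
    refine Finset.sum_eq_zero fun b _ => ?_
    rw [← Finset.sum_mul]
    have := congrFun hw b
    simp only [Matrix.vecMulLinear_apply, Matrix.vecMul, dotProduct, Pi.zero_apply] at this
    rw [show ∑ i, g.coeff c x i b * w i = 0 by simpa [mul_comm] using this, zero_mul]
  rw [h2] at h1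
  exact lt_irrefl _ h1

/-- The vector `ξ` is the Christoffel term `Γ(v, v)`, obtained by raising the index of `connForm`.
-/
theorem exists_connection : ∃ ξ : Fin n → ℂ, ∀ b, ∑ a, g.coeff c x a b * ξ a = g.connForm c x v b := by
  refine ⟨Matrix.vecMul (g.connForm c x v) (g.coeff c x)⁻¹, fun b => ?_⟩
  have h : Matrix.vecMul (Matrix.vecMul (g.connForm c x v) (g.coeff c x)⁻¹) (g.coeff c x) =
      g.connForm c x v := by
    rw [Matrix.vecMul_vecMul, Matrix.nonsing_inv_mul _
      ((Matrix.isUnit_iff_isUnit_det _).1 isUnit_coeff), Matrix.vecMul_one]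
  conv_rhs => rw [← h]
  simp only [Matrix.vecMul, dotProduct]
  exact Finset.sum_congr rfl fun a _ => mul_comm _ _

theorem dzbar_coeff (a b f : Fin n) :
    dzbar f (fun y => g.coeff c y a b) x = conj (dz f (fun y => g.coeff c y b a) x) := by
  rw [← dzbar_conj ((g.smooth c b a).differentiable (by simp) x)]
  congr 1
  funext y
  exact g.hermitian c y b a

variable {ξ : Fin n → ℂ}

theorem herm_connection (hξ : ∀ b, ∑ a, g.coeff c x a b * ξ a = g.connForm c x v b)
    (w : Fin n → ℂ) : herm (g.coeff c x) ξ w = ∑ b, g.connForm c x v b * conj (w b) := by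
  rw [herm, Finset.sum_comm]
  refine Finset.sum_congr rfl fun b _ => ?_
  rw [← hξ b, Finset.sum_mul]

theorem conj_herm_coeff (v w : Fin n → ℂ) :
    conj (herm (g.coeff c x) v w) = herm (g.coeff c x) w v := by
  simp only [herm, map_sum, map_mul, Complex.conj_conj]
  rw [Finset.sum_comm]
  refine Finset.sum_congr rfl fun a _ => Finset.sum_congr rfl fun b _ => ?_
  rw [← g.hermitian]; ring

/-- The quadratic term of the curvature is the squared length of `Γ(v, v)`. -/
theorem curvForm_eq (hξ : ∀ b, ∑ a, g.coeff c x a b * ξ a = g.connForm c x v b) :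
    g.curvForm c x v = -g.leviForm c x v + herm (g.coeff c x) ξ ξ := by
  have hinv : ξ = Matrix.vecMul (g.connForm c x v) (g.coeff c x)⁻¹ := by
    have h : Matrix.vecMul ξ (g.coeff c x) = g.connForm c x v := by
      funext b
      rw [← hξ b]
      simp only [Matrix.vecMul, dotProduct]
      exact Finset.sum_congr rfl fun a _ => mul_comm _ _
    rw [← h, Matrix.vecMul_vecMul, Matrix.mul_nonsing_inv _
      ((Matrix.isUnit_iff_isUnit_det _).1 isUnit_coeff), Matrix.vecMul_one]
  have h1 : herm (g.coeff c x) ξ ξ =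
      ∑ q, ∑ p, (g.coeff c x)⁻¹ p q * g.connForm c x v p * conj (g.connForm c x v q) := by
    rw [← conj_herm_coeff, herm_connection hξ, map_sum]
    refine Finset.sum_congr rfl fun q _ => ?_
    conv_lhs => rw [hinv]
    simp only [Matrix.vecMul, dotProduct, map_mul, Complex.conj_conj]
    rw [mul_comm, Finset.sum_mul]
    refine Finset.sum_congr rfl fun p _ => ?_
    ring
  have h2 : ∀ q, conj (g.connForm c x v q) =
      ∑ b, ∑ f, dzbar f (fun y => g.coeff c y q b) x * conj (v f) * conj (v b) := fun q => by
    simp only [connForm, map_sum, map_mul, dzbar_coeff]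
  rw [h1, curvForm, leviForm]
  simp only [curv, add_mul, Finset.sum_add_distrib]
  congr 1
  · rw [← Finset.sum_neg_distrib]
    refine Finset.sum_congr rfl fun a _ => ?_
    rw [← Finset.sum_neg_distrib]
    refine Finset.sum_congr rfl fun b _ => ?_
    rw [Finset.sum_comm, Finset.sum_mul, Finset.sum_mul, ← Finset.sum_neg_distrib]
    refine Finset.sum_congr rfl fun f _ => ?_
    rw [Finset.sum_mul, Finset.sum_mul, Finset.sum_mul, ← Finset.sum_neg_distrib]
    refine Finset.sum_congr rfl fun e _ => ?_
    ring
  · simp only [h2]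
    simp only [connForm, Finset.sum_mul, Finset.mul_sum]
    refine (sum_reorder fun a b e f p q => (g.coeff c x)⁻¹ p q *
      dz e (fun y => g.coeff c y a p) x * dzbar f (fun y => g.coeff c y q b) x * v a *
        conj (v b) * v e * conj (v f)).trans ?_
    refine Finset.sum_congr rfl fun q _ => Finset.sum_congr rfl fun p _ =>
      Finset.sum_congr rfl fun b _ => Finset.sum_congr rfl fun f _ =>
      Finset.sum_congr rfl fun a _ => Finset.sum_congr rfl fun e _ => ?_
    ring

/-- The curvature in terms of the Levi form of the length of a holomorphic curve. -/
theorem hasLevi_curve {γ : ℂ → Fin n → ℂ} (hγ : ∀ᶠ s in 𝓝 0, DifferentiableAt ℂ γ s)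
    (h0 : γ 0 = x) (hv : deriv γ 0 = v) {η : Fin n → ℂ} (hη : deriv (deriv γ) 0 = η)
    (hξ : ∀ b, ∑ a, g.coeff c x a b * ξ a = g.connForm c x v b) :
    ∃ p q, HasLevi (fun s => herm (g.coeff c (γ s)) (deriv γ s) (deriv γ s)) p q
      (-g.curvForm c x v + herm (g.coeff c x) (ξ + η) (ξ + η)) := by
  have hγ' := HasLevi.eventually_differentiableAt_deriv hγ
  have hc : ∀ a, HasLevi (fun s => deriv γ s a) (η a) 0 0 := fun a => by
    refine HasLevi.holomorphic ?_ ?_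
    · filter_upwards [hγ'] with s hs using differentiableAt_pi.1 hs a
    · rw [← hη]; exact (hasDerivAt_pi.1 hγ'.self_of_nhds.hasDerivAt a).deriv
  have hcc : ∀ a, HasLevi (fun s => conj (deriv γ s a)) 0 (conj (η a)) 0 := fun a => by
    refine HasLevi.antiholomorphic (f := fun s => deriv γ s a) ?_ ?_
    · filter_upwards [hγ'] with s hs using differentiableAt_pi.1 hs a
    · rw [← hη]; exact (hasDerivAt_pi.1 hγ'.self_of_nhds.hasDerivAt a).deriv
  have key := HasLevi.sum Finset.univ fun a _ => HasLevi.sum Finset.univ fun b _ =>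
    ((HasLevi.comp_holomorphic (g.smooth c a b) hγ hv).mul (hc a)).mul (hcc b)
  refine ⟨_, _, key.congr_val rfl rfl ?_⟩
  -- The two mixed terms and `|η|²` complete `|ξ|²` to `|ξ + η|²`, the squared length of the
  -- covariant acceleration of the curve.
  rw [curvForm_eq hξ, herm_add_add, herm_connection hξ η, ← conj_herm_coeff ξ η,
    herm_connection hξ η]
  simp only [h0, hv, map_sum, map_mul, Complex.conj_conj, neg_add_rev, neg_neg]
  have e1 : ∑ b, g.connForm c x v b * conj (η b) =
      ∑ a, ∑ b, (∑ e, dz e (fun y => g.coeff c y a b) x * v e) * v a * conj (η b) := by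
    rw [Finset.sum_comm]
    refine Finset.sum_congr rfl fun b _ => ?_
    simp only [connForm, Finset.sum_mul]
  have e2 : ∑ b, conj (g.connForm c x v b) * η b =
      ∑ a, ∑ b, (∑ e, dzbar e (fun y => g.coeff c y a b) x * conj (v e)) * η a * conj (v b) := by
    refine Finset.sum_congr rfl fun a _ => ?_
    simp only [connForm, map_sum, map_mul, Finset.sum_mul, dzbar_coeff]
    refine Finset.sum_congr rfl fun b _ => Finset.sum_congr rfl fun e _ => ?_
    ring
  have e3 : herm (g.coeff c x) η η = ∑ a, ∑ b, g.coeff c x a b * η a * conj (η b) := rfl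
  rw [e1, e2, e3, leviForm]
  have : ∀ A B C D E : ℂ, -A + B + (A + C + D + E) = B + C + D + E := fun A B C D E => by ring
  rw [this]
  simp only [← Finset.sum_add_distrib]
  refine Finset.sum_congr rfl fun a _ => Finset.sum_congr rfl fun b _ => ?_
  ring

theorem holSecCurv_pos_iff (hv : v ≠ 0) : 0 < g.holSecCurv c x v ↔ 0 < (g.curvForm c x v).re := by
  have := g.pos c x v hv
  rw [holSecCurv, curvForm]
  exact div_pos_iff_of_pos_right (by positivity)

end KahlerMetric

/-! ### Reduction of curvature positivity to the slices. -/

namespace KahlerMetric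

variable {k : ℕ} {g : KahlerMetric n k}

theorem hasDerivAt_quadratic (y w η : Fin n → ℂ) (s : ℂ) :
    HasDerivAt (fun s : ℂ => y + s • w + (s ^ 2 / 2) • η) (w + s • η) s := by
  have h1 : HasDerivAt (fun s : ℂ => s • w) ((1 : ℂ) • w) s := (hasDerivAt_id s).smul_const w
  have h2 : HasDerivAt (fun s : ℂ => (s ^ 2 / 2) • η) (((2 : ℕ) * s ^ 1 / 2 : ℂ) • η) s := by
    simpa using ((hasDerivAt_pow 2 s).div_const 2).smul_const η
  refine ((h1.const_add y).add h2).congr_deriv ?_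
  simp

theorem deriv_quadratic (y w η : Fin n → ℂ) :
    deriv (fun s : ℂ => y + s • w + (s ^ 2 / 2) • η) = fun s => w + s • η :=
  funext fun s => (hasDerivAt_quadratic y w η s).deriv

theorem deriv_deriv_quadratic (y w η : Fin n → ℂ) (s : ℂ) :
    deriv (deriv fun s : ℂ => y + s • w + (s ^ 2 / 2) • η) s = η := by
  rw [deriv_quadratic]
  have : HasDerivAt (fun s : ℂ => w + s • η) ((1 : ℂ) • η) s :=
    ((hasDerivAt_id s).smul_const η).const_add w
  rw [this.deriv, one_smul]

theorem differentiableAt_quadratic (y w η : Fin n → ℂ) (s : ℂ) :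
    DifferentiableAt ℂ (fun s : ℂ => y + s • w + (s ^ 2 / 2) • η) s :=
  (hasDerivAt_quadratic y w η s).differentiableAt

/-- Positivity of the holomorphic sectional curvature can be tested on the slices. -/
theorem hasPositiveHolSecCurv_of_slices (hk : 1 ≤ k) (hg : g.IsUnitaryInvariant)
    (h : ∀ (c : ChartIdx n) (t : ℝ), 0 ≤ t → ∀ v, v ≠ 0 →
      0 < (g.curvForm c (slicePt c t) v).re) : g.HasPositiveHolSecCurv := by
  intro c x v hv
  rw [holSecCurv_pos_iff hv]
  obtain ⟨A, hA, t, ht, hAt⟩ := exists_actMap_eq_slicePt hk c x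
  set y := slicePt c (t : ℂ) with hy
  have hsymm : (chart (k := k) c).symm y = A • (chart (k := k) c).symm x := by
    rw [← hAt]; exact (chart c).left_inv hA
  have hback : A⁻¹ • (chart (k := k) c).symm y = (chart (k := k) c).symm x := by
    rw [hsymm, inv_smul_smul]
  have hsrc : A⁻¹ • (chart (k := k) c).symm y ∈ (chart (k := k) c).source := by
    rw [hback]; exact (chart c).map_target (Set.mem_univ _)
  have hψy : actMap A⁻¹ c c k y = x := by
    change chart c (A⁻¹ • (chart (k := k) c).symm y) = x
    rw [hback]; exact (chart c).right_inv (Set.mem_univ _)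
  obtain ⟨L, hL, -⟩ := exists_hasFDerivAt_actMap hsrc
  have hinv : ∀ w, herm (g.coeff c x) (L w) (L w) = herm (g.coeff c y) w w := fun w => by
    have := hg A⁻¹ c c y hsrc w w
    change herm (g.coeff c (actMap A⁻¹ c c k y)) (fderiv ℂ (actMap A⁻¹ c c k) y w)
      (fderiv ℂ (actMap A⁻¹ c c k) y w) = _ at this
    rwa [hψy, hL.fderiv] at this
  have hinj : Function.Injective (L : (Fin n → ℂ) →ₗ[ℂ] (Fin n → ℂ)) := by
    refine (injective_iff_map_eq_zero _).2 fun w hw => ?_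
    by_contra hne
    have h1 := g.pos c y w hne
    rw [← hinv w, show L w = 0 from hw] at h1
    simp [herm] at h1
  obtain ⟨w, hw⟩ := LinearMap.injective_iff_surjective.1 hinj v
  have hw : L w = v := hw
  have hw0 : w ≠ 0 := by rintro rfl; exact hv (by rw [← hw, map_zero])
  obtain ⟨ξ, hξ⟩ := exists_connection (g := g) (c := c) (x := y) (v := w)
  -- With second derivative `-ξ` the curve has no covariant acceleration at `y`, so the Levi form of
  -- its squared speed there is exactly minus the curvature.
  let γ : ℂ → Fin n → ℂ := fun s => y + s • w + (s ^ 2 / 2) • (-ξ)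
  have hγd : ∀ s, DifferentiableAt ℂ γ s := differentiableAt_quadratic y w (-ξ)
  have hγ0 : γ 0 = y := by simp [γ]
  have hγ1 : deriv γ 0 = w := by simp only [γ]; rw [deriv_quadratic]; simp
  obtain ⟨p, q, hlevi⟩ := hasLevi_curve (.of_forall hγd) hγ0 hγ1
    (deriv_deriv_quadratic y w (-ξ) 0) hξ
  have hopen : ∀ᶠ s in 𝓝 (0 : ℂ), A⁻¹ • (chart (k := k) c).symm (γ s) ∈ (chart (k := k) c).source := by
    have hcont : Continuous fun s => scale A⁻¹ c c (γ s) := by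
      have hγc : Continuous γ := continuous_iff_continuousAt.2 fun s => (hγd s).continuousAt
      have : Continuous (scale A⁻¹ c c) := by
        unfold scale Matrix.mulVec dotProduct frame
        fun_prop
      exact this.comp hγc
    have h0 : scale A⁻¹ c c (γ 0) ≠ 0 := by rw [hγ0]; exact (mem_source_iff.1 hsrc).1
    filter_upwards [hcont.continuousAt.eventually_ne h0] with s hs
    exact mem_source_iff.2 ⟨hs, fun h => absurd rfl h⟩
  have hd : ∀ᶠ s in 𝓝 (0 : ℂ), HasDerivAt (fun s => actMap A⁻¹ c c k (γ s))
      (fderiv ℂ (actMap A⁻¹ c c k) (γ s) (deriv γ s)) s := by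
    filter_upwards [hopen] with s hs
    obtain ⟨M, hM, -⟩ := exists_hasFDerivAt_actMap hs
    rw [hM.fderiv]
    exact hM.comp_hasDerivAt s (hγd s).hasDerivAt
  obtain ⟨ξ', hξ'⟩ := exists_connection (g := g) (c := c) (x := x) (v := v)
  obtain ⟨p', q', hlevi'⟩ := hasLevi_curve (g := g) (c := c) (γ := fun s => actMap A⁻¹ c c k (γ s))
    (hd.mono fun s hs => hs.differentiableAt) (by simp only [hγ0, hψy])
    (by rw [hd.self_of_nhds.deriv, hγ0, hγ1, hL.fderiv, hw]) rfl hξ'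
  have heq : (fun s => herm (g.coeff c (actMap A⁻¹ c c k (γ s)))
      (deriv (fun s => actMap A⁻¹ c c k (γ s)) s) (deriv (fun s => actMap A⁻¹ c c k (γ s)) s))
      =ᶠ[𝓝 0] fun s => herm (g.coeff c (γ s)) (deriv γ s) (deriv γ s) := by
    filter_upwards [hd, hopen] with s hs hs'
    rw [hs.deriv]
    exact hg A⁻¹ c c (γ s) hs' _ _
  -- The isometry preserves the squared speed, so the two Levi forms agree. At `x` the acceleration
  -- can only add a non-negative term, so the curvature at `x` is at least that at `y`. No
  -- transformation law for the curvature is needed.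
  have hm := (hlevi.congr_of_eventuallyEq heq).unique hlevi'
  have h1 := h c t ht w hw0
  have h2 := g.herm_nonneg (c := c) (x := x)
    (ξ' + deriv (deriv fun s => actMap A⁻¹ c c k (γ s)) 0)
  have h3 := congrArg Complex.re hm
  rw [add_neg_cancel] at h3
  simp only [Complex.add_re, Complex.neg_re] at h3
  have h4 : (herm (g.coeff c y) 0 0).re = 0 := by simp [herm]
  rw [← hy] at h1
  linarith

theorem hasWirt_sum_dz {f : (Fin n → ℂ) → ℂ} {x : Fin n → ℂ} (hf : DifferentiableAt ℝ f x)
    (v : Fin n → ℂ) :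
    HasWirt f (∑ e, dz e f x * v e) (∑ e, dzbar e f x * conj (v e)) x v := by
  refine ⟨_, hf.hasFDerivAt, fderiv_eq_sum_dz f x v, ?_⟩
  rw [fderiv_eq_sum_dz, mul_sub, Finset.mul_sum, Finset.mul_sum, sub_eq_add_neg,
    ← Finset.sum_neg_distrib]
  congr 1 <;> refine Finset.sum_congr rfl fun e _ => ?_
  · simp only [Pi.smul_apply, smul_eq_mul]; ring
  · simp only [Pi.smul_apply, smul_eq_mul, map_mul, Complex.conj_I]; ring

theorem herm_single_right (G : Matrix (Fin n) (Fin n) ℂ) (v : Fin n → ℂ) (b : Fin n) :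
    herm G v (Pi.single b 1) = ∑ a, G a b * v a := by
  refine Finset.sum_congr rfl fun a _ => ?_
  rw [Finset.sum_eq_single b]
  · simp
  · intro i _ hi; simp [Pi.single_eq_of_ne hi]
  · simp

theorem connForm_eq {c : ChartIdx n} {x v : Fin n → ℂ} {b : Fin n} {p q : ℂ}
    (h : HasWirt (fun y => herm (g.coeff c y) v (Pi.single b 1)) p q x v) :
    g.connForm c x v b = p := by
  simp only [herm_single_right] at h
  have h1 := HasWirt.sum Finset.univ fun a _ =>
    (hasWirt_sum_dz ((g.smooth c a b).differentiable (by simp) x) v).mul (HasWirt.const (v a) x v)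
  rw [← (h1.unique h).1, connForm]
  refine Finset.sum_congr rfl fun a _ => ?_
  rw [mul_zero, zero_add, Finset.sum_mul]

end KahlerMetric

/-! ### The curvature on the slices -/

/-- The squared norm of the base component. -/
def baseNormSq (c : ChartIdx n) (v : Fin n → ℂ) : ℝ := ∑ i, Complex.normSq (hor c v i)

theorem inn_hor_hor (c : ChartIdx n) (v : Fin n → ℂ) :
    inn (hor c v) (hor c v) = baseNormSq c v := by
  simp [inn, baseNormSq, Complex.mul_conj]

/-! ### The invariant tensor along straight lines through a point of a slice. -/

section Line

variable (k : ℕ) (c : ChartIdx n) (t s : ℂ) (v : Fin n → ℂ)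

theorem hor_line : hor c (slicePt c t + s • v) = s • hor c v := by
  funext i
  by_cases hi : i = c.1
  · subst hi; simp [hor]
  · simp [hor, slicePt, hi]

theorem nrm_line : nrm c (slicePt c t + s • v) = 1 + Complex.normSq s * baseNormSq c v := by
  rw [nrm_eq, hor_line, baseNormSq, Finset.mul_sum]
  simp

theorem line_apply : (slicePt c t + s • v) c.1 = t + s * v c.1 := by simp [slicePt]

theorem inn_hor_frame_line :
    inn (hor c v) (frame c (slicePt c t + s • v)) = conj s * baseNormSq c v := by
  rw [inn_hor_frame, hor_line, ← conj_inn, inn_smul_left, map_mul, conj_inn, inn_hor_hor]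

theorem vert_line : vert k c (slicePt c t + s • v) v =
    v c.1 + (-weight k c.2 * baseNormSq c v) * ((t + s * v c.1) * conj s *
      (((1 + Complex.normSq s * baseNormSq c v) ^ (-1 : ℤ) : ℝ) : ℂ)) := by
  rw [vert, line_apply, inn_hor_frame_line, nrm_line, zpow_neg_one]
  push_cast
  ring

theorem fubini_line : fubini c (slicePt c t + s • v) v v =
    baseNormSq c v * (((1 + Complex.normSq s * baseNormSq c v) ^ (-2 : ℤ) : ℝ) : ℂ) := by
  have hN : (nrm c (slicePt c t + s • v) : ℂ) ≠ 0 := by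
    exact_mod_cast (nrm_pos c _).ne'
  rw [fubini, ← conj_inn (hor c v) (frame c _), inn_hor_frame_line, inn_hor_hor, ← nrm_line c t s v]
  push_cast
  rw [zpow_neg, map_mul, Complex.conj_conj, Complex.conj_ofReal]
  have h2 : conj s * s * baseNormSq c v = (nrm c (slicePt c t + s • v) : ℂ) - 1 := by
    rw [nrm_line]; push_cast; rw [Complex.normSq_eq_conj_mul_self]; ring
  have h3 : (nrm c (slicePt c t + s • v) : ℂ) ^ (2 : ℤ) = (nrm c (slicePt c t + s • v) : ℂ) ^ 2 := by
    norm_cast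
  rw [h3]
  generalize (nrm c (slicePt c t + s • v) : ℂ) = N at hN h2
  field_simp
  linear_combination (-(baseNormSq c v : ℂ)) * h2

end Line

/-- At the origin `|s|²` has no first derivatives and Levi form `1`, so only the first derivative of
the power matters. -/
theorem hasLevi_ofReal_nrm (Y : ℝ) (m : ℤ) :
    HasLevi (fun s => (((1 + Complex.normSq s * Y) ^ m : ℝ) : ℂ)) 0 0 (m * Y) := by
  have hs : HasLevi (fun s => s) 1 0 0 :=
    .holomorphic (.of_forall fun _ => differentiableAt_id) (deriv_id 0)
  have hsc : HasLevi (fun s => conj s) 0 1 0 :=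
    (HasLevi.antiholomorphic (f := fun s => s) (.of_forall fun _ => differentiableAt_id)
      (deriv_id 0)).congr_val rfl (map_one _) rfl
  have h1 : HasLevi (fun s => ((1 + Complex.normSq s * Y : ℝ) : ℂ)) 0 0 Y := by
    have := (HasLevi.const 1).add ((hs.mul hsc).mul (HasLevi.const (Y : ℂ)))
    refine (this.congr_val (by simp) (by simp) (by simp)).congr_of_eventuallyEq (.of_forall fun s => ?_)
    simp [Complex.mul_conj]
  have hpos : ∀ᶠ s in 𝓝 (0 : ℂ), (1 + Complex.normSq s * Y : ℝ) ≠ 0 := by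
    have : Continuous fun s : ℂ => 1 + Complex.normSq s * Y := by
      have := Complex.continuous_normSq; fun_prop
    exact this.continuousAt.eventually_ne (by simp)
  refine (h1.realComp (φ := fun r => r ^ m) (φ' := fun r => m * r ^ (m - 1))
    (hpos.mono fun s hs => hasDerivAt_zpow m _ (.inl hs))
    ((hasDerivAt_zpow (m - 1) _ (.inl (by simp))).const_mul _)).congr_val (by simp) (by simp) (by simp)

/-! ### The curvature as a quadratic form on a slice. -/

namespace RadialPair

variable {k : ℕ} (P : RadialPair k)

/-- The holomorphic sectional curvature of a line with vertical and horizontal parts of squared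
lengths `X` and `Y` on a slice, up to normalisation. -/
def sliceCurv (b : Bool) (r X Y : ℝ) : ℝ :=
  (r * deriv (P.E b) r ^ 2 / P.E b r - deriv (P.E b) r - r * deriv (deriv (P.E b)) r) * X ^ 2 +
    4 * weight k b * (P.E b r + r * deriv (P.E b) r + weight k b * r * P.E b r ^ 2 / P.F b r) *
      X * Y + 2 * (P.F b r - weight k b ^ 2 * r * P.E b r) * Y ^ 2

theorem hasDerivAt_deriv_E (b : Bool) {r : ℝ} (hr : 0 ≤ r) :
    HasDerivAt (deriv (P.E b)) (deriv (deriv (P.E b)) r) r :=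
  (((P.contDiffAt_E b r hr).derivWithin (m := ∞) (by simp)).differentiableAt (by simp)).hasDerivAt

theorem hasLevi_line (c : ChartIdx n) (t : ℂ) (v : Fin n → ℂ) {r X Y : ℝ}
    (hr : Complex.normSq t = r) (hX : Complex.normSq (v c.1) = X) (hY : baseNormSq c v = Y) :
    ∃ p q, HasLevi (fun s => tensor k P.F P.E c (slicePt c t + s • v) v v) p q
      (((deriv (P.E c.2) r + r * deriv (deriv (P.E c.2)) r) * X ^ 2 -
        4 * weight k c.2 * (P.E c.2 r + r * deriv (P.E c.2) r) * X * Y +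
        2 * (weight k c.2 ^ 2 * r * P.E c.2 r - P.F c.2 r) * Y ^ 2 : ℝ) : ℂ) := by
  have hr0 : 0 ≤ r := hr ▸ Complex.normSq_nonneg t
  have ht : t * conj t = r := by rw [Complex.mul_conj, hr]
  have hv : v c.1 * conj (v c.1) = X := by rw [Complex.mul_conj, hX]
  set κ : ℂ := (weight k c.2 : ℂ) with hκ
  have hs : HasLevi (fun s => s) 1 0 0 :=
    .holomorphic (.of_forall fun _ => differentiableAt_id) (deriv_id 0)
  have hsc : HasLevi (fun s => conj s) 0 1 0 :=
    (HasLevi.antiholomorphic (f := fun s => s) (.of_forall fun _ => differentiableAt_id)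
      (deriv_id 0)).congr_val rfl (map_one _) rfl
  have hx : HasLevi (fun s => t + s * v c.1) (v c.1) 0 0 :=
    ((HasLevi.const t).add (hs.mul (HasLevi.const (v c.1)))).congr_val (by simp) (by simp) (by simp)
  have hxc : HasLevi (fun s => conj t + conj s * conj (v c.1)) 0 (conj (v c.1)) 0 :=
    ((HasLevi.const (conj t)).add (hsc.mul (HasLevi.const (conj (v c.1))))).congr_val
      (by simp) (by simp) (by simp)
  have hN := hasLevi_ofReal_nrm Y
  have hrho : HasLevi (fun s => (rho k c (slicePt c t + s • v) : ℂ)) (conj t * v c.1)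
      (t * conj (v c.1)) (X - κ * r * Y) := by
    refine (((hx.mul hxc).mul (hN (-weight k c.2))).congr_val ?_ ?_ ?_).congr_of_eventuallyEq
      (.of_forall fun s => ?_)
    · simp; ring
    · simp
    · simp
      linear_combination (-κ * Y) * ht + hv
    · simp only [rho, line_apply, nrm_line, hY]
      push_cast
      rw [← Complex.mul_conj]
      simp
  have hrho0 : rho k c (slicePt c t + (0 : ℂ) • v) = r := by
    rw [zero_smul, add_zero, rho_slicePt, hr]
  have hF := hrho.realComp (φ := P.F c.2) (φ' := fun r => -weight k c.2 * P.E c.2 r)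
    (.of_forall fun s => P.hasDerivAt_F c.2 _ (rho_nonneg k c _))
    ((P.hasDerivAt_E c.2 (rho_nonneg k c _)).const_mul _)
  have hE := hrho.realComp (φ := P.E c.2) (φ' := deriv (P.E c.2))
    (.of_forall fun s => P.hasDerivAt_E c.2 (rho_nonneg k c _))
    (P.hasDerivAt_deriv_E c.2 (rho_nonneg k c _))
  rw [hrho0] at hF hE
  have hβ : HasLevi (fun s => v c.1 + -κ * Y * ((t + s * v c.1) * conj s *
      (((1 + Complex.normSq s * Y) ^ (-1 : ℤ) : ℝ) : ℂ))) 0 (-κ * Y * t) (-κ * Y * v c.1) :=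
    ((HasLevi.const (v c.1)).add ((HasLevi.const (-κ * Y)).mul ((hx.mul hsc).mul
      (hN (-1))))).congr_val (by simp) (by simp) (by simp)
  have hβc : HasLevi (fun s => conj (v c.1) + -κ * Y * ((conj t + conj s * conj (v c.1)) * s *
      (((1 + Complex.normSq s * Y) ^ (-1 : ℤ) : ℝ) : ℂ))) (-κ * Y * conj t) 0
      (-κ * Y * conj (v c.1)) :=
    ((HasLevi.const (conj (v c.1))).add ((HasLevi.const (-κ * Y)).mul ((hxc.mul hs).mul
      (hN (-1))))).congr_val (by simp) (by simp) (by simp)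
  have key := (hF.mul ((HasLevi.const (Y : ℂ)).mul (hN (-2)))).add
    ((hE.mul (hN (-weight k c.2))).mul (hβ.mul hβc))
  refine ⟨_, _, (key.congr_val rfl rfl ?_).congr_of_eventuallyEq (.of_forall fun s => ?_)⟩
  · simp only [hrho0, map_zero, zero_mul, mul_zero, add_zero, zero_add, one_zpow,
      Complex.ofReal_one, mul_one]
    push_cast
    rw [← hκ]
    generalize ((P.F c.2 r : ℝ) : ℂ) = F
    generalize ((P.E c.2 r : ℝ) : ℂ) = E
    generalize ((deriv (P.E c.2) r : ℝ) : ℂ) = E1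
    generalize ((deriv (deriv (P.E c.2)) r : ℝ) : ℂ) = E2
    generalize v c.1 = x at *
    rw [← hv, ← ht]
    ring
  · simp only [tensor, fubini_line, vert_line, hY, nrm_line]
    simp only [map_add, map_mul, map_neg, Complex.conj_conj, Complex.conj_ofReal, map_intCast]
    push_cast
    ring

/-- For a straight line `η = 0`, so the curvature is `|ξ|²` minus the Levi form computed in
`hasLevi_line`. -/
theorem curvForm_slicePt (c : ChartIdx n) (t : ℂ) (v : Fin n → ℂ) :
    (P.metric n).curvForm c (slicePt c t) v =
      P.sliceCurv c.2 (Complex.normSq t) (Complex.normSq (v c.1)) (baseNormSq c v) := by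
  obtain ⟨r, hr⟩ : ∃ r, Complex.normSq t = r := ⟨_, rfl⟩
  obtain ⟨X, hX⟩ : ∃ X, Complex.normSq (v c.1) = X := ⟨_, rfl⟩
  obtain ⟨Y, hY⟩ : ∃ Y, baseNormSq c v = Y := ⟨_, rfl⟩
  have hr0 : 0 ≤ r := hr ▸ Complex.normSq_nonneg t
  have ht : t * conj t = r := by rw [Complex.mul_conj, hr]
  have hv : v c.1 * conj (v c.1) = X := by rw [Complex.mul_conj, hX]
  have hE0 : (P.E c.2 r : ℂ) ≠ 0 := by exact_mod_cast (P.E_pos c.2 r hr0).ne'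
  have hF0 : (P.F c.2 r : ℂ) ≠ 0 := by exact_mod_cast (P.F_pos c.2 r hr0).ne'
  -- The metric is diagonal on the slice, so `g(ξ, ·) = ∂_v g(v, ·)` is solved separately in the
  -- horizontal and the fibre direction. The factor `2` arises because the Kähler condition makes
  -- two terms equal.
  set a : ℂ := -2 * weight k c.2 * P.E c.2 r / P.F c.2 r * conj t * v c.1 with ha
  set e : ℂ := deriv (P.E c.2) r / P.E c.2 r * conj t * v c.1 ^ 2 with he
  let ξ : Fin n → ℂ := Function.update (a • v) c.1 e
  have hξj : ξ c.1 = e := by simp [ξ]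
  have hξh : hor c ξ = a • hor c v := by
    funext i
    by_cases hi : i = c.1
    · subst hi; simp [hor]
    · simp [hor, ξ, hi]
  have hξ : ∀ b, ∑ a, (P.metric n).coeff c (slicePt c t) a b * ξ a =
      (P.metric n).connForm c (slicePt c t) v b := fun b => by
    have h1 := P.hasWirt_tensor c (slicePt c t) v v (Pi.single b 1)
    have h2 : (fun y => tensor k P.F P.E c y v (Pi.single b 1)) =
        fun y => herm ((P.metric n).coeff c y) v (Pi.single b 1) := funext fun y =>
      (herm_tensorCoeff k P.F P.E c y v _).symm
    rw [h2, rho_slicePt, hr] at h1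
    rw [KahlerMetric.connForm_eq h1, ← KahlerMetric.herm_single_right]
    refine (herm_tensorCoeff k P.F P.E c (slicePt c t) ξ _).trans ?_
    rw [tensor_slicePt, tensorDeriv_slicePt, hr, hξh, hξj, inn_smul_left, ha, he]
    push_cast
    field_simp
    ring
  obtain ⟨p, q, h1⟩ := KahlerMetric.hasLevi_curve (g := P.metric n) (c := c)
    (.of_forall (KahlerMetric.differentiableAt_quadratic (slicePt c t) v 0))
    (by simp) (by rw [KahlerMetric.deriv_quadratic]; simp)
    (KahlerMetric.deriv_deriv_quadratic (slicePt c t) v 0 0) hξ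
  obtain ⟨p', q', h2⟩ := P.hasLevi_line c t v hr hX hY
  have h3 := (h2.congr_of_eventuallyEq (.of_forall fun s => by
    rw [KahlerMetric.deriv_quadratic]
    simp only [smul_zero, add_zero]
    exact herm_tensorCoeff k P.F P.E c _ v v)).unique h1
  have h4 : herm ((P.metric n).coeff c (slicePt c t)) (ξ + 0) (ξ + 0) =
      P.F c.2 r * (a * conj a * Y) + P.E c.2 r * (e * conj e) := by
    rw [add_zero]
    refine (herm_tensorCoeff k P.F P.E c (slicePt c t) ξ ξ).trans ?_
    rw [tensor_slicePt, hr, hξh, hξj, inn_smul_left, ← conj_inn, inn_smul_left, map_mul, conj_inn,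
      inn_hor_hor, hY]
    ring
  rw [h4] at h3
  rw [hr, hX, hY, sliceCurv]
  have h5 : (P.metric n).curvForm c (slicePt c t) v =
      P.F c.2 r * (a * conj a * Y) + P.E c.2 r * (e * conj e) -
      (((deriv (P.E c.2) r + r * deriv (deriv (P.E c.2)) r) * X ^ 2 -
        4 * weight k c.2 * (P.E c.2 r + r * deriv (P.E c.2) r) * X * Y +
        2 * (weight k c.2 ^ 2 * r * P.E c.2 r - P.F c.2 r) * Y ^ 2 : ℝ) : ℂ) := by
    linear_combination h3
  have haa : a * conj a = 4 * weight k c.2 ^ 2 * P.E c.2 r ^ 2 / P.F c.2 r ^ 2 * r * X := by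
    rw [ha]
    simp only [map_mul, map_div₀, map_neg, Complex.conj_ofReal, map_intCast, Complex.conj_conj,
      map_ofNat]
    rw [← ht, ← hv]
    ring
  have hee : e * conj e = deriv (P.E c.2) r ^ 2 / P.E c.2 r ^ 2 * r * X ^ 2 := by
    rw [he]
    simp only [map_mul, map_div₀, map_pow, Complex.conj_ofReal, Complex.conj_conj]
    rw [← ht, ← hv]
    ring
  rw [h5, haa, hee]
  push_cast
  field_simp
  ring

/-- Positivity of the curvature of a metric given by functions of the radius. -/
theorem hasPositiveHolSecCurv_iff (hn : 2 ≤ n) (hk : 1 ≤ k) :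
    (P.metric n).HasPositiveHolSecCurv ↔ ∀ b r, 0 ≤ r → ∀ X Y : ℝ, 0 ≤ X → 0 ≤ Y →
      (X ≠ 0 ∨ Y ≠ 0) → 0 < P.sliceCurv b r X Y := by
  constructor
  · intro h b r hr X Y hX hY hXY
    -- Both a fibre and a base direction are needed to realise arbitrary `X` and `Y`; this is where
    -- `n ≥ 2` enters.
    let j₀ : Fin n := ⟨0, by omega⟩
    let i₀ : Fin n := ⟨1, by omega⟩
    have hij : i₀ ≠ j₀ := by simp [i₀, j₀]
    let v : Fin n → ℂ := Pi.single j₀ ((√X : ℝ) : ℂ) + Pi.single i₀ ((√Y : ℝ) : ℂ)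
    have hvj : v j₀ = ((√X : ℝ) : ℂ) := by simp [v, hij.symm]
    have hvi : v i₀ = ((√Y : ℝ) : ℂ) := by simp [v, hij]
    have hv : v ≠ 0 := by
      intro h0
      rcases hXY with h1 | h1
      · rw [h0] at hvj
        exact h1 ((Real.sqrt_eq_zero hX).1 (Complex.ofReal_eq_zero.1 hvj.symm))
      · rw [h0] at hvi
        exact h1 ((Real.sqrt_eq_zero hY).1 (Complex.ofReal_eq_zero.1 hvi.symm))
    have hYv : baseNormSq (j₀, b) v = Y := by
      rw [baseNormSq, Finset.sum_eq_single i₀]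
      · simp only [hor, Function.update_of_ne hij, hvi]
        rw [Complex.normSq_ofReal, Real.mul_self_sqrt hY]
      · intro i _ hi
        by_cases hij' : i = j₀
        · simp [hor, hij']
        · simp [hor, hij', v, hi]
      · simp
    have h1 := (KahlerMetric.holSecCurv_pos_iff hv).1 (h (j₀, b) (slicePt (j₀, b) (√r : ℝ)) v hv)
    rw [P.curvForm_slicePt, Complex.ofReal_re, hYv, hvj, Complex.normSq_ofReal,
      Complex.normSq_ofReal, Real.mul_self_sqrt hr, Real.mul_self_sqrt hX] at h1
    exact h1
  · intro h
    refine KahlerMetric.hasPositiveHolSecCurv_of_slices hk P.isUnitaryInvariant_metric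
      fun c t ht v hv => ?_
    rw [P.curvForm_slicePt, Complex.ofReal_re]
    refine h _ _ (Complex.normSq_nonneg _) _ _ (Complex.normSq_nonneg _)
      (Finset.sum_nonneg fun i _ => Complex.normSq_nonneg _) ?_
    by_contra! hcon
    refine hv (funext fun i => ?_)
    by_cases hi : i = c.1
    · subst hi; exact Complex.normSq_eq_zero.1 hcon.1
    · have h1 := (Finset.sum_eq_zero_iff_of_nonneg fun i _ => Complex.normSq_nonneg _).1 hcon.2 i
        (Finset.mem_univ i)
      simpa [hor, hi] using h1

end RadialPair

/-! ### The curvature condition on the momentum profile -/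

/-- The curvature form in terms of the momentum profile `φ`. -/
def momForm (k : ℕ) (a l : ℝ) (φ : ℝ → ℝ) (u X Y : ℝ) : ℝ :=
  k / l * -deriv (deriv φ) u * X ^ 2 + 4 * k * (l * φ u / (a + l * u) - deriv φ u) * X * Y +
    2 * (a + l * u - k * l * φ u) * Y ^ 2

theorem contDiff_momentum {e : ℝ → ℝ} (he : ContDiff ℝ ∞ e) (hD : ∀ u, 0 < den e u) :
    ContDiff ℝ ∞ (momentum e) := by
  have h : ContDiff ℝ ∞ fun u : ℝ => u * (1 - u) := contDiff_id.mul (contDiff_const.sub contDiff_id)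
  exact h.div (contDiff_const.sub (h.mul he)) fun u => (hD u).ne'

namespace ProfileData

variable (D : ProfileData) {k : ℕ}

theorem eventually_mul_fibre (k : ℕ) (b : Bool) {r : ℝ} (hr : 0 ≤ r) :
    ∀ᶠ t in 𝓝 r, t * D.fibre k b t = D.l / k * momentum D.e (D.height b t) := by
  filter_upwards [mul_slope (q := D.const b) (D.contDiff_fn b) (D.den_fn_pos b) hr] with t ht
  rw [fibre, mul_left_comm, ht]
  cases b
  · simp only [fn, cond_false]
    rw [momentum_reflectFun]
    rfl
  · rfl

/-- The relation `t E = (l / k) φ(u)` is differentiated twice, using that `u'` is `∓(k / l) E`. This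
turns `E` and its derivatives into `φ` and its derivatives, and the remaining powers of `E` are
absorbed into `X`. -/
theorem sliceCurv_eq (hk : 1 ≤ k) (b : Bool) {r : ℝ} (hr : 0 ≤ r) (X Y : ℝ) :
    (D.radialPair hk).sliceCurv b r X Y =
      momForm k D.a D.l (momentum D.e) (D.height b r) (D.fibre k b r * X) Y := by
  set P := D.radialPair hk with hP
  set φ := momentum D.e with hφ
  have hφs : ContDiff ℝ ∞ φ := contDiff_momentum D.contDiff_e D.den_pos
  have hφ1 : ∀ u, HasDerivAt φ (deriv φ u) u := fun u =>
    (hφs.differentiable (by simp) u).hasDerivAt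
  have hφ2 : ∀ u, HasDerivAt (deriv φ) (deriv (deriv φ) u) u := fun u =>
    ((contDiff_infty_iff_deriv.1 hφs).2.differentiable (by simp) u).hasDerivAt
  have hk0 : (k : ℝ) ≠ 0 := by positivity
  have hl0 := D.l_pos.ne'
  -- The sign by which the two kinds of charts differ. It enters the result only through `ε * ε =
  -- 1`, so both ends give the same form.
  set ε : ℝ := cond b 1 (-1) with hε
  have hε2 : ε * ε = 1 := by cases b <;> simp [hε]
  have hκ : (weight k b : ℝ) = ε * k := by cases b <;> simp [hε, weight]
  set E := D.fibre k b with hE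
  have hEd : ∀ᶠ t in 𝓝 r, HasDerivAt E (deriv E t) t := by
    have : ContDiffAt ℝ 1 E r := (P.contDiffAt_E b r hr).of_le (by exact_mod_cast le_top)
    filter_upwards [this.eventually (by simp)] with t ht using
      (ht.differentiableAt (by simp)).hasDerivAt
  have hhd : ∀ᶠ t in 𝓝 r, HasDerivAt (D.height b) (-(ε * k / D.l * E t)) t := by
    filter_upwards [D.eventually_hasDerivAt_height b hr] with t ht
    refine ht.congr_deriv ?_
    rw [← hε, hE, fibre]
    field_simp
  have h0 : ∀ᶠ t in 𝓝 r, t * E t = D.l / k * φ (D.height b t) := D.eventually_mul_fibre k b hr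
  have h1 : ∀ᶠ t in 𝓝 r, E t + t * deriv E t = -ε * deriv φ (D.height b t) * E t := by
    filter_upwards [h0.eventually_nhds, hEd, hhd] with t ht hEt hht
    have e1 := ((hasDerivAt_id t).mul hEt).congr_of_eventuallyEq
      (f₁ := fun t => D.l / k * φ (D.height b t)) (ht.mono fun s hs => hs.symm)
    have e2 := e1.unique (((hφ1 _).comp t hht).const_mul (D.l / k))
    simp only [id, one_mul] at e2
    rw [e2]
    field_simp
  have h2 : 2 * deriv E r + r * deriv (deriv E) r =
      k / D.l * deriv (deriv φ) (D.height b r) * E r ^ 2 -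
        ε * deriv φ (D.height b r) * deriv E r := by
    have hE2 : HasDerivAt (deriv E) (deriv (deriv E) r) r := P.hasDerivAt_deriv_E b hr
    have hEr := hEd.self_of_nhds
    have e1 := (hEr.add ((hasDerivAt_id r).mul hE2)).congr_of_eventuallyEq
      (f₁ := fun t => -ε * deriv φ (D.height b t) * E t) (h1.mono fun s hs => hs.symm)
    have e2 := e1.unique ((((hφ2 _).comp r hhd.self_of_nhds).const_mul (-ε)).mul hEr)
    simp only [id, one_mul, Function.comp_def] at e2
    have e3 : 2 * deriv E r + r * deriv (deriv E) r =
        deriv E r + (deriv E r + r * deriv (deriv E) r) := by ring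
    rw [e3, e2]
    have e4 : ε * ε * k = k := by rw [hε2, one_mul]
    linear_combination (deriv (deriv φ) (D.height b r) * E r ^ 2 / D.l) * e4
  have h0' := h0.self_of_nhds
  have h1' := h1.self_of_nhds
  have hE0 : E r ≠ 0 := (P.E_pos b r hr).ne'
  have hF0 : D.a + D.l * D.height b r ≠ 0 := (P.F_pos b r hr).ne'
  have hPE : P.E b = E := rfl
  have hPF : P.F b r = D.a + D.l * D.height b r := rfl
  rw [RadialPair.sliceCurv, momForm, hPE, hPF, hκ]
  generalize D.height b r = u at *
  have hA : r * deriv E r ^ 2 / E r - deriv E r - r * deriv (deriv E) r =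
      k / D.l * -deriv (deriv φ) u * E r ^ 2 := by
    have : r * deriv E r ^ 2 / E r = (-ε * deriv φ u - 1) * deriv E r := by
      field_simp
      linear_combination deriv E r * h1'
    rw [this]
    linear_combination -h2
  have hB : ε * k * (E r + r * deriv E r + ε * k * r * E r ^ 2 / (D.a + D.l * u)) =
      k * (D.l * φ u / (D.a + D.l * u) - deriv φ u) * E r := by
    have : ε * k * r * E r ^ 2 / (D.a + D.l * u) = ε * D.l * φ u / (D.a + D.l * u) * E r := by
      have e4 : r * E r * k = D.l * φ u := by rw [h0']; field_simp
      rw [show ε * k * r * E r ^ 2 = ε * (r * E r * k) * E r by ring, e4]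
      ring
    rw [h1', this]
    linear_combination (k * E r * (D.l * φ u / (D.a + D.l * u) - deriv φ u)) * hε2
  have hC : (ε * k) ^ 2 * r * E r = k * D.l * φ u := by
    have e4 : r * E r * k = D.l * φ u := by rw [h0']; field_simp
    linear_combination (k ^ 2 * r * E r) * hε2 + k * e4
  rw [hA, hC]
  linear_combination (4 * X * Y) * hB

/-- The value `u = 0` corresponds to `r = ∞` and is attained only in the charts at the other end. -/
theorem exists_height_eq {u : ℝ} (h0 : 0 ≤ u) (h1 : u ≤ 1) :
    ∃ b r, 0 ≤ r ∧ D.height b r = u := by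
  rcases h0.eq_or_lt with rfl | h0
  · refine ⟨false, 0, le_rfl, ?_⟩
    simp only [height, cond_false]
    rw [profile_zero (D.contDiff_fn _) (D.den_fn_pos _), sub_self]
  · refine ⟨true, radius D.q D.e u, ?_, profile_radius D.contDiff_e D.den_pos h0⟩
    exact mul_nonneg (div_nonneg (sub_nonneg.2 h1) h0.le) (Real.exp_pos _).le

/-- The curvature condition for profile data. -/
def IsPositive (k : ℕ) : Prop :=
  ∀ u, 0 ≤ u → u ≤ 1 → ∀ X Y : ℝ, 0 ≤ X → 0 ≤ Y → (X ≠ 0 ∨ Y ≠ 0) →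
    0 < momForm k D.a D.l (momentum D.e) u X Y

theorem hasPositiveHolSecCurv_iff (hn : 2 ≤ n) (hk : 1 ≤ k) :
    (D.metric hk n).HasPositiveHolSecCurv ↔ D.IsPositive k := by
  refine ((D.radialPair hk).hasPositiveHolSecCurv_iff hn hk).trans ⟨fun h u h0 h1 X Y hX hY hXY => ?_,
    fun h b r hr X Y hX hY hXY => ?_⟩
  · obtain ⟨b, r, hr, rfl⟩ := D.exists_height_eq h0 h1
    have hE : 0 < D.fibre k b r := (D.radialPair hk).E_pos b r hr
    have := h b r hr (X / D.fibre k b r) Y (by positivity) hY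
      (hXY.imp (fun h => div_ne_zero h hE.ne') id)
    rwa [D.sliceCurv_eq hk b hr, mul_div_cancel₀ _ hE.ne'] at this
  · have hE : 0 < D.fibre k b r := (D.radialPair hk).E_pos b r hr
    rw [D.sliceCurv_eq hk b hr]
    exact h _ (D.height_nonneg b hr) (D.height_le_one b hr) _ _ (by positivity) hY
      (hXY.imp (fun h => mul_ne_zero hE.ne' h) id)

end ProfileData

/-! ### Interpolation of momentum profiles -/

/-- The function `e` whose momentum profile is `(1 - τ) φ₀ + τ φ₁`. -/
def interp (e₀ e₁ : ℝ → ℝ) (τ u : ℝ) : ℝ :=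
  ((1 - τ) * e₀ u + τ * e₁ u - u * (1 - u) * e₀ u * e₁ u) / ((1 - τ) * den e₁ u + τ * den e₀ u)

section Interp

variable {e₀ e₁ : ℝ → ℝ} {τ : ℝ}

theorem interp_den_pos (h₀ : ∀ u, 0 < den e₀ u) (h₁ : ∀ u, 0 < den e₁ u)
    (hτ₀ : 0 ≤ τ) (hτ₁ : τ ≤ 1) (u : ℝ) : 0 < (1 - τ) * den e₁ u + τ * den e₀ u := by
  rcases hτ₀.eq_or_lt with rfl | h
  · simpa using h₁ u
  · have := mul_nonneg (sub_nonneg.2 hτ₁) (h₁ u).le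
    have := mul_pos h (h₀ u)
    linarith

/-- Averaging `u (1 - u) / den` means averaging `1 / den`, so the new denominator is a weighted
harmonic mean; `interp` is what solving for `e` gives. -/
theorem den_interp (h₀ : ∀ u, 0 < den e₀ u) (h₁ : ∀ u, 0 < den e₁ u)
    (hτ₀ : 0 ≤ τ) (hτ₁ : τ ≤ 1) (u : ℝ) : den (interp e₀ e₁ τ) u =
    den e₀ u * den e₁ u / ((1 - τ) * den e₁ u + τ * den e₀ u) := by
  have h := (interp_den_pos h₀ h₁ hτ₀ hτ₁ u).ne'
  rw [eq_div_iff h]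
  conv_lhs => rw [den, interp]
  rw [sub_mul, mul_assoc, div_mul_cancel₀ _ h]
  simp only [den]
  ring

theorem den_interp_pos (h₀ : ∀ u, 0 < den e₀ u) (h₁ : ∀ u, 0 < den e₁ u)
    (hτ₀ : 0 ≤ τ) (hτ₁ : τ ≤ 1) (u : ℝ) : 0 < den (interp e₀ e₁ τ) u := by
  rw [den_interp h₀ h₁ hτ₀ hτ₁]
  exact div_pos (mul_pos (h₀ u) (h₁ u)) (interp_den_pos h₀ h₁ hτ₀ hτ₁ u)

theorem momentum_interp (h₀ : ∀ u, 0 < den e₀ u) (h₁ : ∀ u, 0 < den e₁ u)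
    (hτ₀ : 0 ≤ τ) (hτ₁ : τ ≤ 1) : momentum (interp e₀ e₁ τ) =
    fun u => (1 - τ) * momentum e₀ u + τ * momentum e₁ u := by
  funext u
  have := interp_den_pos h₀ h₁ hτ₀ hτ₁ u
  have := h₀ u
  have := h₁ u
  rw [momentum, momentum, momentum, den_interp h₀ h₁ hτ₀ hτ₁]
  field_simp

theorem contDiff_interp (h₀ : ∀ u, 0 < den e₀ u) (h₁ : ∀ u, 0 < den e₁ u)
    (he₀ : ContDiff ℝ ∞ e₀) (he₁ : ContDiff ℝ ∞ e₁) :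
    ContDiff ℝ ∞ fun p : ℝ × ℝ => interp e₀ e₁ (Real.smoothTransition p.1) p.2 := by
  have hτ : ContDiff ℝ ∞ fun p : ℝ × ℝ => Real.smoothTransition p.1 :=
    Real.smoothTransition.contDiff.comp contDiff_fst
  have h0 : ContDiff ℝ ∞ fun p : ℝ × ℝ => e₀ p.2 := he₀.comp contDiff_snd
  have h1 : ContDiff ℝ ∞ fun p : ℝ × ℝ => e₁ p.2 := he₁.comp contDiff_snd
  have hw : ContDiff ℝ ∞ fun p : ℝ × ℝ => p.2 * (1 - p.2) :=
    contDiff_snd.mul (contDiff_const.sub contDiff_snd)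
  have hτ' := contDiff_const (c := (1 : ℝ)).sub hτ
  refine ContDiff.div (((hτ'.mul h0).add (hτ.mul h1)).sub ((hw.mul h0).mul h1))
    ((hτ'.mul (contDiff_const.sub (hw.mul h1))).add (hτ.mul (contDiff_const.sub (hw.mul h0))))
    fun p => ?_
  exact (interp_den_pos h₀ h₁ (Real.smoothTransition.nonneg _) (Real.smoothTransition.le_one _)
    p.2).ne'

theorem interp_zero (h₁ : ∀ u, 0 < den e₁ u) : interp e₀ e₁ 0 = e₀ := by
  funext u
  have := h₁ u
  rw [interp, div_eq_iff (by simpa using this.ne')]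
  simp only [den]
  ring

theorem interp_one (h₀ : ∀ u, 0 < den e₀ u) : interp e₀ e₁ 1 = e₁ := by
  funext u
  have := h₀ u
  rw [interp, div_eq_iff (by simpa using this.ne')]
  simp only [den]
  ring

end Interp

/-- With `a` and `l` fixed every coefficient of the form is affine in `φ` and its derivatives. This
is the convexity behind path-connectedness. -/
theorem momForm_convexComb (k : ℕ) (a l τ : ℝ) {φ₀ φ₁ : ℝ → ℝ} (h₀ : ContDiff ℝ ∞ φ₀)
    (h₁ : ContDiff ℝ ∞ φ₁) (u X Y : ℝ) :
    momForm k a l (fun u => (1 - τ) * φ₀ u + τ * φ₁ u) u X Y =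
      (1 - τ) * momForm k a l φ₀ u X Y + τ * momForm k a l φ₁ u X Y := by
  have hd : ∀ {φ₀ φ₁ : ℝ → ℝ}, ContDiff ℝ ∞ φ₀ → ContDiff ℝ ∞ φ₁ →
      deriv (fun u => (1 - τ) * φ₀ u + τ * φ₁ u) = fun u => (1 - τ) * deriv φ₀ u + τ * deriv φ₁ u :=
    fun h₀ h₁ => funext fun u =>
      (((h₀.differentiable (by simp) u).hasDerivAt.const_mul _).add
        ((h₁.differentiable (by simp) u).hasDerivAt.const_mul _)).deriv
  rw [momForm, hd h₀ h₁, hd (contDiff_infty_iff_deriv.1 h₀).2 (contDiff_infty_iff_deriv.1 h₁).2]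
  simp only [momForm]
  ring

/-! ### A model profile -/

/-- With `w = u (1 - u)` and `m = 1 + C w`, the model has `φ = w / m`, `φ' = (1 - 2 u) / m ^ 2` and
`-φ'' = (2 m + 2 C (1 - 2 u) ^ 2) / m ^ 3`. Only `-φ' X Y` can be negative. A large `C` makes the `X
^ 2` coefficient dominate `φ' ^ 2` and keeps the `Y ^ 2` coefficient above `a`, so the square can be
completed. -/
theorem momForm_model_pos {k : ℕ} (hk : 1 ≤ k) {a l C : ℝ} (ha : 0 < a) (hl : 0 < l)
    (hC : 2 * k * l ≤ C * a) {e : ℝ → ℝ} (hD : ∀ u, 0 < den e u) {u : ℝ} (h0 : 0 ≤ u) (h1 : u ≤ 1)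
    (he : e =ᶠ[𝓝 u] fun _ => -C) {X Y : ℝ} (hX : 0 ≤ X) (hY : 0 ≤ Y) (hXY : X ≠ 0 ∨ Y ≠ 0) :
    0 < momForm k a l (momentum e) u X Y := by
  have hk0 : (0 : ℝ) < k := by exact_mod_cast hk
  have hC0 : 0 < C := pos_of_mul_pos_left (lt_of_lt_of_le (by positivity) hC) ha.le
  have hm : ∀ᶠ v in 𝓝 u, 0 < 1 + C * (v * (1 - v)) ∧
      momentum e v = v * (1 - v) / (1 + C * (v * (1 - v))) := by
    filter_upwards [he] with v hv
    have hden : den e v = 1 + C * (v * (1 - v)) := by rw [den, hv]; ring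
    exact ⟨hden ▸ hD v, by rw [momentum, hden]⟩
  have hw : ∀ v : ℝ, HasDerivAt (fun v : ℝ => v * (1 - v)) (1 - 2 * v) v := fun v =>
    ((hasDerivAt_id v).mul ((hasDerivAt_id v).const_sub 1)).congr_deriv (by simp; ring)
  have hM : ∀ v : ℝ, HasDerivAt (fun v : ℝ => 1 + C * (v * (1 - v))) (C * (1 - 2 * v)) v :=
    fun v => ((hw v).const_mul C).const_add 1
  have hd1 : ∀ᶠ v in 𝓝 u, deriv (momentum e) v = (1 - 2 * v) / (1 + C * (v * (1 - v))) ^ 2 := by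
    filter_upwards [hm.eventually_nhds] with v hv
    have hv0 := hv.self_of_nhds.1
    have h2 := ((hw v).div (hM v) hv0.ne').congr_of_eventuallyEq (hv.mono fun s hs => hs.2)
    rw [h2.deriv]
    congr 1
    ring
  set w := u * (1 - u) with hw_def
  set m := 1 + C * w with hm_def
  set d := 1 - 2 * u with hd_def
  have hw0 : 0 ≤ w := mul_nonneg h0 (sub_nonneg.2 h1)
  have hm1 : 1 ≤ m := by have := mul_nonneg hC0.le hw0; linarith
  have hm0 : 0 < m := by linarith
  have hd2 : deriv (deriv (momentum e)) u = -((2 * m + 2 * C * d ^ 2) / m ^ 3) := by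
    have h3 : HasDerivAt (fun v : ℝ => 1 - 2 * v) (-2) u :=
      (((hasDerivAt_id u).const_mul 2).const_sub 1).congr_deriv (by simp)
    have h2 := (h3.div ((hM u).pow 2) (pow_ne_zero 2 hm0.ne')).congr_of_eventuallyEq hd1
    rw [h2.deriv]
    simp only [Pi.pow_apply]
    rw [← hw_def, ← hm_def, ← hd_def]
    field_simp
    push_cast
    ring
  have hF : 0 < a + l * u := by positivity
  rw [momForm, hd2, hd1.self_of_nhds, hm.self_of_nhds.2, neg_neg, ← hw_def, ← hm_def, ← hd_def]
  set p := d / m ^ 2 with hp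
  -- The hypothesis gives `4 k² / a ≤ 2 k C / l`, and `m ≥ 1` gives `p ^ 2 ≤ d ^ 2 / m ^ 3`. The
  -- first summand is left over for strict positivity.
  have hA : 2 * k / (l * m ^ 2) + 4 * k ^ 2 * p ^ 2 / a ≤
      k / l * ((2 * m + 2 * C * d ^ 2) / m ^ 3) := by
    have e1 : k / l * ((2 * m + 2 * C * d ^ 2) / m ^ 3) =
        2 * k / (l * m ^ 2) + 2 * k * C / l * (d ^ 2 / m ^ 3) := by
      field_simp
    have e2 : 4 * k ^ 2 / a ≤ 2 * k * C / l := by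
      rw [div_le_div_iff₀ ha hl]
      nlinarith
    have e3 : p ^ 2 ≤ d ^ 2 / m ^ 3 := by
      rw [hp, div_pow, ← pow_mul]
      exact div_le_div_of_nonneg_left (sq_nonneg d) (by positivity)
        (pow_le_pow_right₀ hm1 (by norm_num))
    have e4 := mul_le_mul e2 e3 (sq_nonneg p) (by positivity)
    rw [e1, show 4 * (k : ℝ) ^ 2 * p ^ 2 / a = 4 * k ^ 2 / a * p ^ 2 by ring]
    linarith
  -- Since `k l ≤ C a / 2` and `C w ≤ m`, the subtracted term is at most `a / 2`.
  have hCc : a ≤ 2 * (a + l * u - k * l * (w / m)) := by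
    have e1 : k * l * (w / m) ≤ a / 2 := by
      rw [mul_div_assoc', div_le_iff₀ hm0]
      have := mul_le_mul_of_nonneg_right hC hw0
      nlinarith
    have : 0 ≤ l * u := by positivity
    linarith
  have hB : 0 ≤ l * (w / m) / (a + l * u) := by positivity
  have hsq : 4 * k ^ 2 * p ^ 2 / a * X ^ 2 - 4 * k * p * X * Y + a * Y ^ 2 =
      (2 * k * p * X - a * Y) ^ 2 / a := by
    field_simp
    ring
  have hlow : 2 * k / (l * m ^ 2) * X ^ 2 + (2 * k * p * X - a * Y) ^ 2 / a ≤
      k / l * ((2 * m + 2 * C * d ^ 2) / m ^ 3) * X ^ 2 +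
        4 * k * (l * (w / m) / (a + l * u) - p) * X * Y +
        2 * (a + l * u - k * l * (w / m)) * Y ^ 2 := by
    have e1 := mul_le_mul_of_nonneg_right hA (sq_nonneg X)
    have e2 := mul_le_mul_of_nonneg_right hCc (sq_nonneg Y)
    have e3 : 0 ≤ 4 * k * (l * (w / m) / (a + l * u)) * X * Y := by positivity
    rw [← hsq]
    linarith
  refine lt_of_lt_of_le ?_ hlow
  by_cases hX0 : X = 0
  · have hY0 := hXY.resolve_left (fun h => h hX0)
    rw [hX0]
    have : (2 * k * p * 0 - a * Y) ^ 2 / a = a * Y ^ 2 := by field_simp; ring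
    rw [this]
    positivity
  · positivity

/-- The constant `-C` has `den ≥ 1` on `[0, 1]` but may fail outside, so it is cut off away from the
interval. -/
theorem exists_model {C : ℝ} (hC : 0 ≤ C) : ∃ e : ℝ → ℝ, ContDiff ℝ ∞ e ∧ (∀ u, 0 < den e u) ∧
    ∀ u ∈ Set.Icc (0 : ℝ) 1, e =ᶠ[𝓝 u] fun _ => -C := by
  refine exists_extension_den_pos isOpen_univ (Set.subset_univ _) contDiffOn_const fun u hu => ?_
  have := mul_nonneg (mul_nonneg hu.1 (sub_nonneg.2 hu.2)) hC
  simp only [den]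
  linarith

/-! ### Paths of metrics -/

/-- The invariant Kähler metrics of positive holomorphic sectional curvature. -/
def positiveMetrics (n k : ℕ) : Set (KahlerMetric n k) :=
  {g | g.IsUnitaryInvariant ∧ g.HasPositiveHolSecCurv}

/-! ### Joining metrics through families of profile data. -/

namespace ProfileData

variable {k : ℕ}

theorem metric_mem_iff (hn : 2 ≤ n) (hk : 1 ≤ k) (D : ProfileData) :
    D.metric hk n ∈ positiveMetrics n k ↔ D.IsPositive k := by
  rw [← D.hasPositiveHolSecCurv_iff hn hk]
  exact and_iff_right (D.radialPair hk).isUnitaryInvariant_metric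

theorem joinedIn_of_family (hn : 2 ≤ n) (hk : 1 ≤ k) {D : ℝ → ProfileData}
    (ha : ContDiff ℝ ∞ fun s => (D s).a) (hl : ContDiff ℝ ∞ fun s => (D s).l)
    (hq : ContDiff ℝ ∞ fun s => (D s).q) (he : ContDiff ℝ ∞ fun p : ℝ × ℝ => (D p.1).e p.2)
    (hD : ∀ s, (D s).IsPositive k) :
    JoinedIn (positiveMetrics n k) ((D 0).metric hk n) ((D 1).metric hk n) := by
  refine JoinedIn.ofLine (continuous_profileData_metric hk ha hl hq he).continuousOn rfl rfl ?_
  rintro _ ⟨s, -, rfl⟩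
  exact (metric_mem_iff hn hk _).2 (hD s)

/-- The smooth transition stays in `[0, 1]` for every real parameter, so the families below are
smooth and positive over the whole line. -/
theorem contDiff_lineMap_smoothTransition (x y : ℝ) :
    ContDiff ℝ ∞ fun s => (1 - Real.smoothTransition s) * x + Real.smoothTransition s * y :=
  ((contDiff_const.sub Real.smoothTransition.contDiff).mul contDiff_const).add
    (Real.smoothTransition.contDiff.mul contDiff_const)

theorem convexComb_pos {x y : ℝ} (hx : 0 < x) (hy : 0 < y) (s : ℝ) :
    0 < (1 - Real.smoothTransition s) * x + Real.smoothTransition s * y := by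
  have h0 := Real.smoothTransition.nonneg s
  have h1 := Real.smoothTransition.le_one s
  rcases h0.eq_or_lt with h | h
  · rw [← h]; simpa using hx
  · have := mul_nonneg (sub_nonneg.2 h1) hx.le
    have := mul_pos h hy
    linarith

/-- Data with the same range are joined by interpolating the momentum profiles. -/
theorem joinedIn_of_range_eq (hn : 2 ≤ n) (hk : 1 ≤ k) {D₀ D₁ : ProfileData} (ha : D₁.a = D₀.a)
    (hl : D₁.l = D₀.l) (h₀ : D₀.IsPositive k) (h₁ : D₁.IsPositive k) :
    JoinedIn (positiveMetrics n k) (D₀.metric hk n) (D₁.metric hk n) := by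
  have hτ₀ := Real.smoothTransition.nonneg
  have hτ₁ := Real.smoothTransition.le_one
  have hsm := contDiff_interp D₀.den_pos D₁.den_pos D₀.contDiff_e D₁.contDiff_e
  let D : ℝ → ProfileData := fun s =>
    { a := D₀.a
      l := D₀.l
      -- The curvature condition does not involve `q`, which may be moved freely.
      q := (1 - Real.smoothTransition s) * D₀.q + Real.smoothTransition s * D₁.q
      e := interp D₀.e D₁.e (Real.smoothTransition s)
      a_pos := D₀.a_pos
      l_pos := D₀.l_pos
      contDiff_e := hsm.comp (contDiff_const.prodMk contDiff_id)
      den_pos := den_interp_pos D₀.den_pos D₁.den_pos (hτ₀ s) (hτ₁ s) }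
  have hD0 : D 0 = D₀ := by
    ext1 <;> simp [D, interp_zero D₁.den_pos]
  have hD1 : D 1 = D₁ := by
    ext1 <;> simp [D, interp_one D₀.den_pos, ha, hl]
  rw [← hD0, ← hD1]
  refine joinedIn_of_family hn hk contDiff_const contDiff_const
    (contDiff_lineMap_smoothTransition _ _) hsm fun s u hu0 hu1 X Y hX hY hXY => ?_
  change 0 < momForm k D₀.a D₀.l (momentum (interp D₀.e D₁.e (Real.smoothTransition s))) u X Y
  rw [momentum_interp D₀.den_pos D₁.den_pos (hτ₀ s) (hτ₁ s),
    momForm_convexComb k D₀.a D₀.l _ (contDiff_momentum D₀.contDiff_e D₀.den_pos)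
      (contDiff_momentum D₁.contDiff_e D₁.den_pos)]
  have e1 := h₁ u hu0 hu1 X Y hX hY hXY
  rw [ha, hl] at e1
  exact convexComb_pos (h₀ u hu0 hu1 X Y hX hY hXY) e1 s

/-- Model data with the same `C` are joined by moving the range. -/
theorem joinedIn_model (hn : 2 ≤ n) (hk : 1 ≤ k) {C : ℝ} {D₀ D₁ : ProfileData} (hq : D₁.q = D₀.q)
    (he : D₁.e = D₀.e) (hC : ∀ u ∈ Set.Icc (0 : ℝ) 1, D₀.e =ᶠ[𝓝 u] fun _ => -C)
    (h₀ : 2 * k * D₀.l ≤ C * D₀.a) (h₁ : 2 * k * D₁.l ≤ C * D₁.a) :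
    JoinedIn (positiveMetrics n k) (D₀.metric hk n) (D₁.metric hk n) := by
  let D : ℝ → ProfileData := fun s =>
    { a := (1 - Real.smoothTransition s) * D₀.a + Real.smoothTransition s * D₁.a
      l := (1 - Real.smoothTransition s) * D₀.l + Real.smoothTransition s * D₁.l
      q := D₀.q
      e := D₀.e
      a_pos := convexComb_pos D₀.a_pos D₁.a_pos s
      l_pos := convexComb_pos D₀.l_pos D₁.l_pos s
      contDiff_e := D₀.contDiff_e
      den_pos := D₀.den_pos }
  have hD0 : D 0 = D₀ := by ext1 <;> simp [D]
  have hD1 : D 1 = D₁ := by ext1 <;> simp [D, hq, he]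
  rw [← hD0, ← hD1]
  refine joinedIn_of_family hn hk (contDiff_lineMap_smoothTransition _ _)
    (contDiff_lineMap_smoothTransition _ _) contDiff_const (D₀.contDiff_e.comp contDiff_snd)
    fun s u hu0 hu1 X Y hX hY hXY => ?_
  refine momForm_model_pos hk (D s).a_pos (D s).l_pos ?_ (D s).den_pos hu0 hu1 (hC u ⟨hu0, hu1⟩)
    hX hY hXY
  -- The condition `2 k l ≤ C a` is linear in `(a, l)`, hence holds along the segment.
  have e1 := mul_le_mul_of_nonneg_left h₀ (sub_nonneg.2 (Real.smoothTransition.le_one s))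
  have e2 := mul_le_mul_of_nonneg_left h₁ (Real.smoothTransition.nonneg s)
  simp only [D]
  linarith

end ProfileData

theorem isPathConnected_positiveMetrics {k : ℕ} (hn : 2 ≤ n) (hk : 1 ≤ k) :
    IsPathConnected (positiveMetrics n k) := by
  obtain ⟨e₀, he₀, hD₀, heq₀⟩ := exists_model (C := 2 * k) (by positivity)
  let D₀ : ProfileData := ⟨1, 1, 0, e₀, one_pos, one_pos, he₀, hD₀⟩
  have h₀ : D₀.IsPositive k := fun u hu0 hu1 X Y hX hY hXY =>
    momForm_model_pos hk one_pos one_pos (C := 2 * k) (by simp) hD₀ hu0 hu1 (heq₀ u ⟨hu0, hu1⟩)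
      hX hY hXY
  refine ⟨D₀.metric hk n, (D₀.metric_mem_iff hn hk).2 h₀, fun {g} hg => ?_⟩
  obtain ⟨D, rfl⟩ := g.exists_profileData hn hk hg.1
  have hD := (D.metric_mem_iff hn hk).1 hg
  have ha := D.a_pos
  have hl := D.l_pos
  -- Large enough for the model to be positive both for the range of `D` and for `a = l = 1`.
  set C : ℝ := max (2 * k) (2 * k * D.l / D.a)
  have hCa : 2 * k * D.l ≤ C * D.a := (div_le_iff₀ ha).1 (le_max_right _ _)
  have hC1 : 2 * k * 1 ≤ C * 1 := by
    rw [mul_one, mul_one]; exact le_max_left _ _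
  obtain ⟨e, he, hDe, heq⟩ := exists_model (C := C) (le_trans (by positivity) (le_max_left _ _))
  let M₀ : ProfileData := ⟨1, 1, 0, e, one_pos, one_pos, he, hDe⟩
  let M : ProfileData := ⟨D.a, D.l, 0, e, ha, hl, he, hDe⟩
  have hM₀ : M₀.IsPositive k := fun u hu0 hu1 X Y hX hY hXY =>
    momForm_model_pos hk one_pos one_pos hC1 hDe hu0 hu1 (heq u ⟨hu0, hu1⟩) hX hY hXY
  have hM : M.IsPositive k := fun u hu0 hu1 X Y hX hY hXY =>
    momForm_model_pos hk ha hl hCa hDe hu0 hu1 (heq u ⟨hu0, hu1⟩) hX hY hXY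
  -- The base point `D₀` must not depend on the metric while `C` does, hence the extra link from
  -- `D₀` to `M₀`.
  exact ((ProfileData.joinedIn_of_range_eq hn hk (D₀ := D₀) (D₁ := M₀) rfl rfl h₀ hM₀).trans
    (ProfileData.joinedIn_model hn hk (D₀ := M₀) (D₁ := M) rfl rfl heq hC1 hCa)).trans
    (ProfileData.joinedIn_of_range_eq hn hk (D₀ := M) (D₁ := D) rfl rfl hM hD)

end Hirzebruch

end

/-- For `n ≥ 2` and `k ≥ 1` the space of all `U(n)`-invariant Kähler metrics with positive
holomorphic sectional curvature on `M_{n,k}` is (non-empty and) path-connected in the `C^∞`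
topology. -/
theorem mainTheorem3 (n k : ℕ) (hn : 2 ≤ n) (hk : 1 ≤ k) :
    IsPathConnected {g : Hirzebruch.KahlerMetric n k |
      g.IsUnitaryInvariant ∧ g.HasPositiveHolSecCurv} := by
  exact Hirzebruch.isPathConnected_positiveMetrics hn hk
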